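/- Running times are on a word RAM: a machine with registers and a memory of $w$-bit words, whose addresses are words, on which each elementary operation on words (arithmetic $+,-,\times$ modulo $2^w$, integer division and remainder, comparison, indirect load and store, conditional branch) takes unit time. The input consists of $n$ distinct positive integers (the set $S$, in any order, one per word) and an integer $u\ge 0$; memory is otherwise zero initially. The words are large enough to hold the elements of $S$, and $2^w\ge (n+u+2)^c$ for an absolute constant $c$. Programs do not depend on $w$ and are correct, within the stated time, for every such $w$. Output numbers are written in binary, one bit per memory cell, in rows of a common length that the program reports. 1. There is a program that, given a set $S$ of $n$ positive integers and $u\ge 0$, computes the function $$N_{u,S}(x)=\#\Bigl\{T\subseteq S : \sum_{s\in T}s=x\Bigr\},\qquad 0\le x\le u,$$ in $O(n\,u\,\log u\,\log n)$ time, with an absolute implied constant; here each of the factors $n$, $u$, $\log_2 u$, $\log_2 n$ is replaced by $1$ when it is smaller than $1$ (or undefined), so that for $n,u\ge 2$ the bound is literal. 2. There is a program that, given such $S$ and $u$, computes in $\widetilde O(nu)$ time, that is, in at most $C\,n\,u\,(\log_2 (nu))^{k}$ time for absolute constants $C,k$ (with the same convention on factors smaller than $1$), the Banzhaf indices of all voters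 in the weighted voting game whose $n$ voters have as weights the elements of $S$ and in which a coalition wins if and only if its total weight is at least $u$. For the voter of weight $s\in S$ let $$\eta_s=\#\Bigl\{T\subseteq S\setminus\{s\} : \sum_{r\in T}r<u\le s+\sum_{r\in T}r\Bigr\}.$$ Its Banzhaf index is $\eta_s/2^{n-1}$, and its normalized Banzhaf index is $\eta_s/\sum_{r\in S}\eta_r$ (read as $0$ if all $\eta_r$ vanish). The program outputs, in the order of the input, an integer numerator for each voter, followed by one integer, such that the numerator divided by $2^{n-1}$ is the voter's Banzhaf index and the numerator divided by the last integer is its normalized Banzhaf index (a quotient with denominator $0$ being read as $0$). -/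

import Mathlib

/- A word RAM with `w`-bit words, programmed in a structured language.  The registers and the memory
cells hold words, that is, natural numbers below `2 ^ w`; a memory address is a word.  Each
elementary operation on words (arithmetic modulo `2 ^ w`, comparison, indirect load and store,
conditional jump) takes one unit of time. -/
namespace WordRAM

inductive Op where
  | add | sub | mul | div | mod | lt | eq

/-- Operations on `w`-bit words; `add`, `sub`, `mul` wrap around, comparisons return `0` or `1`. -/
def Op.eval (w : ℕ) : Op → ℕ → ℕ → ℕ
  | .add, a, b => (a + b) % 2 ^ w
  | .sub, a, b => (a + (2 ^ w - b)) % 2 ^ w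
  | .mul, a, b => (a * b) % 2 ^ w
  | .div, a, b => a / b
  | .mod, a, b => a % b
  | .lt, a, b => (if a < b then 1 else 0) % 2 ^ w
  | .eq, a, b => (if a = b then 1 else 0) % 2 ^ w

structure State where
  reg : ℕ → ℕ
  mem : ℕ → ℕ

inductive Expr where
  | const (k : ℕ)
  | reg (r : ℕ)
  | load (addr : Expr)
  | op (o : Op) (e₁ e₂ : Expr)

def Expr.eval (w : ℕ) (σ : State) : Expr → ℕ
  | .const k => k % 2 ^ w
  | .reg r => σ.reg r
  | .load e => σ.mem (e.eval w σ)
  | .op o e₁ e₂ => o.eval w (e₁.eval w σ) (e₂.eval w σ)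

/-- The time to evaluate an expression: the number of its nodes. -/
def Expr.cost : Expr → ℕ
  | .const _ => 1
  | .reg _ => 1
  | .load e => e.cost + 1
  | .op _ e₁ e₂ => e₁.cost + e₂.cost + 1

inductive Cmd where
  | nop
  | assign (r : ℕ) (e : Expr)
  | store (addr e : Expr)
  | seq (p q : Cmd)
  | cond (b : Expr) (p q : Cmd)
  | loop (b : Expr) (p : Cmd)

/-- `Exec w p σ t σ'`: on words of `w` bits, the program `p` started in the state `σ` halts after
exactly `t` units of time in the state `σ'`. A condition is true if its value is nonzero. -/
inductive Exec (w : ℕ) : Cmd → State → ℕ → State → Prop where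
  | nop (σ : State) : Exec w .nop σ 1 σ
  | assign (σ : State) (r : ℕ) (e : Expr) :
      Exec w (.assign r e) σ (e.cost + 1) ⟨Function.update σ.reg r (e.eval w σ), σ.mem⟩
  | store (σ : State) (a e : Expr) :
      Exec w (.store a e) σ (a.cost + e.cost + 1)
        ⟨σ.reg, Function.update σ.mem (a.eval w σ) (e.eval w σ)⟩
  | seq {σ₀ σ₁ σ₂ : State} {p q : Cmd} {t₁ t₂ : ℕ} (h₁ : Exec w p σ₀ t₁ σ₁)
      (h₂ : Exec w q σ₁ t₂ σ₂) : Exec w (.seq p q) σ₀ (t₁ + t₂) σ₂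
  | condTrue {σ σ' : State} {b : Expr} {p q : Cmd} {t : ℕ} (hb : b.eval w σ ≠ 0)
      (h : Exec w p σ t σ') : Exec w (.cond b p q) σ (b.cost + 1 + t) σ'
  | condFalse {σ σ' : State} {b : Expr} {p q : Cmd} {t : ℕ} (hb : b.eval w σ = 0)
      (h : Exec w q σ t σ') : Exec w (.cond b p q) σ (b.cost + 1 + t) σ'
  | loopTrue {σ₀ σ₁ σ₂ : State} {b : Expr} {p : Cmd} {t₁ t₂ : ℕ} (hb : b.eval w σ₀ ≠ 0)
      (h₁ : Exec w p σ₀ t₁ σ₁) (h₂ : Exec w (.loop b p) σ₁ t₂ σ₂) :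
      Exec w (.loop b p) σ₀ (b.cost + 1 + t₁ + t₂) σ₂
  | loopFalse {σ : State} {b : Expr} {p : Cmd} (hb : b.eval w σ = 0) :
      Exec w (.loop b p) σ (b.cost + 1) σ

/-- The initial state: the list `l` in the memory cells `0, …, l.length - 1`, its length in
register `0`, the number `u` in register `1`, and zeros everywhere else. -/
def initState (l : List ℕ) (u : ℕ) : State where
  reg := fun r => if r = 0 then l.length else if r = 1 then u else 0
  mem := fun a => l.getD a 0

/-- The `L` cells from address `a` on hold the number `v` in binary, one bit per cell, least
significant bit first. -/
def HoldsBinary (mem : ℕ → ℕ) (a L v : ℕ) : Prop :=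
  v < 2 ^ L ∧ ∀ i < L, mem (a + i) = (v.testBit i).toNat

/-- In the final state `σ`, the memory holds a table whose rows `0, …, m - 1` are the binary
numbers `f 0, …, f (m - 1)`. The address of the table is in register `0`, the common length of its
rows in register `1`. -/
def HoldsTable (σ : State) (m : ℕ) (f : ℕ → ℕ) : Prop :=
  ∀ x < m, HoldsBinary σ.mem (σ.reg 0 + x * σ.reg 1) (σ.reg 1) (f x)

end WordRAM

/-- The number of subsets of `S` that sum up to `x`. -/
def subsetSumCount (S : Finset ℕ) (x : ℕ) : ℕ :=
  (S.powerset.filter fun T => ∑ s ∈ T, s = x).card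

/-- The number of swings of the voter of weight `s` in the weighted voting game in which the voters
have the weights in `S` and a coalition wins when its total weight is at least `u`: the number of
losing coalitions without this voter that win once the voter joins. -/
def swingCount (S : Finset ℕ) (u s : ℕ) : ℕ :=
  ((S.erase s).powerset.filter fun T => ∑ r ∈ T, r < u ∧ u ≤ ∑ r ∈ insert s T, r).card

/-- The (absolute) Banzhaf index: the fraction of the coalitions of the other voters for which the
voter is decisive. -/
def banzhafIndex (S : Finset ℕ) (u s : ℕ) : ℚ :=
  (swingCount S u s : ℚ) / 2 ^ (S.card - 1)

/-- The normalized Banzhaf index: the voter's share of all swings (`0` if there are no swings). -/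
def normalizedBanzhafIndex (S : Finset ℕ) (u s : ℕ) : ℚ :=
  (swingCount S u s : ℚ) / ∑ r ∈ S, (swingCount S u r : ℚ)

/-! The number of subsets with sum x is the coefficient of X^x in the product of 1 + X^s over the
weights s ≤ u; heavier weights cannot occur in such a sum. At most min(n, u) weights remain, since
they are distinct and positive. They are padded with factors 1 to a power of two p = 2^q, and the
product modulo X^(u+1) is formed along a binary tree. The coefficients are long numbers, so bits
must be counted: a product of m factors has coefficients below 2^m (`coeff_block_lt`) and occupies
(u+1) m one-bit cells. Hence every level of the tree fills the same V = p (u+1) cells and can be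
computed in place.

Two adjacent blocks are multiplied by Kronecker substitution. With rows re-spaced to 2m bits the
polynomials become integers in base 2^(2m), and the wanted coefficients are the digits of the
integer product modulo 2^(2m(u+1)) (`sum_conv_spread`, `testBit_sum_mul_pow`). The integer product
is a convolution of 0/1 sequences α, β, followed by carries (`runs_normalize`). The convolution
comes from a fast Fourier transform of length R in fixed-point arithmetic: for z = α + iβ the
self-convolution has imaginary part 2 α*β (`im_sum_mul`), and transforming, squaring and
transforming again yields R times the self-convolution, read backwards (`dft_sq_dft`). With the
scale R^24 the accumulated error stays below the scale (`SmallError.second`), so rounding is exact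
(`round_eq`). The roots of unity come from the half-angle formula, integer square roots and repeated
multiplication. A level costs O(V log V), and there are q levels. Since p is at most about 2 min(n,
u), q is O(log n) and log V is O(log u).

For the Banzhaf indices let B(y) count the coalitions of weight below y, and B_s(y) those among them
without s. Then B(y) = B_s(y) + B_s(y-s) and η_s = B_s(u) - B_s(u-s), so η_s = B(u) - 2B(u-s) +
2B(u-2s) - ... (`swingCount_eq_alternating`). The prefix sums B are formed in each bit position
separately, without carries, which gives digits that fit into words. A term of an alternating sum
then costs O(p) operations, and carries are propagated once per voter. As the weights are distinct,
the number of terms is at most the sum of u/s over s ≤ u, that is O(u log u) (`sum_div_le`).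

The programs are verified on states with integer entries, which stand for residues modulo 2^w. Ring
operations commute with this reduction, so negative numbers are harmless; only division, comparison
and addresses must stay in range (`Op.eval_enc`). -/

namespace WordRAM

/-! ### Integer states -/

/-- A machine state with integer registers and cells; it stands for their residues mod `2 ^ w`. -/
structure ZState where
  reg : ℕ → ℤ
  mem : ℤ → ℤ

/-- The word that represents an integer. -/
def enc (w : ℕ) (z : ℤ) : ℕ := (z % 2 ^ w).toNat

/-- The integer is a word. -/
def InWord (w : ℕ) (z : ℤ) : Prop := 0 ≤ z ∧ z < 2 ^ w

namespace ZState

/-- The machine state which an integer state stands for. -/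
def toState (w : ℕ) (s : ZState) : State := ⟨fun r => enc w (s.reg r), fun a => enc w (s.mem a)⟩

/-- Assign a value to a register. -/
def set (s : ZState) (r : ℕ) (v : ℤ) : ZState := ⟨fun r' => if r' = r then v else s.reg r', s.mem⟩

/-- Assign a value to a memory cell. -/
def put (s : ZState) (a v : ℤ) : ZState := ⟨s.reg, fun a' => if a' = a then v else s.mem a'⟩

@[simp] theorem set_reg (s : ZState) (r : ℕ) (v : ℤ) (r' : ℕ) :
    (s.set r v).reg r' = if r' = r then v else s.reg r' := rfl

@[simp] theorem set_mem (s : ZState) (r : ℕ) (v : ℤ) : (s.set r v).mem = s.mem := rfl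

@[simp] theorem put_reg (s : ZState) (a v : ℤ) : (s.put a v).reg = s.reg := rfl

@[simp] theorem put_mem (s : ZState) (a v a' : ℤ) :
    (s.put a v).mem a' = if a' = a then v else s.mem a' := rfl

end ZState

theorem enc_lt (w : ℕ) (z : ℤ) : enc w z < 2 ^ w := by
  have h : (0 : ℤ) < 2 ^ w := by positivity
  have h1 := Int.emod_lt_of_pos z h
  have h0 := Int.emod_nonneg z h.ne'
  have : ((z % 2 ^ w).toNat : ℤ) < ((2 ^ w : ℕ) : ℤ) := by
    rw [Int.toNat_of_nonneg h0]; push_cast; exact h1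
  exact_mod_cast this

theorem coe_enc (w : ℕ) (z : ℤ) : (enc w z : ℤ) = z % 2 ^ w :=
  Int.toNat_of_nonneg (Int.emod_nonneg z (by positivity))

theorem InWord.coe_enc {w : ℕ} {z : ℤ} (h : InWord w z) : (enc w z : ℤ) = z := by
  rw [WordRAM.coe_enc, Int.emod_eq_of_lt h.1 h.2]

theorem enc_eq_of_modEq {w : ℕ} {y : ℕ} {z : ℤ} (h : (y : ℤ) % 2 ^ w = z % 2 ^ w) :
    y % 2 ^ w = enc w z := by
  have : ((y % 2 ^ w : ℕ) : ℤ) = (enc w z : ℤ) := by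
    rw [coe_enc]; push_cast; exact h
  exact_mod_cast this

theorem enc_eq_of_coe_eq {w : ℕ} {y : ℕ} {z : ℤ} (h : (y : ℤ) = z) (hz : InWord w z) :
    y = enc w z := by
  have : (y : ℤ) = (enc w z : ℤ) := by rw [hz.coe_enc, h]
  exact_mod_cast this

theorem enc_natCast {w : ℕ} {y : ℕ} (h : y < 2 ^ w) : enc w y = y :=
  (enc_eq_of_coe_eq rfl ⟨by positivity, by exact_mod_cast h⟩).symm

theorem enc_boole_ne_zero {w : ℕ} (hw : 0 < w) {P : Prop} [Decidable P] :
    enc w (if P then 1 else 0) ≠ 0 ↔ P := by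
  have h2 : 1 < 2 ^ w := Nat.one_lt_two_pow hw.ne'
  split_ifs with h
  · have : enc w ((1 : ℕ) : ℤ) = 1 := enc_natCast h2
    simp_all
  · have : enc w ((0 : ℕ) : ℤ) = 0 := enc_natCast (by positivity)
    simp_all

/-! ### Evaluation over the integers -/

/-- The operations on words, without wrapping around. -/
def Op.evalZ : Op → ℤ → ℤ → ℤ
  | .add, a, b => a + b
  | .sub, a, b => a - b
  | .mul, a, b => a * b
  | .div, a, b => a / b
  | .mod, a, b => a % b
  | .lt, a, b => if a < b then 1 else 0
  | .eq, a, b => if a = b then 1 else 0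

/-- The operands for which an operation on words computes the operation on integers. -/
def Op.Ok (w : ℕ) : Op → ℤ → ℤ → Prop
  | .add, _, _ => True
  | .sub, _, _ => True
  | .mul, _, _ => True
  | .div, a, b => InWord w a ∧ InWord w b
  | .mod, a, b => InWord w a ∧ InWord w b
  | .lt, a, b => InWord w a ∧ InWord w b
  | .eq, a, b => InWord w a ∧ InWord w b

/-- Sum, difference and product descend to residues modulo 2^w, so they need no bound and may pass
through negative values. Quotient, remainder and comparison depend on the representative, so their
operands must be words. -/
theorem Op.eval_enc {w : ℕ} {o : Op} {a b : ℤ} (h : o.Ok w a b) :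
    o.eval w (enc w a) (enc w b) = enc w (o.evalZ a b) := by
  have hp : (0 : ℤ) < 2 ^ w := by positivity
  cases o with
  | add =>
    refine enc_eq_of_modEq ?_
    push_cast
    rw [coe_enc, coe_enc, Op.evalZ, ← Int.add_emod]
  | sub =>
    refine enc_eq_of_modEq ?_
    have hb := (enc_lt w b).le
    push_cast [hb]
    rw [coe_enc, coe_enc, Op.evalZ]
    have : a % 2 ^ w + (2 ^ w - b % 2 ^ w) = a % 2 ^ w - b % 2 ^ w + 2 ^ w := by ring
    rw [this, Int.add_emod_right, ← Int.sub_emod]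
  | mul =>
    refine enc_eq_of_modEq ?_
    push_cast
    rw [coe_enc, coe_enc, Op.evalZ, ← Int.mul_emod]
  | div =>
    obtain ⟨ha, hb⟩ := h
    refine enc_eq_of_coe_eq ?_ ⟨Int.ediv_nonneg ha.1 hb.1, ?_⟩
    · simp only [Op.eval, Op.evalZ]; push_cast; rw [ha.coe_enc, hb.coe_enc]
    · exact (Int.ediv_le_self _ ha.1).trans_lt ha.2
  | mod =>
    obtain ⟨ha, hb⟩ := h
    have : (Op.mod.eval w (enc w a) (enc w b) : ℤ) = Op.mod.evalZ a b := by
      simp only [Op.eval, Op.evalZ]; push_cast; rw [ha.coe_enc, hb.coe_enc]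
    refine enc_eq_of_coe_eq this ⟨this ▸ by positivity, ?_⟩
    rw [← this]
    have h1 : Op.mod.eval w (enc w a) (enc w b) ≤ enc w a := Nat.mod_le _ _
    exact_mod_cast h1.trans_lt (enc_lt w a)
  | lt =>
    obtain ⟨ha, hb⟩ := h
    refine enc_eq_of_modEq ?_
    have : enc w a < enc w b ↔ a < b := by
      rw [← Int.ofNat_lt, ha.coe_enc, hb.coe_enc]
    simp [Op.evalZ, this]
  | eq =>
    obtain ⟨ha, hb⟩ := h
    refine enc_eq_of_modEq ?_
    have : enc w a = enc w b ↔ a = b := by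
      rw [← Int.natCast_inj, ha.coe_enc, hb.coe_enc]
    simp [Op.evalZ, this]

namespace Expr

/-- The value of an expression over the integers. -/
def evalZ (s : ZState) : Expr → ℤ
  | .const k => k
  | .reg r => s.reg r
  | .load e => s.mem (e.evalZ s)
  | .op o e₁ e₂ => o.evalZ (e₁.evalZ s) (e₂.evalZ s)

/-- No operation in the expression overflows. -/
def Ok (w : ℕ) (s : ZState) : Expr → Prop
  | .const _ => True
  | .reg _ => True
  | .load e => e.Ok w s ∧ InWord w (e.evalZ s)
  | .op o e₁ e₂ => e₁.Ok w s ∧ e₂.Ok w s ∧ o.Ok w (e₁.evalZ s) (e₂.evalZ s)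

theorem eval_toState {w : ℕ} {s : ZState} {e : Expr} (h : e.Ok w s) :
    e.eval w (s.toState w) = enc w (e.evalZ s) := by
  induction e with
  | const k => exact enc_eq_of_modEq rfl
  | reg r => rfl
  | load e ih =>
    rw [eval, ih h.1, evalZ]
    simp only [ZState.toState, h.2.coe_enc]
  | op o e₁ e₂ h₁ h₂ => rw [eval, h₁ h.1, h₂ h.2.1, Op.eval_enc h.2.2]; rfl

instance : Add Expr := ⟨.op .add⟩
instance : Sub Expr := ⟨.op .sub⟩
instance : Mul Expr := ⟨.op .mul⟩
instance : Div Expr := ⟨.op .div⟩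
instance : Mod Expr := ⟨.op .mod⟩
instance (k : ℕ) : OfNat Expr k := ⟨.const k⟩

/-- The comparison of two expressions. -/
abbrev less (a b : Expr) : Expr := .op .lt a b

/-- The test for equality of two expressions. -/
abbrev same (a b : Expr) : Expr := .op .eq a b

variable (w : ℕ) (s : ZState) (a b : Expr) (k : ℕ)

@[simp] theorem evalZ_add : (a + b).evalZ s = a.evalZ s + b.evalZ s := rfl
@[simp] theorem evalZ_sub : (a - b).evalZ s = a.evalZ s - b.evalZ s := rfl
@[simp] theorem evalZ_mul : (a * b).evalZ s = a.evalZ s * b.evalZ s := rfl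
@[simp] theorem evalZ_div : (a / b).evalZ s = a.evalZ s / b.evalZ s := rfl
@[simp] theorem evalZ_mod : (a % b).evalZ s = a.evalZ s % b.evalZ s := rfl
@[simp] theorem evalZ_ofNat : (ofNat(k) : Expr).evalZ s = (OfNat.ofNat k : ℤ) := rfl
@[simp] theorem evalZ_reg : (Expr.reg k).evalZ s = s.reg k := rfl
@[simp] theorem evalZ_load : (Expr.load a).evalZ s = s.mem (a.evalZ s) := rfl
@[simp] theorem evalZ_less :
    (Expr.less a b).evalZ s = if a.evalZ s < b.evalZ s then 1 else 0 := rfl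
@[simp] theorem evalZ_same :
    (Expr.same a b).evalZ s = if a.evalZ s = b.evalZ s then 1 else 0 := rfl

@[simp] theorem ok_add : (a + b).Ok w s ↔ a.Ok w s ∧ b.Ok w s :=
  ⟨fun h => ⟨h.1, h.2.1⟩, fun h => ⟨h.1, h.2, trivial⟩⟩
@[simp] theorem ok_sub : (a - b).Ok w s ↔ a.Ok w s ∧ b.Ok w s :=
  ⟨fun h => ⟨h.1, h.2.1⟩, fun h => ⟨h.1, h.2, trivial⟩⟩
@[simp] theorem ok_mul : (a * b).Ok w s ↔ a.Ok w s ∧ b.Ok w s :=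
  ⟨fun h => ⟨h.1, h.2.1⟩, fun h => ⟨h.1, h.2, trivial⟩⟩
@[simp] theorem ok_div : (a / b).Ok w s ↔
    a.Ok w s ∧ b.Ok w s ∧ InWord w (a.evalZ s) ∧ InWord w (b.evalZ s) := Iff.rfl
@[simp] theorem ok_mod : (a % b).Ok w s ↔
    a.Ok w s ∧ b.Ok w s ∧ InWord w (a.evalZ s) ∧ InWord w (b.evalZ s) := Iff.rfl
@[simp] theorem ok_less : (less a b).Ok w s ↔
    a.Ok w s ∧ b.Ok w s ∧ InWord w (a.evalZ s) ∧ InWord w (b.evalZ s) := Iff.rfl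
@[simp] theorem ok_same : (same a b).Ok w s ↔
    a.Ok w s ∧ b.Ok w s ∧ InWord w (a.evalZ s) ∧ InWord w (b.evalZ s) := Iff.rfl
@[simp] theorem ok_ofNat : (ofNat(k) : Expr).Ok w s := trivial
@[simp] theorem ok_reg : (Expr.reg k).Ok w s := trivial
@[simp] theorem ok_load : (Expr.load a).Ok w s ↔ a.Ok w s ∧ InWord w (a.evalZ s) := Iff.rfl

@[simp] theorem cost_add : (a + b).cost = a.cost + b.cost + 1 := rfl
@[simp] theorem cost_sub : (a - b).cost = a.cost + b.cost + 1 := rfl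
@[simp] theorem cost_mul : (a * b).cost = a.cost + b.cost + 1 := rfl
@[simp] theorem cost_div : (a / b).cost = a.cost + b.cost + 1 := rfl
@[simp] theorem cost_mod : (a % b).cost = a.cost + b.cost + 1 := rfl
@[simp] theorem cost_less : (less a b).cost = a.cost + b.cost + 1 := rfl
@[simp] theorem cost_same : (same a b).cost = a.cost + b.cost + 1 := rfl
@[simp] theorem cost_ofNat : (ofNat(k) : Expr).cost = 1 := rfl
@[simp] theorem cost_reg : (Expr.reg k).cost = 1 := rfl
@[simp] theorem cost_load : (Expr.load a).cost = a.cost + 1 := rfl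

/-- The expression reads neither the memory nor the register `i`. -/
def Indep (i : ℕ) : Expr → Prop
  | .const _ => True
  | .reg r => r ≠ i
  | .load _ => False
  | .op _ e₁ e₂ => e₁.Indep i ∧ e₂.Indep i

@[simp] theorem indep_add : (a + b).Indep k ↔ a.Indep k ∧ b.Indep k := Iff.rfl
@[simp] theorem indep_sub : (a - b).Indep k ↔ a.Indep k ∧ b.Indep k := Iff.rfl
@[simp] theorem indep_mul : (a * b).Indep k ↔ a.Indep k ∧ b.Indep k := Iff.rfl
@[simp] theorem indep_div : (a / b).Indep k ↔ a.Indep k ∧ b.Indep k := Iff.rfl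
@[simp] theorem indep_ofNat (j : ℕ) : (ofNat(j) : Expr).Indep k := trivial
@[simp] theorem indep_reg (j : ℕ) : (Expr.reg j).Indep k ↔ j ≠ k := Iff.rfl

variable {w s a k}

theorem Indep.evalZ_eq {s' : ZState} (h : a.Indep k) (hs : ∀ r ≠ k, s'.reg r = s.reg r) :
    a.evalZ s' = a.evalZ s := by
  induction a with
  | const _ => rfl
  | reg r => exact hs r h
  | load _ => exact h.elim
  | op o e₁ e₂ h₁ h₂ => rw [evalZ, evalZ, h₁ h.1, h₂ h.2]

theorem Indep.ok_iff {s' : ZState} (h : a.Indep k) (hs : ∀ r ≠ k, s'.reg r = s.reg r) :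
    a.Ok w s' ↔ a.Ok w s := by
  induction a with
  | const _ => rfl
  | reg r => rfl
  | load _ => exact h.elim
  | op o e₁ e₂ h₁ h₂ => rw [Ok, Ok, h₁ h.1, h₂ h.2, h.1.evalZ_eq hs, h.2.evalZ_eq hs]

end Expr

/-! ### Runs of programs -/

infixr:60 " ;; " => Cmd.seq
infix:62 " ::= " => Cmd.assign

/-- From the state `s`, the program halts within time `T` in a state that satisfies `Q`. -/
def Runs (w : ℕ) (p : Cmd) (s : ZState) (T : ℕ) (Q : ZState → Prop) : Prop :=
  ∃ t s', Exec w p (s.toState w) t (s'.toState w) ∧ t ≤ T ∧ Q s'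

namespace Runs

variable {w : ℕ} {p q : Cmd} {s : ZState} {T T₁ T₂ : ℕ} {P Q : ZState → Prop}

theorem mono (h : Runs w p s T₁ P) (hT : T₁ ≤ T₂) (hPQ : ∀ s', P s' → Q s') :
    Runs w p s T₂ Q := by
  obtain ⟨t, s', h1, h2, h3⟩ := h
  exact ⟨t, s', h1, h2.trans hT, hPQ _ h3⟩

theorem seq (h₁ : Runs w p s T₁ P) (h₂ : ∀ s', P s' → Runs w q s' T₂ Q) :
    Runs w (p ;; q) s (T₁ + T₂) Q := by
  obtain ⟨t, s', h1, h2, h3⟩ := h₁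
  obtain ⟨t', s'', h4, h5, h6⟩ := h₂ s' h3
  exact ⟨t + t', s'', .seq h1 h4, add_le_add h2 h5, h6⟩

theorem assign {r : ℕ} {e : Expr} (h : e.Ok w s) (hQ : Q (s.set r (e.evalZ s))) :
    Runs w (r ::= e) s (e.cost + 1) Q := by
  refine ⟨_, s.set r (e.evalZ s), ?_, le_rfl, hQ⟩
  convert Exec.assign (w := w) (s.toState w) r e using 1
  rw [Expr.eval_toState h]
  simp only [ZState.toState, ZState.set, State.mk.injEq, and_true]
  funext r'
  simp only [Function.update_apply]
  split_ifs <;> rfl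

theorem assign_seq {r : ℕ} {e : Expr} (h : e.Ok w s)
    (hQ : Runs w q (s.set r (e.evalZ s)) T Q) :
    Runs w (r ::= e ;; q) s (e.cost + 1 + T) Q :=
  seq (P := fun s' => s' = s.set r (e.evalZ s)) (assign h rfl) (by rintro _ rfl; exact hQ)

theorem store {a e : Expr} (ha : a.Ok w s) (he : e.Ok w s) (h : InWord w (a.evalZ s))
    (hQ : Q (s.put (a.evalZ s) (e.evalZ s))) :
    Runs w (.store a e) s (a.cost + e.cost + 1) Q := by
  refine ⟨_, s.put (a.evalZ s) (e.evalZ s), ?_, le_rfl, hQ⟩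
  convert Exec.store (w := w) (s.toState w) a e using 1
  rw [Expr.eval_toState ha, Expr.eval_toState he]
  simp only [ZState.toState, ZState.put, State.mk.injEq, true_and]
  funext x
  -- An address in the word range is its own code; any other address would be reduced by the machine
  -- but not by `put`.
  have : x = enc w (a.evalZ s) ↔ (x : ℤ) = a.evalZ s := by
    rw [← Int.natCast_inj, h.coe_enc]
  simp only [Function.update_apply, this]
  split_ifs <;> rfl

theorem store_seq {a e : Expr} (ha : a.Ok w s) (he : e.Ok w s) (h : InWord w (a.evalZ s))
    (hQ : Runs w q (s.put (a.evalZ s) (e.evalZ s)) T Q) :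
    Runs w (.store a e ;; q) s (a.cost + e.cost + 1 + T) Q :=
  seq (P := fun s' => s' = s.put (a.evalZ s) (e.evalZ s)) (store ha he h rfl)
    (by rintro _ rfl; exact hQ)

/-- A loop whose `i`-th pass takes the invariant `I i` to `I (i + 1)`. -/
theorem loop (hw : 0 < w) {a b : Expr} (N : ℕ) (τ : ℕ → ℕ) (I : ℕ → ZState → Prop)
    (h0 : I 0 s)
    (hok : ∀ i ≤ N, ∀ s', I i s' → (Expr.less a b).Ok w s')
    (hlt : ∀ i < N, ∀ s', I i s' → a.evalZ s' < b.evalZ s')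
    (hend : ∀ s', I N s' → b.evalZ s' ≤ a.evalZ s' ∧ Q s')
    (hstep : ∀ i < N, ∀ s', I i s' → Runs w p s' (τ i) (I (i + 1))) :
    Runs w (.loop (.less a b) p) s
      (∑ i ∈ Finset.range N, (τ i + a.cost + b.cost + 2) + a.cost + b.cost + 2) Q := by
  suffices H : ∀ k i, i + k = N → ∀ s, I i s → Runs w (.loop (.less a b) p) s
      (∑ j ∈ Finset.range k, (τ (i + j) + a.cost + b.cost + 2) + a.cost + b.cost + 2) Q by
    simpa using H N 0 (zero_add N) s h0
  intro k
  induction k with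
  | zero =>
    intro i hi s hs
    obtain rfl : i = N := by omega
    have hv := hend s hs
    refine ⟨_, s, .loopFalse ?_, ?_, hv.2⟩
    · rw [Expr.eval_toState (hok i le_rfl s hs)]
      by_contra h
      exact absurd ((enc_boole_ne_zero hw).1 h) (not_lt.2 hv.1)
    · simp
  | succ k ih =>
    intro i hi s hs
    obtain ⟨t, s', h1, h2, h3⟩ := hstep i (by omega) s hs
    obtain ⟨t', s'', h4, h5, h6⟩ := ih (i + 1) (by omega) s' h3
    refine ⟨_, s'', .loopTrue ?_ h1 h4, ?_, h6⟩
    · rw [Expr.eval_toState (hok i (by omega) s hs)]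
      exact (enc_boole_ne_zero hw).2 (hlt i (by omega) s hs)
    · rw [Finset.sum_range_succ']
      simp only [Expr.cost_less, add_zero]
      have : ∑ j ∈ Finset.range k, (τ (i + (j + 1)) + a.cost + b.cost + 2) =
          ∑ j ∈ Finset.range k, (τ (i + 1 + j) + a.cost + b.cost + 2) :=
        Finset.sum_congr rfl fun j _ => by rw [show i + (j + 1) = i + 1 + j by ring]
      omega

end Runs

/-- Run `p` with the register `i` going through `0, …, len - 1`. -/
def Cmd.forLoop (i : ℕ) (len : Expr) (p : Cmd) : Cmd :=
  i ::= 0 ;; .loop (.less (.reg i) len) (p ;; i ::= .reg i + 1)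

/-- Store in the cells `b, …, b + len - 1` the values of `e`, which may depend on the register `i`,
the number of the cell. -/
def Cmd.fill (i : ℕ) (b len e : Expr) : Cmd := .forLoop i len (.store (b + .reg i) e)

namespace Runs

variable {w : ℕ} {p q : Cmd} {s : ZState} {T T₁ T₂ : ℕ} {P Q : ZState → Prop}

/-- The postcondition of a pass is phrased for the state with the counter already advanced, so
bodies are verified without the increment. The length is evaluated anew before each pass, hence it
must be constant along the invariant. -/
theorem forLoop (hw : 0 < w) {i : ℕ} {len : Expr} (n : ℕ) (τ : ℕ → ℕ) (I : ℕ → ZState → Prop)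
    (hn : n < 2 ^ w) (h0 : I 0 (s.set i 0))
    (hlen : ∀ k ≤ n, ∀ s' : ZState, s'.reg i = (k : ℤ) → I k s' → len.Ok w s' ∧ len.evalZ s' = n)
    (hend : ∀ s' : ZState, s'.reg i = (n : ℤ) → I n s' → Q s')
    (hstep : ∀ k < n, ∀ s' : ZState, s'.reg i = (k : ℤ) → I k s' →
      Runs w p s' (τ k) fun s'' => s''.reg i = (k : ℤ) ∧ I (k + 1) (s''.set i ((k + 1 : ℕ) : ℤ))) :
    Runs w (.forLoop i len p) s
      (∑ k ∈ Finset.range n, (τ k + len.cost + 7) + len.cost + 5) Q := by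
  have hword : ∀ k ≤ n, InWord w (k : ℤ) := fun k hk =>
    ⟨by positivity, by exact_mod_cast hk.trans_lt hn⟩
  have := loop (w := w) (p := p ;; i ::= .reg i + 1) (s := s.set i 0) (Q := Q) hw
    (a := .reg i) (b := len) n (fun k => τ k + 4) (fun k s' => s'.reg i = k ∧ I k s')
    ⟨by simp, h0⟩
    (fun k hk s' h => by
      obtain ⟨h1, h2⟩ := hlen k hk s' h.1 h.2
      rw [Expr.ok_less]
      refine ⟨trivial, h1, ?_, ?_⟩
      · rw [Expr.evalZ_reg, h.1]; exact hword k hk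
      · rw [h2]; exact hword n le_rfl)
    (fun k hk s' h => by
      rw [(hlen k hk.le s' h.1 h.2).2, Expr.evalZ_reg, h.1]; exact_mod_cast hk)
    (fun s' h => ⟨by rw [(hlen n le_rfl s' h.1 h.2).2, Expr.evalZ_reg, h.1], hend s' h.1 h.2⟩)
    (fun k hk s' h => by
      refine seq (hstep k hk s' h.1 h.2) (T₂ := 4) fun s'' h'' => ?_
      refine assign (by simp) ?_
      simp only [Expr.evalZ_add, Expr.evalZ_reg, h''.1]
      refine ⟨by simp, ?_⟩
      simpa using h''.2)
  refine mono (assign_seq (by simp) (by simpa using this)) ?_ fun _ h => h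
  simp only [Expr.cost_ofNat]
  have h1 : ∀ k, τ k + 4 + 1 + len.cost + 2 = τ k + len.cost + 7 := fun k => by ring
  simp only [h1]
  omega

/-- The expression is analysed in a memory `M` that already contains the cells written by earlier
passes. This permits recurrences in which a cell depends on earlier ones, as for carries and prefix
sums. -/
theorem fill (hw : 0 < w) {i : ℕ} {b len e : Expr} (n : ℕ) (B : ℤ) (f : ℕ → ℤ)
    (hbi : b.Indep i) (hli : len.Indep i) (hb : b.Ok w s ∧ b.evalZ s = B)
    (hl : len.Ok w s ∧ len.evalZ s = n) (hB : 0 ≤ B) (hBn : B + n < 2 ^ w)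
    (he : ∀ k < n, ∀ M : ℤ → ℤ, (∀ j < k, M (B + (j : ℕ)) = f j) →
      (∀ a, a < B ∨ B + k ≤ a → M a = s.mem a) →
      e.Ok w ⟨(s.set i k).reg, M⟩ ∧ e.evalZ ⟨(s.set i k).reg, M⟩ = f k)
    (hQ : ∀ M : ℤ → ℤ, (∀ j < n, M (B + (j : ℕ)) = f j) →
      (∀ a, a < B ∨ B + n ≤ a → M a = s.mem a) → Q ⟨(s.set i n).reg, M⟩) :
    Runs w (.fill i b len e) s (n * (b.cost + e.cost + len.cost + 10) + len.cost + 5) Q := by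
  have hn : n < 2 ^ w := by
    have : (n : ℤ) < 2 ^ w := by linarith
    exact_mod_cast this
  refine mono (forLoop hw n (fun _ => b.cost + e.cost + 3)
    (fun k s' => s'.reg = (s.set i k).reg ∧ (∀ j < k, s'.mem (B + (j : ℕ)) = f j) ∧
      ∀ a, a < B ∨ B + k ≤ a → s'.mem a = s.mem a) hn ?_ ?_ ?_ ?_) ?_ fun _ h => h
  · exact ⟨rfl, fun j hj => absurd hj (by omega), fun a _ => rfl⟩
  · intro k _ s' _ h
    have hs : ∀ r ≠ i, s'.reg r = s.reg r := fun r hr => by rw [h.1]; simp [hr]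
    rw [hli.ok_iff hs, hli.evalZ_eq hs]
    exact hl
  · rintro s' _ ⟨h1, h2, h3⟩
    have := hQ s'.mem h2 h3
    rwa [← h1] at this
  · rintro k hk s' h0 ⟨h1, h2, h3⟩
    have hs : ∀ r ≠ i, s'.reg r = s.reg r := fun r hr => by rw [h1]; simp [hr]
    have he' := he k hk s'.mem h2 h3
    rw [← h1] at he'
    have hb' : b.evalZ s' = B := by rw [hbi.evalZ_eq hs, hb.2]
    have hbo : b.Ok w s' := (hbi.ok_iff hs).2 hb.1
    refine mono (store (by simpa using hbo) he'.1 ?_ ?_) (by simp; omega) fun _ h => h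
    · simp only [Expr.evalZ_add, Expr.evalZ_reg, hb', h0]
      exact ⟨by positivity, by have : (k : ℤ) < n := by exact_mod_cast hk
                               linarith⟩
    · simp only [Expr.evalZ_add, Expr.evalZ_reg, hb', h0]
      refine ⟨by simpa using h0, ?_, ?_, ?_⟩
      · funext r
        by_cases hr : r = i
        · simp [hr]
        · simp [hr, h1]
      · intro j hj
        simp only [ZState.set_mem, ZState.put_mem]
        split_ifs with hjk
        · have : j = k := by
            have : (j : ℤ) = k := by linarith
            exact_mod_cast this
          rw [this]; exact he'.2
        · exact h2 j (by
            have : j ≠ k := fun h => hjk (by rw [h])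
            omega)
      · intro a ha
        push_cast at ha
        simp only [ZState.set_mem, ZState.put_mem]
        rw [if_neg (by omega)]
        exact h3 a (by omega)
  · simp only [Finset.sum_const, Finset.card_range, smul_eq_mul]
    have : b.cost + e.cost + 3 + len.cost + 7 = b.cost + e.cost + len.cost + 10 := by ring
    rw [this]

end Runs

end WordRAM

namespace WordRAM

open Complex

/-! ### The discrete Fourier transform -/

/-- The primitive `R`-th root of unity `exp (2 π i / R)`. -/
noncomputable def root (R : ℕ) : ℂ := exp (2 * Real.pi * I / R)

theorem root_primitive {R : ℕ} (hR : R ≠ 0) : IsPrimitiveRoot (root R) R :=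
  Complex.isPrimitiveRoot_exp R hR

theorem norm_root (R : ℕ) : ‖root R‖ = 1 := by
  have : 2 * (Real.pi : ℂ) * I / R = ((2 * Real.pi / R : ℝ) : ℂ) * I := by push_cast; ring
  rw [root, this, norm_exp_ofReal_mul_I]

theorem norm_root_pow (R j : ℕ) : ‖root R ^ j‖ = 1 := by rw [norm_pow, norm_root, one_pow]

theorem root_eq (R : ℕ) : root R = Real.cos (2 * Real.pi / R) + Real.sin (2 * Real.pi / R) * I := by
  have : 2 * (Real.pi : ℂ) * I / R = ((2 * Real.pi / R : ℝ) : ℂ) * I := by push_cast; ring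
  rw [root, this, exp_mul_I, ofReal_cos, ofReal_sin]

/-- The Fourier transform with `n` terms of the subsequence of `z` with step `h` that starts at
`r`. -/
noncomputable def partialDFT (R h n : ℕ) (z : ℕ → ℂ) (k r : ℕ) : ℂ :=
  ∑ t ∈ Finset.range n, z (r + t * h) * root R ^ (h * t * k)

theorem sum_range_two_mul {M : Type*} [AddCommMonoid M] (f : ℕ → M) (n : ℕ) :
    ∑ t ∈ Finset.range (2 * n), f t =
      ∑ t ∈ Finset.range n, f (2 * t) + ∑ t ∈ Finset.range n, f (2 * t + 1) := by
  induction n with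
  | zero => simp
  | succ n ih =>
    rw [show 2 * (n + 1) = 2 * n + 1 + 1 by ring, Finset.sum_range_succ, Finset.sum_range_succ, ih,
      Finset.sum_range_succ, Finset.sum_range_succ]
    abel

theorem root_pow_mod {R : ℕ} (hR : R ≠ 0) (m : ℕ) : root R ^ (m % R) = root R ^ m := by
  conv_rhs => rw [← Nat.div_add_mod m R]
  rw [pow_add, pow_mul, (root_primitive hR).pow_eq_one, one_pow, one_mul]

/-- Changing k by n changes the exponent h t k by a multiple of n h = R. -/
theorem partialDFT_mod {R h n : ℕ} (hR : n * h = R) (h0 : R ≠ 0) (z : ℕ → ℂ) (k r : ℕ) :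
    partialDFT R h n z (k % n) r = partialDFT R h n z k r := by
  refine Finset.sum_congr rfl fun t _ => ?_
  congr 1
  rw [← root_pow_mod h0, ← root_pow_mod h0 (h * t * k)]
  congr 1
  conv_rhs => rw [← Nat.div_add_mod k n]
  rw [show h * t * (n * (k / n) + k % n) = h * t * (k % n) + n * h * (t * (k / n)) by ring, hR,
    Nat.add_mul_mod_self_left]

/-- The Cooley–Tukey recursion: even and odd t run through the subsequences of step 2h that start at
r and at r + h, and each of their transforms has period n in k. -/
theorem partialDFT_two_mul {R h n : ℕ} (hR : n * (2 * h) = R) (h0 : R ≠ 0) (z : ℕ → ℂ) (k r : ℕ) :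
    partialDFT R h (2 * n) z k r = partialDFT R (2 * h) n z (k % n) r +
      root R ^ (h * k) * partialDFT R (2 * h) n z (k % n) (r + h) := by
  rw [partialDFT_mod hR h0, partialDFT_mod hR h0]
  simp only [partialDFT]
  rw [sum_range_two_mul, Finset.mul_sum]
  congr 1
  · refine Finset.sum_congr rfl fun t _ => ?_
    congr 2 <;> ring
  · refine Finset.sum_congr rfl fun t _ => ?_
    rw [show r + (2 * t + 1) * h = r + h + t * (2 * h) by ring,
      show h * (2 * t + 1) * k = h * k + 2 * h * t * k by ring, pow_add]
    ring

theorem norm_partialDFT_le {R h n : ℕ} (z : ℕ → ℂ) (k r : ℕ) {B : ℝ} (hz : ∀ i, ‖z i‖ ≤ B) :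
    ‖partialDFT R h n z k r‖ ≤ n * B := by
  have : ‖partialDFT R h n z k r‖ ≤ ∑ _t ∈ Finset.range n, B := by
    refine norm_sum_le_of_le _ fun t _ => ?_
    rw [norm_mul, norm_root_pow, mul_one]
    exact hz _
  simpa using this

/-- The discrete Fourier transform of length `R`. -/
noncomputable def dft (R : ℕ) (z : ℕ → ℂ) (k : ℕ) : ℂ := partialDFT R 1 R z k 0

theorem dft_eq (R : ℕ) (z : ℕ → ℂ) (k : ℕ) :
    dft R z k = ∑ t ∈ Finset.range R, z t * root R ^ (t * k) := by
  simp [dft, partialDFT]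

theorem sum_root_pow {R : ℕ} (hR : R ≠ 0) (m : ℕ) :
    ∑ s ∈ Finset.range R, root R ^ (s * m) = if R ∣ m then (R : ℂ) else 0 := by
  have hp := root_primitive hR
  simp only [mul_comm _ m, pow_mul]
  split_ifs with h
  · rw [(hp.pow_eq_one_iff_dvd m).2 h]; simp
  · have h1 : root R ^ m ≠ 1 := fun h' => h ((hp.pow_eq_one_iff_dvd m).1 h')
    rw [geom_sum_eq h1, ← pow_mul, mul_comm, pow_mul, hp.pow_eq_one, one_pow, sub_self, zero_div]

/-- Transforming, squaring and transforming again gives the self-convolution. -/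
theorem dft_sq_dft {R N : ℕ} (hR : 2 * N ≤ R) (z : ℕ → ℂ) (hz : ∀ i, N ≤ i → z i = 0) {j : ℕ}
    (hj : j < N) :
    dft R (fun s => dft R z s ^ 2) ((R - j) % R) =
      R * ∑ a ∈ Finset.range (j + 1), z a * z (j - a) := by
  have h0 : R ≠ 0 := by omega
  -- The frequency -j modulo R: there a forward transform acts as R times the inverse transform.
  set k := (R - j) % R with hk
  -- Zero padding excludes wrap-around: for a, b, j < N the difference a + b - j has absolute value
  -- below 2N ≤ R.
  have hdiv : ∀ a b : ℕ, a < N → b < N → (R ∣ a + b + k ↔ a + b = j) := by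
    intro a b ha hb
    rcases Nat.eq_zero_or_pos j with rfl | hj0
    · rw [hk, Nat.sub_zero, Nat.mod_self, add_zero]
      exact ⟨fun h => Nat.eq_zero_of_dvd_of_lt h (by omega), fun h => by simp [h]⟩
    · rw [hk, Nat.mod_eq_of_lt (by omega)]
      constructor
      · rintro ⟨c, hc⟩
        have : c = 1 := by
          have h1 : 0 < c := Nat.pos_of_ne_zero (by rintro rfl; omega)
          have h2 : c < 2 := by
            by_contra h
            have : R * 2 ≤ R * c := Nat.mul_le_mul_left R (by omega)
            omega
          omega
        subst this; omega
      · intro h; exact ⟨1, by omega⟩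
  calc dft R (fun s => dft R z s ^ 2) k
      = ∑ s ∈ Finset.range R, ∑ a ∈ Finset.range R, ∑ b ∈ Finset.range R,
          z a * z b * root R ^ (s * (a + b + k)) := by
        rw [dft_eq]
        refine Finset.sum_congr rfl fun s _ => ?_
        rw [dft_eq, sq, Finset.sum_mul_sum, Finset.sum_mul]
        refine Finset.sum_congr rfl fun a _ => ?_
        rw [Finset.sum_mul]
        refine Finset.sum_congr rfl fun b _ => ?_
        rw [show s * (a + b + k) = a * s + b * s + s * k by ring, pow_add, pow_add]
        ring
    _ = ∑ a ∈ Finset.range R, ∑ b ∈ Finset.range R,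
          z a * z b * (if R ∣ a + b + k then (R : ℂ) else 0) := by
        rw [Finset.sum_comm]
        refine Finset.sum_congr rfl fun a _ => ?_
        rw [Finset.sum_comm]
        refine Finset.sum_congr rfl fun b _ => ?_
        rw [← Finset.mul_sum, sum_root_pow h0]
    _ = ∑ a ∈ Finset.range R, if a ≤ j then R * (z a * z (j - a)) else 0 := by
        refine Finset.sum_congr rfl fun a _ => ?_
        have key : ∀ b ∈ Finset.range R, z a * z b * (if R ∣ a + b + k then (R : ℂ) else 0) =
            if b = j - a then (if a ≤ j then R * (z a * z (j - a)) else 0) else 0 := by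
          intro b _
          by_cases ha : a < N
          · by_cases hb : b < N
            · simp only [hdiv a b ha hb]
              by_cases h : a + b = j
              · rw [if_pos h, if_pos (by omega), if_pos (by omega), show j - a = b by omega]; ring
              · rw [if_neg h, mul_zero]
                by_cases hb' : b = j - a
                · rw [if_pos hb', if_neg (by omega)]
                · rw [if_neg hb']
            · rw [hz b (by omega), mul_zero, zero_mul, if_neg (show ¬ b = j - a by omega)]
          · rw [hz a (by omega), if_neg (show ¬ a ≤ j by omega)]; simp
        rw [Finset.sum_congr rfl key, Finset.sum_ite_eq',
          if_pos (Finset.mem_range.2 (by omega))]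
    _ = _ := by
        rw [← Finset.sum_filter, Finset.mul_sum]
        refine Finset.sum_congr ?_ fun _ _ => rfl
        ext a
        simp only [Finset.mem_filter, Finset.mem_range]
        omega

/-- The convolution of two real sequences is half the imaginary part of a self-convolution. -/
theorem im_sum_mul {a b : ℕ → ℤ} (z : ℕ → ℂ) (hz : ∀ i, z i = a i + b i * I) (j : ℕ) :
    (∑ i ∈ Finset.range (j + 1), z i * z (j - i)).im =
      2 * ((∑ i ∈ Finset.range (j + 1), a i * b (j - i) : ℤ) : ℝ) := by
  have h1 : (∑ i ∈ Finset.range (j + 1), z i * z (j - i)).im =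
      ∑ i ∈ Finset.range (j + 1), (a i * b (j - i) + b i * a (j - i) : ℝ) := by
    rw [Complex.im_sum]
    refine Finset.sum_congr rfl fun i _ => ?_
    rw [hz, hz]; simp
  -- The reflection i ↦ j - i exchanges the two mixed terms, which accounts for the factor 2.
  have h2 : ∑ i ∈ Finset.range (j + 1), (b i * a (j - i) : ℝ) =
      ∑ i ∈ Finset.range (j + 1), (a i * b (j - i) : ℝ) := by
    rw [← Finset.sum_range_reflect]
    refine Finset.sum_congr rfl fun i hi => ?_
    have := Finset.mem_range.1 hi
    rw [show j + 1 - 1 - i = j - i by omega, show j - (j - i) = i by omega]; ring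
  rw [h1, Finset.sum_add_distrib, h2]
  push_cast; ring

/-! ### Fixed-point arithmetic -/

/-- The Gaussian integer `a + b i` as a complex number. -/
noncomputable def cx (a b : ℤ) : ℂ := a + b * I

@[simp] theorem cx_re (a b : ℤ) : (cx a b).re = a := by simp [cx]
@[simp] theorem cx_im (a b : ℤ) : (cx a b).im = b := by simp [cx]

theorem cx_add (a b c d : ℤ) : cx (a + c) (b + d) = cx a b + cx c d := by
  simp only [cx]; push_cast; ring

theorem cx_mul (a b c d : ℤ) : cx (a * c - b * d) (a * d + b * c) = cx a b * cx c d := by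
  apply Complex.ext <;> simp

/-- Rounding down moves each coordinate by at most 1, and the norm is at most the sum of the
coordinate errors. -/
theorem norm_cx_div_sub_le {S : ℤ} (hS : 0 < S) (a b : ℤ) :
    ‖cx (a / S) (b / S) - cx a b / S‖ ≤ 2 := by
  have hS' : (0 : ℝ) < S := by exact_mod_cast hS
  have key : ∀ a : ℤ, |((a / S : ℤ) : ℝ) - a / S| ≤ 1 := by
    intro a
    have h1 : (S : ℝ) * ((a / S : ℤ) : ℝ) ≤ a := by exact_mod_cast Int.mul_ediv_self_le hS.ne'
    have h2 : (a : ℝ) < S * ((a / S : ℤ) : ℝ) + S := by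
      exact_mod_cast Int.lt_mul_ediv_self_add hS
    rw [abs_le]
    constructor
    · rw [neg_le_sub_iff_le_add, div_le_iff₀ hS']; nlinarith
    · rw [sub_le_iff_le_add]
      have : ((a / S : ℤ) : ℝ) ≤ a / S := by rw [le_div_iff₀ hS']; linarith
      linarith
  refine (Complex.norm_le_abs_re_add_abs_im _).trans ?_
  have hre : (cx (a / S) (b / S) - cx a b / S).re = ((a / S : ℤ) : ℝ) - a / S := by
    rw [sub_re, cx_re]
    congr 1
    simp
  have him : (cx (a / S) (b / S) - cx a b / S).im = ((b / S : ℤ) : ℝ) - b / S := by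
    rw [sub_im, cx_im]
    congr 1
    simp
  rw [hre, him]
  linarith [key a, key b]

/-- The error of a rounded product. -/
theorem norm_round_mul_sub_le {S : ℤ} (hS : 0 < S) {p q x y : ℤ} {ω V : ℂ} {Δ e A B : ℝ}
    (hω : ‖ω‖ ≤ A) (hw : ‖cx p q - S * ω‖ ≤ Δ) (hv : ‖cx x y - S * V‖ ≤ e) (hV : ‖V‖ ≤ B)
    (heS : e ≤ S) :
    ‖cx ((p * x - q * y) / S) ((p * y + q * x) / S) - S * (ω * V)‖ ≤ A * e + 2 + Δ * (B + 1) := by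
  have hS' : (0 : ℝ) < S := by exact_mod_cast hS
  have hSc : (S : ℂ) ≠ 0 := by exact_mod_cast hS.ne'
  have hnS : ‖(S : ℂ)‖ = S := by
    rw [Complex.norm_intCast, abs_of_pos hS']
  have hΔ : 0 ≤ Δ := (norm_nonneg _).trans hw
  have hx : ‖cx x y‖ ≤ S * (B + 1) := by
    calc ‖cx x y‖ = ‖(cx x y - S * V) + S * V‖ := by ring_nf
      _ ≤ e + S * B := by
        refine (norm_add_le _ _).trans (add_le_add hv ?_)
        rw [norm_mul, hnS]; gcongr
      _ ≤ _ := by linarith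
  have hr := norm_cx_div_sub_le hS (p * x - q * y) (p * y + q * x)
  rw [cx_mul] at hr
  -- The error has three sources: the rounding, at most 2; the error Δ of the factor times |cx x
  -- y|/S ≤ B + 1; and the input error e times |ω| ≤ A.
  have hid : cx ((p * x - q * y) / S) ((p * y + q * x) / S) - S * (ω * V) =
      (cx ((p * x - q * y) / S) ((p * y + q * x) / S) - cx p q * cx x y / S) +
      (cx p q - S * ω) * (cx x y / S) + ω * (cx x y - S * V) := by
    field_simp; ring
  rw [hid]
  refine (norm_add₃_le).trans ?_
  have h1 : ‖(cx p q - S * ω) * (cx x y / S)‖ ≤ Δ * (B + 1) := by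
    rw [norm_mul, norm_div, hnS]
    refine mul_le_mul hw ?_ (by positivity) hΔ
    rw [div_le_iff₀ hS']; linarith
  have h2 : ‖ω * (cx x y - S * V)‖ ≤ A * e := by
    rw [norm_mul]
    exact mul_le_mul hω hv (norm_nonneg _) ((norm_nonneg _).trans hω)
  linarith

/-- The size of the products that are rounded. -/
theorem abs_mul_le {S : ℤ} (hS : 0 < S) {p q x y : ℤ} {ω V : ℂ} {Δ e B : ℝ}
    (hw : ‖cx p q - S * ω‖ ≤ Δ) (hω : ‖ω‖ ≤ B) (hΔS : Δ ≤ S) (hv : ‖cx x y - S * V‖ ≤ e)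
    (hV : ‖V‖ ≤ B) (heS : e ≤ S) :
    |((p * x - q * y : ℤ) : ℝ)| ≤ S ^ 2 * (B + 1) ^ 2 ∧
      |((p * y + q * x : ℤ) : ℝ)| ≤ S ^ 2 * (B + 1) ^ 2 := by
  have hS' : (0 : ℝ) < S := by exact_mod_cast hS
  have hnS : ‖(S : ℂ)‖ = S := by
    rw [Complex.norm_intCast, abs_of_pos hS']
  have key : ∀ {x y : ℤ} {V : ℂ} {e : ℝ}, ‖cx x y - S * V‖ ≤ e → ‖V‖ ≤ B → e ≤ S →
      ‖cx x y‖ ≤ S * (B + 1) := by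
    intro x y V e hv hV heS
    calc ‖cx x y‖ = ‖(cx x y - S * V) + S * V‖ := by ring_nf
      _ ≤ e + S * B := by
        refine (norm_add_le _ _).trans (add_le_add hv ?_)
        rw [norm_mul, hnS]; gcongr
      _ ≤ _ := by linarith
  have h : ‖cx (p * x - q * y) (p * y + q * x)‖ ≤ S ^ 2 * (B + 1) ^ 2 := by
    rw [cx_mul, norm_mul]
    calc _ ≤ (S * (B + 1)) * (S * (B + 1)) :=
          mul_le_mul (key hw hω hΔS) (key hv hV heS) (norm_nonneg _)
            ((norm_nonneg _).trans (key hw hω hΔS))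
      _ = _ := by ring
  have h1 := (Complex.abs_re_le_norm _).trans h
  have h2 := (Complex.abs_im_le_norm _).trans h
  rw [cx_re] at h1
  rw [cx_im] at h2
  exact ⟨h1, h2⟩

/-- `re + im i` approximates `S Z` up to an error `e`. -/
def Approx (R : ℕ) (S : ℤ) (re im : ℕ → ℤ) (Z : ℕ → ℂ) (e : ℝ) : Prop :=
  ∀ i < R, ‖cx (re i) (im i) - S * Z i‖ ≤ e

/-- The sequence of all partial transforms. -/
noncomputable def stage (R h n : ℕ) (z : ℕ → ℂ) (i : ℕ) : ℂ := partialDFT R h n z (i / h) (i % h)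

/-- The index from which a step of the transform reads. -/
def srcIndex (h n i : ℕ) : ℕ := i / h % n * (2 * h) + i % h

theorem srcIndex_lt {R h n i : ℕ} (hR : n * (2 * h) = R) (h0 : 0 < R) :
    srcIndex h n i + h < R := by
  have hn : 0 < n := Nat.pos_of_ne_zero (by rintro rfl; omega)
  have hh : 0 < h := Nat.pos_of_ne_zero (by rintro rfl; omega)
  have h1 : (i / h % n + 1) * (2 * h) ≤ n * (2 * h) :=
    Nat.mul_le_mul_right _ (Nat.mod_lt _ hn)
  have h2 := Nat.mod_lt i hh
  rw [srcIndex]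
  rw [add_mul] at h1
  omega

/-- In this layout the cell k h + r holds the frequency k of the subsequence starting at r. The
recursion reads the frequency k mod n at the starts r and r + h, and the twiddle exponent h k equals
i - i % h. The stages lead from the sequence itself (h = R) to its transform in natural order (h =
1), so no bit reversal is needed. -/
theorem stage_two_mul {R h n : ℕ} (hR : n * (2 * h) = R) (h0 : 0 < R) (z : ℕ → ℂ) (i : ℕ) :
    stage R h (2 * n) z i = stage R (2 * h) n z (srcIndex h n i) +
      root R ^ (i - i % h) * stage R (2 * h) n z (srcIndex h n i + h) := by
  have hh : 0 < h := Nat.pos_of_ne_zero (by rintro rfl; omega)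
  have hm := Nat.mod_lt i hh
  have hsub : i - i % h = h * (i / h) := by
    have := Nat.div_add_mod i h; omega
  have e1 : ∀ r < 2 * h, (i / h % n * (2 * h) + r) / (2 * h) = i / h % n ∧
      (i / h % n * (2 * h) + r) % (2 * h) = r := by
    intro r hr
    constructor
    · rw [add_comm, Nat.add_mul_div_right _ _ (by omega), Nat.div_eq_of_lt hr, zero_add]
    · rw [add_comm, Nat.add_mul_mod_self_right, Nat.mod_eq_of_lt hr]
  simp only [stage, srcIndex]
  rw [partialDFT_two_mul hR h0.ne', hsub, add_assoc, (e1 _ (by omega)).1, (e1 _ (by omega)).2,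
    (e1 _ (by omega)).1, (e1 _ (by omega)).2]

theorem stage_start {R : ℕ} (z : ℕ → ℂ) {i : ℕ} (hi : i < R) : stage R R 1 z i = z i := by
  rw [stage, partialDFT]
  simp [Nat.mod_eq_of_lt hi, Nat.div_eq_of_lt hi]

theorem stage_end (R : ℕ) (z : ℕ → ℂ) (i : ℕ) : stage R 1 R z i = dft R z i := by
  rw [stage, dft, Nat.div_one, Nat.mod_one]

/-- One step of the transform in fixed-point arithmetic. -/
theorem Approx.step {R h n : ℕ} (hR : n * (2 * h) = R) (h0 : 0 < R) {S : ℤ} (hS : 0 < S)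
    {re im wr wi : ℕ → ℤ} {z : ℕ → ℂ} {Δ e B : ℝ} (hw : Approx R S wr wi (root R ^ ·) Δ)
    (hx : Approx R S re im (stage R (2 * h) n z) e) (hB : ∀ i, ‖stage R (2 * h) n z i‖ ≤ B)
    (heS : e ≤ S) :
    Approx R S
      (fun i => re (srcIndex h n i) + (wr (i - i % h) * re (srcIndex h n i + h) -
        wi (i - i % h) * im (srcIndex h n i + h)) / S)
      (fun i => im (srcIndex h n i) + (wr (i - i % h) * im (srcIndex h n i + h) +
        wi (i - i % h) * re (srcIndex h n i + h)) / S)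
      (stage R h (2 * n) z) (2 * e + (2 + Δ * (B + 1))) := by
  intro i hi
  have hs := srcIndex_lt (i := i) hR h0
  have h1 := norm_round_mul_sub_le hS (norm_root_pow R _).le (hw (i - i % h) (by omega))
    (hx (srcIndex h n i + h) hs) (hB _) heS
  have h2 := hx (srcIndex h n i) (by omega)
  simp only
  rw [stage_two_mul hR h0, cx_add]
  calc _ = ‖(cx (re (srcIndex h n i)) (im (srcIndex h n i)) -
        S * stage R (2 * h) n z (srcIndex h n i)) +
      (cx ((wr (i - i % h) * re (srcIndex h n i + h) -
        wi (i - i % h) * im (srcIndex h n i + h)) / S)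
        ((wr (i - i % h) * im (srcIndex h n i + h) +
        wi (i - i % h) * re (srcIndex h n i + h)) / S) -
        S * (root R ^ (i - i % h) * stage R (2 * h) n z (srcIndex h n i + h)))‖ := by
        congr 1; ring
    _ ≤ _ := (norm_add_le _ _).trans (by linarith)

/-- Recovery of an integer from an approximation. -/
theorem round_eq {R : ℕ} {S v c : ℤ} (hS : 0 < S) (hR : 2 ≤ R)
    (h : |(v : ℝ) - S * (R * (2 * c))| ≤ S) :
    0 ≤ v + R * S - 2 * R * S * c ∧ (v + R * S) / (2 * R * S) = c := by
  have h1 : |v - S * (R * (2 * c))| ≤ S := by exact_mod_cast h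
  rw [abs_le] at h1
  -- The candidates for v are spaced by 2RS, and the shift by RS turns the floor into rounding to
  -- the nearest one; R ≥ 2 keeps the error S strictly below RS.
  have hRS : 2 * S ≤ R * S := by
    have : (2 : ℤ) ≤ R := by exact_mod_cast hR
    nlinarith
  have e1 : S * (R * (2 * c)) = 2 * R * S * c := by ring
  rw [e1] at h1
  refine ⟨by linarith [h1.1], ?_⟩
  have hp : 0 < 2 * R * S := by nlinarith
  refine le_antisymm (Int.lt_add_one_iff.1 (Int.ediv_lt_of_lt_mul hp ?_))
    (Int.le_ediv_of_mul_le hp ?_) <;> nlinarith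

end WordRAM

namespace WordRAM

open Complex

/-! ### Twiddle factors -/

theorem abs_sqrt_sub_le {r x : ℤ} (hr : 0 ≤ r) (h1 : r * r ≤ x) (h2 : x < (r + 1) * (r + 1)) :
    |(r : ℝ) - √x| ≤ 1 := by
  have h1' : (r : ℝ) * r ≤ x := by exact_mod_cast h1
  have h2' : (x : ℝ) < (r + 1) * (r + 1) := by exact_mod_cast h2
  have hr' : (0 : ℝ) ≤ r := by exact_mod_cast hr
  have a1 : (r : ℝ) ≤ √x := Real.le_sqrt_of_sq_le (by linarith)
  have a2 : √x ≤ r + 1 := Real.sqrt_le_iff.2 ⟨by linarith, by linarith⟩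
  rw [abs_le]; constructor <;> linarith

/-- For y, T ≥ 0 one has |y - T|^2 ≤ |y - T| (y + T) = |y^2 - T^2|. This needs no lower bound on y +
T. -/
theorem abs_sub_le_of_sq {y T d : ℝ} (hy : 0 ≤ y) (hT : 0 ≤ T) (hd : 0 ≤ d)
    (h : |y ^ 2 - T ^ 2| ≤ d ^ 2) : |y - T| ≤ d := by
  rw [abs_le] at *
  constructor <;> nlinarith

/-- The half-angle formula for the cosine in fixed-point arithmetic. -/
theorem cos_half_approx {H c r : ℤ} {θ : ℝ} (hH : 2 ≤ H) (hθ : 0 ≤ θ) (hθ' : θ ≤ Real.pi / 2)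
    (hc0 : 0 ≤ c) (hcH : c ≤ 2 * H) (hc : |(c : ℝ) - (2 * H : ℤ) * Real.cos θ| ≤ 2) (hr : 0 ≤ r)
    (h1 : r * r ≤ (2 * H + c) * H) (h2 : (2 * H + c) * H < (r + 1) * (r + 1)) :
    r ≤ 2 * H ∧ |(r : ℝ) - (2 * H : ℤ) * Real.cos (θ / 2)| ≤ 2 := by
  refine ⟨by nlinarith, ?_⟩
  have hH' : (2 : ℝ) ≤ H := by exact_mod_cast hH
  have hc0' : (0 : ℝ) ≤ c := by exact_mod_cast hc0
  have hr1 := abs_sqrt_sub_le hr h1 h2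
  have hcos : 0 ≤ Real.cos θ := Real.cos_nonneg_of_mem_Icc ⟨by linarith, hθ'⟩
  have hcos2 : 0 ≤ Real.cos (θ / 2) := Real.cos_nonneg_of_mem_Icc ⟨by linarith, by linarith⟩
  have hsq : Real.cos (θ / 2) ^ 2 = 1 / 2 + Real.cos θ / 2 := by
    have := Real.cos_sq (θ / 2)
    rwa [show 2 * (θ / 2) = θ by ring] at this
  push_cast at hc ⊢
  set y := √(((2 * H + c) * H : ℤ) : ℝ) with hy
  have hy2 : y ^ 2 = (2 * H + c) * H := by
    rw [hy, Real.sq_sqrt (by push_cast; positivity)]; push_cast; ring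
  have hy0 : 0 ≤ y := Real.sqrt_nonneg _
  set C := 2 * H * Real.cos (θ / 2) with hC
  have hC0 : 0 ≤ C := by positivity
  have hC2 : C ^ 2 = 2 * H * (H + H * Real.cos θ) := by rw [hC, mul_pow, hsq]; ring
  have hyH : (H : ℝ) ≤ y := by
    refine abs_le_of_sq_le_sq' ?_ hy0 |>.2
    rw [hy2]; nlinarith
  have hCH : (H : ℝ) ≤ C := by
    refine abs_le_of_sq_le_sq' ?_ hC0 |>.2
    rw [hC2]; nlinarith [mul_nonneg (by linarith : (0:ℝ) ≤ H) hcos]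
  -- Both y and C are at least H, so dividing by y + C ≥ 2H reduces the old error, at most 2 and
  -- here multiplied by H, to at most 1. The integer square root adds 1, so the bound 2 reproduces
  -- itself under halving.
  have hd : (y - C) * (y + C) = H * (c - 2 * H * Real.cos θ) := by
    have : (y - C) * (y + C) = y ^ 2 - C ^ 2 := by ring
    rw [this, hy2, hC2]; ring
  have hyC : |y - C| ≤ 1 := by
    rw [abs_le] at hc ⊢
    constructor <;> by_contra hcon <;> rw [not_le] at hcon <;> nlinarith
  calc |(r : ℝ) - C| = |(r - y) + (y - C)| := by ring_nf
    _ ≤ 1 + 1 := (abs_add_le _ _).trans (add_le_add hr1 hyC)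
    _ = 2 := by norm_num

/-- The sine from the cosine in fixed-point arithmetic. -/
theorem sin_approx {G c r : ℤ} {θ : ℝ} (hG : 3 ≤ G) (hθ : 0 ≤ θ) (hθ' : θ ≤ Real.pi)
    (hc0 : 0 ≤ c) (hcS : c ≤ G ^ 2) (hc : |(c : ℝ) - (G ^ 2 : ℤ) * Real.cos θ| ≤ 2) (hr : 0 ≤ r)
    (h1 : r * r ≤ G ^ 2 * G ^ 2 - c * c) (h2 : G ^ 2 * G ^ 2 - c * c < (r + 1) * (r + 1)) :
    |(r : ℝ) - (G ^ 2 : ℤ) * Real.sin θ| ≤ 2 * G + 1 := by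
  have hG' : (3 : ℝ) ≤ G := by exact_mod_cast hG
  have hc0' : (0 : ℝ) ≤ c := by exact_mod_cast hc0
  have hcS' : (c : ℝ) ≤ G ^ 2 := by exact_mod_cast hcS
  have hr1 := abs_sqrt_sub_le hr h1 h2
  have hsin : 0 ≤ Real.sin θ := Real.sin_nonneg_of_mem_Icc ⟨hθ, hθ'⟩
  push_cast at hc ⊢
  set y := √((G ^ 2 * G ^ 2 - c * c : ℤ) : ℝ) with hy
  have hy2 : y ^ 2 = G ^ 2 * G ^ 2 - c * c := by
    rw [hy, Real.sq_sqrt (by push_cast; nlinarith)]; push_cast; ring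
  -- The sine may be close to 0, so one cannot divide by the sum of the roots. The squares differ by
  -- at most 2 · 2G² = (2G)², which costs half of the precision; hence the scale is a square G².
  have hyT : |y - G ^ 2 * Real.sin θ| ≤ 2 * G := by
    refine abs_sub_le_of_sq (Real.sqrt_nonneg _) (by positivity) (by positivity) ?_
    have h : y ^ 2 - (G ^ 2 * Real.sin θ) ^ 2 =
        -((c - G ^ 2 * Real.cos θ) * (c + G ^ 2 * Real.cos θ)) := by
      rw [hy2, mul_pow, Real.sin_sq]; ring
    rw [h, abs_neg, abs_mul]
    have h3 : |(c : ℝ) + G ^ 2 * Real.cos θ| ≤ 2 * G ^ 2 := by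
      have h4 := Real.cos_le_one θ
      have h5 := Real.neg_one_le_cos θ
      rw [abs_le]; constructor <;> nlinarith [sq_nonneg (G : ℝ)]
    nlinarith [abs_nonneg ((c : ℝ) - G ^ 2 * Real.cos θ),
      abs_nonneg ((c : ℝ) + G ^ 2 * Real.cos θ)]
  calc |(r : ℝ) - G ^ 2 * Real.sin θ| = |(r - y) + (y - G ^ 2 * Real.sin θ)| := by ring_nf
    _ ≤ 1 + 2 * G := (abs_add_le _ _).trans (add_le_add hr1 hyT)
    _ = _ := by ring

theorem root_approx {G c s : ℤ} {R : ℕ} (hG : 3 ≤ G)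
    (hc : |(c : ℝ) - (G ^ 2 : ℤ) * Real.cos (2 * Real.pi / R)| ≤ 2)
    (hs : |(s : ℝ) - (G ^ 2 : ℤ) * Real.sin (2 * Real.pi / R)| ≤ 2 * G + 1) :
    ‖cx c s - (G ^ 2 : ℤ) * root R‖ ≤ 3 * G := by
  have hG' : (3 : ℝ) ≤ G := by exact_mod_cast hG
  have h : cx c s - (G ^ 2 : ℤ) * root R =
      ((c - (G ^ 2 : ℤ) * Real.cos (2 * Real.pi / R) : ℝ) : ℂ) +
        ((s - (G ^ 2 : ℤ) * Real.sin (2 * Real.pi / R) : ℝ) : ℂ) * I := by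
    rw [root_eq, cx]; push_cast; ring
  rw [h]
  refine (norm_add_le _ _).trans ?_
  rw [norm_mul, norm_I, mul_one, norm_real, norm_real, Real.norm_eq_abs, Real.norm_eq_abs]
  linarith

/-- Powers of the approximate root of unity. -/
theorem root_pow_approx {R : ℕ} {S c s : ℤ} (hS : 0 < S) {δ : ℝ} (hδ : ‖cx c s - S * root R‖ ≤ δ)
    (re im : ℕ → ℤ) (n : ℕ) (hn : n * (2 + 2 * δ) ≤ S) (hre : re 0 = S) (him : im 0 = 0)
    (hre' : ∀ j, re (j + 1) = (c * re j - s * im j) / S)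
    (him' : ∀ j, im (j + 1) = (c * im j + s * re j) / S) (j : ℕ) (hj : j ≤ n) :
    ‖cx (re j) (im j) - S * root R ^ j‖ ≤ j * (2 + 2 * δ) := by
  have hδ0 : 0 ≤ δ := (norm_nonneg _).trans hδ
  induction j with
  | zero => simp [hre, him, cx]
  | succ j ih =>
    have ih := ih (by omega)
    have hjn : (j : ℝ) ≤ n := by exact_mod_cast (show j ≤ n by omega)
    have hjS : (j : ℝ) * (2 + 2 * δ) ≤ S :=
      (mul_le_mul_of_nonneg_right hjn (by positivity)).trans hn
    -- With A = B = 1 each multiplication adds only 2 + 2δ: the error grows linearly because the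
    -- true root has norm 1.
    have := norm_round_mul_sub_le hS (norm_root R).le hδ ih (norm_root_pow R j).le hjS
    rw [hre', him', pow_succ', Nat.cast_succ]
    linarith

/-- The sequence of the rounded powers of `(c + s i) / S`. -/
def powSeq (S c s : ℤ) : ℕ → ℤ × ℤ
  | 0 => (S, 0)
  | j + 1 => ((c * (powSeq S c s j).1 - s * (powSeq S c s j).2) / S,
      (c * (powSeq S c s j).2 + s * (powSeq S c s j).1) / S)

/-- The scale of the fixed-point numbers for transforms of length `R`. -/
def scale (R : ℕ) : ℤ := (R : ℤ) ^ 24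

theorem scale_eq (R : ℕ) : scale R = ((R : ℤ) ^ 12) ^ 2 := by rw [scale, ← pow_mul]

theorem scale_pos {R : ℕ} (hR : 4 ≤ R) : 0 < scale R := by
  have : (0 : ℤ) < R := by exact_mod_cast (show 0 < R by omega)
  rw [scale]; positivity

/-- The error bound for the table of the roots of unity. -/
theorem powSeq_approx {R : ℕ} (hR : 4 ≤ R) {c s : ℤ}
    (h : ‖cx c s - scale R * root R‖ ≤ 3 * (R : ℝ) ^ 12) :
    Approx R (scale R) (fun j => (powSeq (scale R) c s j).1)
      (fun j => (powSeq (scale R) c s j).2) (root R ^ ·) ((R : ℝ) ^ 15) := by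
  have hR' : (4 : ℝ) ≤ R := by exact_mod_cast hR
  have h12 : (1 : ℝ) ≤ (R : ℝ) ^ 12 := one_le_pow₀ (by linarith)
  have hb : (R : ℝ) * (2 + 2 * (3 * (R : ℝ) ^ 12)) ≤ R ^ 15 := by
    have : (R : ℝ) ^ 15 = R * (R ^ 12 * (R * R)) := by ring
    rw [this]
    refine mul_le_mul_of_nonneg_left ?_ (by linarith)
    have h16 : 16 ≤ (R : ℝ) * R := by nlinarith
    nlinarith [mul_le_mul_of_nonneg_left h16 (by linarith : 0 ≤ (R : ℝ) ^ 12)]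
  have h24 : (R : ℝ) ^ 15 ≤ (scale R : ℝ) := by
    rw [scale]; push_cast
    exact pow_le_pow_right₀ (by linarith) (by norm_num)
  intro j hj
  have := root_pow_approx (scale_pos hR) h (fun j => (powSeq (scale R) c s j).1)
    (fun j => (powSeq (scale R) c s j).2) R (hb.trans h24) rfl rfl (fun _ => rfl) (fun _ => rfl)
    j hj.le
  refine this.trans (le_trans ?_ hb)
  have hjR : (j : ℝ) ≤ R := by exact_mod_cast hj.le
  gcongr

end WordRAM

namespace WordRAM

open Complex

/-! ### Integer square roots -/

/-- The register `31` receives the integer square root of the register `30`; the register `32`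
must hold a power of two that is large enough. -/
def isqrt : Cmd :=
  31 ::= 0 ;;
  .loop (.less 0 (.reg 32)) (
    31 ::= .reg 31 + .reg 32 *
      (1 - .less (.reg 30) ((.reg 31 + .reg 32) * (.reg 31 + .reg 32))) ;;
    32 ::= .reg 32 / 2)

/-- A binary search, bit by bit from the top. The comparison enters as a factor 0 or 1 in place of a
branch. -/
theorem runs_isqrt {w : ℕ} {s : ZState} (j : ℕ) {x : ℤ} (hx : s.reg 30 = x) (hx0 : 0 ≤ x)
    (hb : s.reg 32 = 2 ^ j) (hxj : x < (2 * 2 ^ j) ^ 2) (hw : (4 * 2 ^ j : ℤ) ^ 2 < 2 ^ w) :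
    Runs w isqrt s (24 * j + 30) fun s' => s'.mem = s.mem ∧
      (∀ r, r ≠ 31 → r ≠ 32 → s'.reg r = s.reg r) ∧
      0 ≤ s'.reg 31 ∧ s'.reg 31 * s'.reg 31 ≤ x ∧ x < (s'.reg 31 + 1) * (s'.reg 31 + 1) := by
  have hj1 : (1 : ℤ) ≤ 2 ^ j := one_le_pow₀ (by norm_num)
  have hw4 : (4 * 2 ^ j : ℤ) < 2 ^ w := by nlinarith
  have hw1 : 0 < w := by
    rcases Nat.eq_zero_or_pos w with rfl | h
    · norm_num at hw4; linarith
    · exact h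
  -- The root lies in a window of width 2^(j+1-i) above register 31, and register 32 holds half of
  -- this width. After j + 1 passes the width is 1 and its half rounds to 0, which ends the loop.
  let I : ℕ → ZState → Prop := fun i s' => s'.mem = s.mem ∧
    (∀ r, r ≠ 31 → r ≠ 32 → s'.reg r = s.reg r) ∧ s'.reg 32 = 2 ^ (j + 1 - i) / 2 ∧
    0 ≤ s'.reg 31 ∧ s'.reg 31 + 2 ^ (j + 1 - i) ≤ 2 * 2 ^ j ∧ s'.reg 31 * s'.reg 31 ≤ x ∧
    x < (s'.reg 31 + 2 ^ (j + 1 - i)) * (s'.reg 31 + 2 ^ (j + 1 - i))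
  have hsplit : ∀ i < j + 1, (2 : ℤ) ^ (j + 1 - i) = 2 * 2 ^ (j + 1 - (i + 1)) := by
    intro i hi
    rw [← pow_succ']; congr 1; omega
  have hword : ∀ i, ∀ s', I i s' → InWord w (s'.reg 32) ∧ InWord w (s'.reg 30) ∧
      InWord w ((s'.reg 31 + s'.reg 32) * (s'.reg 31 + s'.reg 32)) := by
    rintro i s' ⟨-, h2, h3, h4, h5, h6, -⟩
    have hp : (0 : ℤ) < 2 ^ (j + 1 - i) := by positivity
    have h32 : 0 ≤ s'.reg 32 := by rw [h3]; positivity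
    have h32' : s'.reg 32 ≤ 2 ^ (j + 1 - i) := by rw [h3]; omega
    rw [h2 30 (by norm_num) (by norm_num), hx]
    exact ⟨⟨h32, by nlinarith⟩, ⟨hx0, by nlinarith⟩, by positivity, by nlinarith⟩
  refine Runs.mono (Runs.assign_seq (by simp) (Runs.loop hw1 (j + 1) (fun _ => 20) I ?_ ?_ ?_ ?_
    (Q := fun s' => s'.mem = s.mem ∧ (∀ r, r ≠ 31 → r ≠ 32 → s'.reg r = s.reg r) ∧
      0 ≤ s'.reg 31 ∧ s'.reg 31 * s'.reg 31 ≤ x ∧ x < (s'.reg 31 + 1) * (s'.reg 31 + 1)) ?_)) ?_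
      fun s' h => h
  · refine ⟨rfl, fun r h _ => by simp [h], ?_, by simp, ?_, by simpa using hx0, ?_⟩
    · simp [hb, pow_succ]
    · simp [pow_succ']
    · simp only [ZState.set_reg, Nat.sub_zero, pow_succ' (2 : ℤ) j]
      simpa [sq] using hxj
  · intro i hi s' h
    have := hword i s' h
    simp only [Expr.ok_less, Expr.ok_ofNat, Expr.ok_reg, Expr.evalZ_ofNat, Expr.evalZ_reg,
      true_and]
    exact ⟨⟨le_rfl, by positivity⟩, this.1⟩
  · rintro i hi s' ⟨-, -, h3, -⟩
    simp only [Expr.evalZ_ofNat, Expr.evalZ_reg, h3, hsplit i hi]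
    rw [Int.mul_ediv_cancel_left _ (by norm_num)]
    positivity
  · rintro s' ⟨h1, h2, h3, h4, h5, h6, h7⟩
    simp only [Nat.sub_self, pow_zero] at h3 h7
    refine ⟨by simp [h3], h1, h2, h4, h6, h7⟩
  · intro i hi s' h
    have hwd := hword i s' h
    obtain ⟨h1, h2, h3, h4, h5, h6, h7⟩ := h
    rw [hsplit i hi] at h3 h5 h7
    rw [Int.mul_ediv_cancel_left _ (by norm_num)] at h3
    have hp : (0 : ℤ) < 2 ^ (j + 1 - (i + 1)) := by positivity
    set b : ℤ := 2 ^ (j + 1 - (i + 1)) with hb'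
    refine Runs.mono (Runs.assign_seq (by simpa using hwd.2) (Runs.assign (Q := I (i + 1)) ?_ ?_))
      (by simp) fun s' h => h
    · simp only [Expr.ok_div, Expr.ok_reg, Expr.ok_ofNat, Expr.evalZ_reg, Expr.evalZ_ofNat,
        true_and, ZState.set_reg]
      exact ⟨hwd.1, by norm_num, by linarith⟩
    · have h30 : s'.reg 30 = x := by rw [h2 30 (by norm_num) (by norm_num), hx]
      simp only [I, ← hb']
      simp only [ZState.set_mem, ZState.set_reg, Expr.evalZ_add, Expr.evalZ_reg, Expr.evalZ_mul,
        Expr.evalZ_sub, Expr.evalZ_ofNat, Expr.evalZ_less, Expr.evalZ_div, h30, h3]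
      refine ⟨h1, fun r hr hr' => by simp [hr, hr', h2], by simp, ?_⟩
      norm_num
      split_ifs with hlt
      · simp only [sub_self, mul_zero, add_zero]
        exact ⟨h4, by linarith, h6, hlt⟩
      · simp only [sub_zero, mul_one]
        refine ⟨by linarith, by linarith, by linarith, by linarith⟩
  · simp only [Finset.sum_const, Finset.card_range, smul_eq_mul, Expr.cost_ofNat, Expr.cost_reg]
    omega

end WordRAM

namespace WordRAM

open Complex

/-- The states agree on the registers below `k` and on the memory below `lo`. -/
def Frame (k : ℕ) (lo : ℤ) (s s' : ZState) : Prop :=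
  (∀ r < k, s'.reg r = s.reg r) ∧ ∀ a < lo, s'.mem a = s.mem a

/-! ### Fixed-point division -/

/-- The quotient of `e` by the scale in the register `14`, rounded down; the register `15` holds
the square of the scale. -/
def rdiv (e : Expr) : Expr := (e + .reg 15 * .reg 14) / .reg 14 - .reg 15

@[simp] theorem cost_rdiv (e : Expr) : (rdiv e).cost = e.cost + 8 := rfl

/-- Machine division is correct only for words. Adding S^3 before the division and subtracting S^2
after it leaves the floor unchanged and makes the dividend nonnegative whenever it was at least
-S^3. -/
theorem evalZ_rdiv {s : ZState} {e : Expr} {S : ℤ} (hS : 0 < S) (h14 : s.reg 14 = S)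
    (h15 : s.reg 15 = S ^ 2) : (rdiv e).evalZ s = e.evalZ s / S := by
  simp only [rdiv, Expr.evalZ_sub, Expr.evalZ_div, Expr.evalZ_add, Expr.evalZ_mul,
    Expr.evalZ_reg, h14, h15]
  rw [Int.add_mul_ediv_right _ _ hS.ne']
  ring

theorem ok_rdiv {w : ℕ} {s : ZState} {e : Expr} {S : ℤ} (hS : 0 < S) (h14 : s.reg 14 = S)
    (h15 : s.reg 15 = S ^ 2) (hw : 2 * S ^ 3 < 2 ^ w) (he : e.Ok w s)
    (hb : |e.evalZ s| ≤ S ^ 3) : (rdiv e).Ok w s := by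
  have h3 : S ≤ S ^ 3 := le_self_pow₀ (by omega) (by norm_num)
  rw [abs_le] at hb
  simp only [rdiv, Expr.ok_sub, Expr.ok_div, Expr.ok_add, Expr.ok_mul, Expr.ok_reg,
    Expr.evalZ_add, Expr.evalZ_mul, Expr.evalZ_reg, h14, h15, he, true_and, and_true]
  refine ⟨⟨?_, ?_⟩, hS.le, by linarith⟩ <;> nlinarith

/-- Here and in the next lemma R^80 serves as a common generous bound for all intermediate numbers
of the transforms. -/
theorem sq_four_mul_scale_le {R : ℕ} (hR : 4 ≤ R) : (4 * scale R) ^ 2 ≤ (R : ℤ) ^ 80 := by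
  have h4 : (4 : ℤ) ≤ R := by exact_mod_cast hR
  have h0 : (0 : ℤ) ≤ 4 * scale R := mul_nonneg (by norm_num) (scale_pos hR).le
  have h1 : 4 * scale R ≤ (R : ℤ) ^ 25 := by
    rw [pow_succ' (R : ℤ) 24]
    exact mul_le_mul_of_nonneg_right h4 (scale_pos hR).le
  refine (pow_le_pow_left₀ h0 h1 2).trans ?_
  rw [← pow_mul]
  exact pow_le_pow_right₀ (by linarith) (by norm_num)

theorem two_mul_scale_pow_le {R : ℕ} (hR : 4 ≤ R) : 2 * scale R ^ 3 ≤ (R : ℤ) ^ 80 := by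
  have h4 : (4 : ℤ) ≤ R := by exact_mod_cast hR
  have h1 : 2 * scale R ^ 3 ≤ (R : ℤ) ^ 73 := by
    rw [pow_succ' (R : ℤ) 72, scale, ← pow_mul]
    exact mul_le_mul_of_nonneg_right (by linarith) (by positivity)
  exact h1.trans (pow_le_pow_right₀ (by linarith) (by norm_num))

/-! ### The table of the roots of unity -/

/-- Set the registers `14` and `15` for the fixed-point numbers of length `R`, the register `13`. -/
def setScale : Cmd :=
  14 ::= .reg 13 * .reg 13 ;;
  14 ::= .reg 14 * .reg 14 ;;
  14 ::= .reg 14 * .reg 14 ;;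
  14 ::= .reg 14 * .reg 14 * .reg 14 ;;
  15 ::= .reg 14 * .reg 14

theorem runs_setScale {w : ℕ} {s : ZState} {R : ℕ} (h : s.reg 13 = R) :
    Runs w setScale s 30 fun s' => s'.mem = s.mem ∧
      (∀ r, r ≠ 14 → r ≠ 15 → s'.reg r = s.reg r) ∧ s'.reg 14 = scale R ∧
      s'.reg 15 = scale R ^ 2 := by
  refine Runs.mono (Runs.assign_seq (by simp) <| Runs.assign_seq (by simp) <|
    Runs.assign_seq (by simp) <| Runs.assign_seq (by simp) <| Runs.assign (Q := fun s' =>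
      s'.mem = s.mem ∧ (∀ r, r ≠ 14 → r ≠ 15 → s'.reg r = s.reg r) ∧ s'.reg 14 = scale R ∧
      s'.reg 15 = scale R ^ 2) (by simp) ?_) (by simp) fun _ h => h
  refine ⟨rfl, fun r h1 h2 => by simp [h1, h2], ?_, ?_⟩
  · simp [h, scale]; ring
  · simp [h, scale]; ring

/-- The register `20` receives the cosine of `2 π / R`. -/
def rootCos : Cmd :=
  20 ::= 0 ;;
  22 ::= 4 ;;
  .loop (.less (.reg 22) (.reg 13)) (
    30 ::= (.reg 14 + .reg 20) * (.reg 14 / 2) ;;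
    32 ::= .reg 14 ;;
    isqrt ;;
    20 ::= .reg 31 ;;
    22 ::= .reg 22 * 2)

/-- Starting from cos(π/2) = 0, which register 22 = 4 records, r half-angle steps reach the angle
2π/2^(r+2), and `cos_half_approx` keeps the error at 2. The scale is a power of two, so it can start
the search in `isqrt`. -/
theorem runs_rootCos {w r R : ℕ} {s : ZState} (hR : R = 2 ^ (r + 2)) (h13 : s.reg 13 = R)
    (h14 : s.reg 14 = scale R) (hw : (R : ℤ) ^ 80 < 2 ^ w) :
    Runs w rootCos s (r * (576 * (r + 2) + 60) + 10) fun s' => s'.mem = s.mem ∧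
      (∀ i < 20, s'.reg i = s.reg i) ∧ 0 ≤ s'.reg 20 ∧ s'.reg 20 ≤ scale R ∧
      |(s'.reg 20 : ℝ) - scale R * Real.cos (2 * Real.pi / R)| ≤ 2 := by
  have hR4 : (4 : ℤ) ≤ R := by
    rw [hR]; push_cast; rw [pow_add]
    have : (1 : ℤ) ≤ 2 ^ r := one_le_pow₀ (by norm_num)
    linarith
  have hS2 : scale R = 2 ^ (24 * (r + 2)) := by
    rw [scale, hR]; push_cast; rw [← pow_mul, mul_comm]
  obtain ⟨H, hS, hH2⟩ : ∃ H : ℤ, scale R = 2 * H ∧ 2 ≤ H := by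
    refine ⟨2 ^ (24 * (r + 2) - 1), ?_, ?_⟩
    · rw [hS2, ← pow_succ']; congr 1
    · calc (2 : ℤ) = 2 ^ 1 := by norm_num
        _ ≤ _ := pow_le_pow_right₀ (by norm_num) (by omega)
  have hS0 : 0 < scale R := by rw [hS]; linarith
  have hwR : (R : ℤ) < 2 ^ w := lt_of_le_of_lt (le_self_pow₀ (by linarith) (by norm_num)) hw
  have hw1 : 0 < w := by
    rcases Nat.eq_zero_or_pos w with rfl | h
    · norm_num at hwR; linarith
    · exact h
  have hwS : (4 * scale R) ^ 2 < 2 ^ w :=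
    (sq_four_mul_scale_le (by exact_mod_cast hR4)).trans_lt hw
  have hwS1 : scale R < 2 ^ w := by nlinarith
  let I : ℕ → ZState → Prop := fun i s' => s'.mem = s.mem ∧
    (∀ i < 20, s'.reg i = s.reg i) ∧ s'.reg 22 = 2 ^ (i + 2) ∧ 0 ≤ s'.reg 20 ∧
    s'.reg 20 ≤ scale R ∧
    |(s'.reg 20 : ℝ) - scale R * Real.cos (2 * Real.pi / (2 ^ (i + 2) : ℝ))| ≤ 2
  refine Runs.mono (Runs.assign_seq (by simp) <| Runs.assign_seq (by simp) <|
    Runs.loop hw1 r (fun _ => 576 * (r + 2) + 56) I ?_ ?_ ?_ ?_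
    (Q := fun s' => s'.mem = s.mem ∧ (∀ i < 20, s'.reg i = s.reg i) ∧ 0 ≤ s'.reg 20 ∧
      s'.reg 20 ≤ scale R ∧
      |(s'.reg 20 : ℝ) - scale R * Real.cos (2 * Real.pi / R)| ≤ 2) ?_) ?_ fun s' h => h
  · refine ⟨rfl, fun i hi => ?_, by simp, by simp, by simp; linarith, ?_⟩
    · simp [show i ≠ 22 by omega, show i ≠ 20 by omega]
    · have : 2 * Real.pi / (2 ^ (0 + 2) : ℝ) = Real.pi / 2 := by ring
      rw [this]; simp
  · rintro i hi s' ⟨h1, h2, h3, h4, -⟩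
    simp only [Expr.ok_less, Expr.ok_reg, Expr.evalZ_reg, true_and, h2 13 (by norm_num), h13, h3]
    refine ⟨⟨by positivity, lt_of_le_of_lt ?_ hwR⟩, by positivity, hwR⟩
    rw [hR]; push_cast
    exact pow_le_pow_right₀ (by norm_num) (by omega)
  · rintro i hi s' ⟨h1, h2, h3, h4, -⟩
    simp only [Expr.evalZ_reg, h2 13 (by norm_num), h13, h3, hR]
    push_cast
    exact pow_lt_pow_right₀ (by norm_num) (by omega)
  · rintro s' ⟨h1, h2, h3, h4, h5, h6⟩
    refine ⟨?_, h1, h2, h4, h5, ?_⟩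
    · simp only [Expr.evalZ_reg, h2 13 (by norm_num), h13, h3, hR]; simp
    · have : (R : ℝ) = 2 ^ (r + 2) := by rw [hR]; push_cast; rfl
      rw [this]; exact h6
  · rintro i hi s' ⟨h1, h2, h3, h4, h5, h6⟩
    have h14' : s'.reg 14 = 2 * H := by rw [h2 14 (by norm_num), h14, hS]
    rw [hS] at h5 h6
    set c := s'.reg 20 with hc
    set x : ℤ := (2 * H + c) * H with hx
    refine Runs.mono (Runs.assign_seq ?_ <| Runs.assign_seq (by simp) <|
      Runs.seq (runs_isqrt (24 * (r + 2)) (x := x) ?_ ?_ ?_ ?_ ?_) (fun s'' hs'' =>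
        Runs.assign_seq (by simp) <| Runs.assign (Q := I (i + 1)) (by simp) ?_))
        ?_ fun s' h => h
    · simp only [Expr.ok_div, Expr.ok_reg, Expr.ok_ofNat, Expr.evalZ_reg, Expr.evalZ_ofNat,
        true_and, Expr.ok_mul, Expr.ok_add, h14']
      exact ⟨⟨by linarith, by linarith⟩, by norm_num, by linarith⟩
    · simp only [ZState.set_reg, Expr.evalZ_add, Expr.evalZ_reg, Expr.evalZ_mul, Expr.evalZ_div,
        Expr.evalZ_ofNat, h14', ← hc]
      norm_num [hx]
    · positivity
    · simp [h14', ← hS2, hS]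
    · rw [← hS2, hS, hx]; nlinarith
    · rw [← hS2]; exact hwS
    · obtain ⟨g1, g2, g3, g4, g5⟩ := hs''
      have hθ : 2 * Real.pi / 2 ^ (i + 1 + 2) = 2 * Real.pi / 2 ^ (i + 2) / 2 := by
        rw [show i + 1 + 2 = i + 2 + 1 by ring, pow_succ]; field_simp
      have hp : (0 : ℝ) < 2 ^ (i + 2) := by positivity
      have hp4 : (4 : ℝ) ≤ 2 ^ (i + 2) := by
        rw [pow_add]
        have : (1 : ℝ) ≤ 2 ^ i := one_le_pow₀ (by norm_num)
        linarith
      have := cos_half_approx (r := s''.reg 31) (c := c) hH2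
        (θ := 2 * Real.pi / 2 ^ (i + 2)) (by positivity)
        (by rw [div_le_div_iff₀ hp (by norm_num)]; nlinarith [Real.pi_pos]) h4 h5 h6 g3 g4 g5
      refine ⟨by simpa using g1.trans h1, fun k hk => ?_, ?_, by simpa using g3, ?_, ?_⟩
      · simp only [ZState.set_reg, show k ≠ 22 by omega, show k ≠ 20 by omega, if_false]
        rw [g2 k (by omega) (by omega)]
        simp [show k ≠ 32 by omega, show k ≠ 30 by omega, h2 k hk]
      · have : s''.reg 22 = 2 ^ (i + 2) := by
          rw [g2 22 (by norm_num) (by norm_num)]; simp [h3]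
        simp [this, pow_succ]
      · simpa [hS] using this.1
      · rw [hθ]; simpa [hS] using this.2
    · simp; omega
  · simp only [Finset.sum_const, Finset.card_range, smul_eq_mul, Expr.cost_ofNat, Expr.cost_reg]
    have : r * (576 * (r + 2) + 56 + 1 + 1 + 2) = r * (576 * (r + 2) + 60) := by ring
    omega

end WordRAM

/-! ### Approximate sequences in memory and the computation of the roots of unity -/

namespace WordRAM

open Complex

/-- The memory holds an approximation of the sequence `Z` from the address `X` on, first all real
parts, then all imaginary parts. -/
def HoldsApprox (M : ℤ → ℤ) (X : ℤ) (R : ℕ) (Z : ℕ → ℂ) (e : ℝ) : Prop :=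
  ∃ re im : ℕ → ℤ, Approx R (scale R) re im Z e ∧
    ∀ j < R, M (X + j) = re j ∧ M (X + R + j) = im j

/-- The memory holds the roots of unity from the address `E` on. -/
def HoldsRoots (M : ℤ → ℤ) (E : ℤ) (R : ℕ) : Prop :=
  HoldsApprox M E R (root R ^ ·) ((R : ℝ) ^ 15)

/-- The registers with the address `E` of the work space, the length `R` of the transforms and the
scale. -/
structure HasParams (E : ℤ) (R : ℕ) (s : ZState) : Prop where
  r5 : s.reg 5 = E
  r13 : s.reg 13 = R
  r14 : s.reg 14 = scale R
  r15 : s.reg 15 = scale R ^ 2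

/-- The words are large enough for transforms of length `R` with the work space at the address
`E`. -/
structure Fits (w : ℕ) (E : ℤ) (R : ℕ) : Prop where
  four_le : 4 ≤ R
  pow_lt : (R : ℤ) ^ 80 < 2 ^ w
  nonneg : 0 ≤ E
  lt : E + 8 * R < 2 ^ w

theorem Fits.pos {w : ℕ} {E : ℤ} {R : ℕ} (h : Fits w E R) : 0 < w := by
  have h1 := h.four_le
  have h2 := h.nonneg
  have h3 := h.lt
  rcases Nat.eq_zero_or_pos w with rfl | h
  · norm_num at h3; omega
  · exact h

theorem Fits.scale_lt {w : ℕ} {E : ℤ} {R : ℕ} (h : Fits w E R) : 2 * scale R ^ 3 < 2 ^ w :=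
  (two_mul_scale_pow_le h.four_le).trans_lt h.pow_lt

/-- Fill the table of the roots of unity. -/
def fillRoots : Cmd :=
  30 ::= .reg 14 * .reg 14 - .reg 20 * .reg 20 ;;
  32 ::= .reg 14 ;;
  isqrt ;;
  21 ::= .reg 31 ;;
  .store (.reg 5) (.reg 14) ;;
  .store (.reg 5 + .reg 13) 0 ;;
  .forLoop 40 (.reg 13 - 1) (
    .store (.reg 5 + 1 + .reg 40) (rdiv (.reg 20 * .load (.reg 5 + .reg 40) -
      .reg 21 * .load (.reg 5 + .reg 13 + .reg 40))) ;;
    .store (.reg 5 + .reg 13 + 1 + .reg 40) (rdiv (.reg 20 * .load (.reg 5 + .reg 13 + .reg 40) +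
      .reg 21 * .load (.reg 5 + .reg 40))))

theorem pow_le_scale {R : ℕ} (hR : 4 ≤ R) {k : ℕ} (hk : k ≤ 24) : (R : ℝ) ^ k ≤ scale R := by
  have : (4 : ℝ) ≤ R := by exact_mod_cast hR
  rw [scale]; push_cast
  exact pow_le_pow_right₀ (by linarith) hk

/-- The products in a step of the transform are small enough. -/
theorem abs_mul_le_scale {R : ℕ} (hR : 4 ≤ R) {p q x y : ℤ} {ω V : ℂ} {Δ e B : ℝ}
    (hw : ‖cx p q - scale R * ω‖ ≤ Δ) (hω : ‖ω‖ ≤ B) (hΔS : Δ ≤ scale R)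
    (hv : ‖cx x y - scale R * V‖ ≤ e) (hV : ‖V‖ ≤ B) (heS : e ≤ scale R)
    (hB : B ≤ (R : ℝ) ^ 4) :
    |p * x - q * y| ≤ scale R ^ 3 ∧ |p * y + q * x| ≤ scale R ^ 3 := by
  obtain ⟨h1, h2⟩ := abs_mul_le (scale_pos hR) hw hω hΔS hv hV heS
  have hS : (0 : ℝ) < scale R := by exact_mod_cast scale_pos hR
  have h4 : (4 : ℝ) ≤ R := by exact_mod_cast hR
  have hb : ((scale R : ℤ) : ℝ) ^ 2 * (B + 1) ^ 2 ≤ (scale R : ℝ) ^ 3 := by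
    rw [pow_succ _ 2]
    refine mul_le_mul_of_nonneg_left ?_ (by positivity)
    have h0 : 0 ≤ B := (norm_nonneg _).trans hω
    have h5 : B + 1 ≤ (R : ℝ) ^ 5 := by
      have h41 : (1 : ℝ) ≤ (R : ℝ) ^ 4 := one_le_pow₀ (by linarith)
      rw [pow_succ]; nlinarith
    refine (pow_le_pow_left₀ (by linarith) h5 2).trans ?_
    rw [← pow_mul]
    exact pow_le_scale hR (by norm_num)
  have h1' := h1.trans hb
  have h2' := h2.trans hb
  exact ⟨by exact_mod_cast h1', by exact_mod_cast h2'⟩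

/-- The table of the roots of unity that is computed from an approximate cosine. -/
theorem powSeq_facts {R : ℕ} (hR4 : 4 ≤ R) {c σ : ℤ} (h0 : 0 ≤ c) (hS : c ≤ scale R)
    (hc : |(c : ℝ) - scale R * Real.cos (2 * Real.pi / R)| ≤ 2) (g3 : 0 ≤ σ)
    (g4 : σ * σ ≤ scale R * scale R - c * c)
    (g5 : scale R * scale R - c * c < (σ + 1) * (σ + 1)) :
    Approx R (scale R) (fun j => (powSeq (scale R) c σ j).1)
      (fun j => (powSeq (scale R) c σ j).2) (root R ^ ·) ((R : ℝ) ^ 15) ∧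
    ∀ j < R, |c * (powSeq (scale R) c σ j).1 - σ * (powSeq (scale R) c σ j).2| ≤ scale R ^ 3 ∧
      |c * (powSeq (scale R) c σ j).2 + σ * (powSeq (scale R) c σ j).1| ≤ scale R ^ 3 := by
  have h4 : (4 : ℝ) ≤ R := by exact_mod_cast hR4
  have hθ : 2 * Real.pi / R ≤ Real.pi := by
    rw [div_le_iff₀ (by linarith only [h4])]; nlinarith only [Real.pi_pos, h4]
  have hR4' : (4 : ℤ) ≤ R := by exact_mod_cast hR4
  have hG3 : (3 : ℤ) ≤ (R : ℤ) ^ 12 :=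
    le_trans (by linarith only [hR4'] : (3 : ℤ) ≤ R)
      (le_self_pow₀ (by linarith only [hR4']) (by norm_num))
  have happ : ‖cx c σ - scale R * root R‖ ≤ 3 * (R : ℝ) ^ 12 := by
    rw [scale_eq] at hS hc g4 g5 ⊢
    have := root_approx hG3 hc (sin_approx hG3 (by positivity) hθ h0 hS hc g3 g4 g5)
    rw [Int.cast_pow (R : ℤ) 12] at this
    exact this
  refine ⟨powSeq_approx hR4 happ, fun j hj => ?_⟩
  have h1 : (1 : ℝ) ≤ R := by linarith only [h4]
  refine abs_mul_le_scale hR4 (B := 1) happ (norm_root R).le ?_ (powSeq_approx hR4 happ j hj)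
    (norm_root_pow R j).le (pow_le_scale hR4 (by norm_num)) (one_le_pow₀ h1)
  refine le_trans ?_ (pow_le_scale hR4 (k := 13) (by norm_num))
  rw [pow_succ' _ 12]
  exact mul_le_mul_of_nonneg_right (by linarith only [h4]) (by positivity)

theorem runs_fillRoots {w r R : ℕ} {E : ℤ} {s : ZState} (hR : R = 2 ^ (r + 2)) (hf : Fits w E R)
    (hp : HasParams E R s) (h0 : 0 ≤ s.reg 20) (hS : s.reg 20 ≤ scale R)
    (hc : |(s.reg 20 : ℝ) - scale R * Real.cos (2 * Real.pi / R)| ≤ 2) :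
    Runs w fillRoots s (600 * (r + 2) + 100 + 80 * R) fun s' =>
      Frame 20 E s s' ∧ HoldsRoots s'.mem E R := by
  have hR4 := hf.four_le
  have hR4' : (4 : ℤ) ≤ R := by exact_mod_cast hR4
  have hS2 : scale R = 2 ^ (24 * (r + 2)) := by
    rw [scale, hR]; push_cast; rw [← pow_mul, mul_comm]
  have hSp := scale_pos hR4
  have hw4 := (sq_four_mul_scale_le hR4).trans_lt hf.pow_lt
  have hE := hf.nonneg
  have hlt := hf.lt
  set c := s.reg 20 with hcdef
  refine Runs.mono (Runs.assign_seq (by simp) <| Runs.assign_seq (by simp) <|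
    Runs.seq (runs_isqrt (24 * (r + 2)) (x := scale R * scale R - c * c) ?_ ?_ ?_ ?_ ?_)
      (fun s₁ hs₁ => Runs.assign_seq (by simp) <| Runs.store_seq (T := R * 80 + 20)
        (Q := fun s' => Frame 20 E s s' ∧ HoldsRoots s'.mem E R) ?_ ?_ ?_ ?_)) ?_ fun s' h => h
  · simp [hp.r14, ← hcdef]
  · nlinarith
  · simp [hp.r14, hS2]
  · rw [← hS2]; nlinarith [mul_nonneg h0 h0]
  · rw [← hS2]; exact hw4
  · simp
  · simp
  · obtain ⟨g1, g2, g3, g4, g5⟩ := hs₁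
    simp only [Expr.evalZ_reg, ZState.set_reg, g2 5 (by norm_num) (by norm_num)]
    simp only [Nat.reduceEqDiff, if_false, hp.r5]
    exact ⟨hE, by omega⟩
  · obtain ⟨g1, g2, g3, g4, g5⟩ := hs₁
    set σ := s₁.reg 31 with hσ
    have k5 : s₁.reg 5 = E := by simpa [hp.r5] using g2 5 (by norm_num) (by norm_num)
    have k13 : s₁.reg 13 = R := by simpa [hp.r13] using g2 13 (by norm_num) (by norm_num)
    have k14 : s₁.reg 14 = scale R := by simpa [hp.r14] using g2 14 (by norm_num) (by norm_num)
    have k15 : s₁.reg 15 = scale R ^ 2 := by simpa [hp.r15] using g2 15 (by norm_num) (by norm_num)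
    have k20 : s₁.reg 20 = c := by simpa using g2 20 (by norm_num) (by norm_num)
    have klow : ∀ k < 20, s₁.reg k = s.reg k := fun k hk => by
      rw [g2 k (by omega) (by omega)]
      simp [show k ≠ 32 by omega, show k ≠ 30 by omega]
    have kmem : s₁.mem = s.mem := by simpa using g1
    obtain ⟨hpow, hbd⟩ := powSeq_facts hR4 h0 hS hc g3 g4 g5
    set wr := fun j => (powSeq (scale R) c σ j).1 with hwr
    set wi := fun j => (powSeq (scale R) c σ j).2 with hwi
    -- Entry 0, which is (S, 0), is stored before the loop. So k passes give the entries 0, …, k,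
    -- and R - 1 passes suffice.
    let I : ℕ → ZState → Prop := fun k s' => (∀ i < 20, s'.reg i = s.reg i) ∧ s'.reg 20 = c ∧
      s'.reg 21 = σ ∧ (∀ a < E, s'.mem a = s.mem a) ∧
      ∀ j < k + 1, s'.mem (E + (j : ℕ)) = wr j ∧ s'.mem (E + R + (j : ℕ)) = wi j
    have hcast : ((R - 1 : ℕ) : ℤ) = R - 1 := by push_cast [show 1 ≤ R by omega]; rfl
    refine Runs.mono (Runs.store_seq (by simp) (by simp) ?_ <|
      Runs.forLoop hf.pos (R - 1) (fun _ => 70) I ?_ ?_ ?_ ?_ ?_) ?_ fun s' h => h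
    · simp [k5, k13]
      exact ⟨by omega, by omega⟩
    · have : ((R - 1 : ℕ) : ℤ) < 2 ^ w := by rw [hcast]; omega
      exact_mod_cast this
    · refine ⟨fun i hi => ?_, by simp [k20], by simp [hσ], fun a ha => ?_, fun j hj => ?_⟩
      · simp [show i ≠ 40 by omega, show i ≠ 21 by omega, klow i hi]
      · simp [k5, k13, kmem, show a ≠ E + R by omega, show a ≠ E by omega]
      · obtain rfl : j = 0 := by omega
        simp [k5, k13, k14, hwr, hwi, powSeq]
        omega
    · rintro k hk s' hs' ⟨i1, -⟩
      simp [i1, hp.r13, hcast]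
    · rintro s' hs' ⟨i1, i2, i3, i4, i5⟩
      refine ⟨⟨i1, i4⟩, wr, wi, hpow, fun j hj => i5 j (by omega)⟩
    · rintro k hk s' hs' ⟨i1, i2, i3, i4, i5⟩
      have p5 : s'.reg 5 = E := by rw [i1 5 (by norm_num), hp.r5]
      have p13 : s'.reg 13 = R := by rw [i1 13 (by norm_num), hp.r13]
      have p14 : s'.reg 14 = scale R := by rw [i1 14 (by norm_num), hp.r14]
      have p15 : s'.reg 15 = scale R ^ 2 := by rw [i1 15 (by norm_num), hp.r15]
      have hb := hbd k (by omega)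
      have l1 := i5 k (by omega)
      have hkR : (k : ℤ) < R := by omega
      -- An arbitrary memory is allowed because the second store is evaluated after the first has
      -- changed a cell; that cell is not among those read.
      have e1 : ∀ m : ℤ → ℤ, m (E + k) = wr k → m (E + R + k) = wi k →
          (rdiv (.reg 20 * .load (.reg 5 + .reg 40) -
            .reg 21 * .load (.reg 5 + .reg 13 + .reg 40))).evalZ ⟨s'.reg, m⟩ = wr (k + 1) ∧
          (rdiv (.reg 20 * .load (.reg 5 + .reg 40) -
            .reg 21 * .load (.reg 5 + .reg 13 + .reg 40))).Ok w ⟨s'.reg, m⟩ ∧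
          (rdiv (.reg 20 * .load (.reg 5 + .reg 13 + .reg 40) +
            .reg 21 * .load (.reg 5 + .reg 40))).evalZ ⟨s'.reg, m⟩ = wi (k + 1) ∧
          (rdiv (.reg 20 * .load (.reg 5 + .reg 13 + .reg 40) +
            .reg 21 * .load (.reg 5 + .reg 40))).Ok w ⟨s'.reg, m⟩ := by
        intro m m1 m2
        refine ⟨?_, ok_rdiv hSp p14 p15 hf.scale_lt ?_ ?_, ?_,
          ok_rdiv hSp p14 p15 hf.scale_lt ?_ ?_⟩
        · rw [evalZ_rdiv (s := ⟨s'.reg, m⟩) hSp p14 p15]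
          simp [p5, p13, hs', i2, i3, m1, m2, hwr, hwi, powSeq]
        · simp [p5, p13, hs', InWord]; omega
        · simpa [p5, p13, hs', i2, i3, m1, m2] using hb.1
        · rw [evalZ_rdiv (s := ⟨s'.reg, m⟩) hSp p14 p15]
          simp [p5, p13, hs', i2, i3, m1, m2, hwr, hwi, powSeq]
        · simp [p5, p13, hs', InWord]; omega
        · simpa [p5, p13, hs', i2, i3, m1, m2] using hb.2
      have q1 := e1 s'.mem l1.1 l1.2
      refine Runs.mono (Runs.store_seq (by simp) q1.2.1 ?_ <| Runs.store (Q := fun s'' =>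
          s''.reg 40 = (k : ℤ) ∧ I (k + 1) (s''.set 40 ((k + 1 : ℕ) : ℤ)))
          (by simp) ?_ ?_ ?_) (by simp) fun s' h => h
      · simp [p5, hs']; exact ⟨by omega, by omega⟩
      all_goals
        set m' := (s'.put ((Expr.reg 5 + 1 + Expr.reg 40).evalZ s') ((rdiv (.reg 20 *
          .load (.reg 5 + .reg 40) - .reg 21 * .load (.reg 5 + .reg 13 + .reg 40))).evalZ s')) with hm'
        have hm1 : ∀ a, m'.mem a = if a = E + 1 + k then wr (k + 1) else s'.mem a := by
          intro a; rw [hm', ZState.put_mem, q1.1]; simp [p5, hs']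
        have q2 := e1 m'.mem (by rw [hm1, if_neg (by omega), l1.1])
          (by rw [hm1, if_neg (by omega), l1.2])
        have hm2 : m'.reg = s'.reg := rfl
      · exact q2.2.2.2
      · simp [hm2, p5, p13, hs']; exact ⟨by omega, by omega⟩
      · refine ⟨by simp [hm2, hs'], ?_⟩
        have q3 := q2.2.2.1
        have hadd : (Expr.reg 5 + Expr.reg 13 + 1 + Expr.reg 40).evalZ m' = E + R + 1 + k := by
          simp [hm2, p5, p13, hs']
        change I (k + 1) ((m'.put _ ((rdiv (.reg 20 * .load (.reg 5 + .reg 13 + .reg 40) +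
            .reg 21 * .load (.reg 5 + .reg 40))).evalZ ⟨s'.reg, m'.mem⟩)).set 40 ((k + 1 : ℕ) : ℤ))
        rw [q3, hadd]
        refine ⟨fun i hi => ?_, by simp [hm2, i2], by simp [hm2, i3], fun a ha => ?_,
          fun j hj => ?_⟩
        · simp [hm2, show i ≠ 40 by omega, i1 i hi]
        · simp only [ZState.set_mem, ZState.put_mem, hm1]
          rw [if_neg (by omega), if_neg (by omega), i4 a ha]
        · simp only [ZState.set_mem, ZState.put_mem, hm1]
          rcases Nat.lt_succ_iff_lt_or_eq.1 hj with hj | rfl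
          · have := i5 j hj
            rw [if_neg (by omega), if_neg (by omega), if_neg (by omega), if_neg (by omega)]
            exact this
          · push_cast
            rw [if_neg (by omega), if_pos (by omega), if_pos (by omega)]
            exact ⟨rfl, rfl⟩
    · simp
      omega
  · simp
    omega

end WordRAM

namespace WordRAM

open Complex

/-! ### The Fourier transform -/

/-- The index `srcIndex h n i` for the registers `h = 23`, `n = 24`, `i = 40`. -/
def srcExpr : Expr := .reg 40 / .reg 23 % .reg 24 * (2 * .reg 23) + .reg 40 % .reg 23

/-- The exponent of the root of unity in a step of the transform. -/
def expExpr : Expr := .reg 40 - .reg 40 % .reg 23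

/-- The real part of a cell of the next stage. -/
def stepRe : Expr :=
  .load (.reg 5 + 2 * .reg 13 + srcExpr) +
    rdiv (.load (.reg 5 + expExpr) * .load (.reg 5 + 2 * .reg 13 + (srcExpr + .reg 23)) -
      .load (.reg 5 + .reg 13 + expExpr) * .load (.reg 5 + 3 * .reg 13 + (srcExpr + .reg 23)))

/-- The imaginary part of a cell of the next stage. -/
def stepIm : Expr :=
  .load (.reg 5 + 3 * .reg 13 + srcExpr) +
    rdiv (.load (.reg 5 + expExpr) * .load (.reg 5 + 3 * .reg 13 + (srcExpr + .reg 23)) +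
      .load (.reg 5 + .reg 13 + expExpr) * .load (.reg 5 + 2 * .reg 13 + (srcExpr + .reg 23)))

/-- Replace the complex sequence at the address `E + 2 R` by the sequence with the real parts `eRe`
and the imaginary parts `eIm`; it is computed in a buffer and then copied back. -/
def mapComplex (eRe eIm : Expr) : Cmd :=
  .fill 40 (.reg 5 + 4 * .reg 13) (.reg 13) eRe ;;
  .fill 40 (.reg 5 + 5 * .reg 13) (.reg 13) eIm ;;
  .fill 40 (.reg 5 + 2 * .reg 13) (2 * .reg 13) (.load (.reg 5 + 4 * .reg 13 + .reg 40))

/-- The discrete Fourier transform of the sequence at the address `E + 2 R`. -/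
def fft : Cmd :=
  23 ::= .reg 13 / 2 ;;
  24 ::= 1 ;;
  .loop (.less 0 (.reg 23)) (
    mapComplex stepRe stepIm ;;
    23 ::= .reg 23 / 2 ;;
    24 ::= .reg 24 * 2)

theorem HasParams.of_frame {E : ℤ} {R : ℕ} {s s' : ZState} (h : HasParams E R s)
    (hs : ∀ r < 20, s'.reg r = s.reg r) : HasParams E R s' :=
  ⟨by rw [hs 5 (by norm_num), h.r5], by rw [hs 13 (by norm_num), h.r13],
    by rw [hs 14 (by norm_num), h.r14], by rw [hs 15 (by norm_num), h.r15]⟩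

theorem HoldsApprox.congr {M M' : ℤ → ℤ} {X : ℤ} {R : ℕ} {Z : ℕ → ℂ} {e : ℝ}
    (h : HoldsApprox M X R Z e) (hM : ∀ a, X ≤ a → a < X + 2 * R → M' a = M a) :
    HoldsApprox M' X R Z e := by
  obtain ⟨re, im, h1, h2⟩ := h
  refine ⟨re, im, h1, fun j hj => ?_⟩
  rw [hM _ (by omega) (by omega), hM _ (by omega) (by omega)]
  exact h2 j hj

theorem evalZ_srcExpr {s : ZState} {h n i : ℕ} (h23 : s.reg 23 = h) (h24 : s.reg 24 = n)
    (h40 : s.reg 40 = i) : srcExpr.evalZ s = (srcIndex h n i : ℕ) := by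
  simp [srcExpr, srcIndex, h23, h24, h40]

theorem evalZ_expExpr {s : ZState} {h i : ℕ} (h23 : s.reg 23 = h) (h40 : s.reg 40 = i) :
    expExpr.evalZ s = (i - i % h : ℕ) := by
  simp only [expExpr, Expr.evalZ_sub, Expr.evalZ_mod, Expr.evalZ_reg, h23, h40]
  rw [Nat.cast_sub (Nat.mod_le i h)]
  push_cast; rfl

theorem ok_srcExpr {w : ℕ} {s : ZState} {R h n i : ℕ} (h23 : s.reg 23 = h) (h24 : s.reg 24 = n)
    (h40 : s.reg 40 = i) (hR : n * (2 * h) = R) (hi : i < R) (hw : (R : ℤ) < 2 ^ w) :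
    srcExpr.Ok w s ∧ expExpr.Ok w s := by
  have h0 : 0 < R := by omega
  have hn : 0 < n := Nat.pos_of_ne_zero (by rintro rfl; omega)
  have hh : 0 < h := Nat.pos_of_ne_zero (by rintro rfl; omega)
  have hhR : h ≤ R := by rw [← hR]; nlinarith
  have hnR : n ≤ R := by rw [← hR]; nlinarith
  have e1 : InWord w (i : ℤ) := ⟨by positivity, by omega⟩
  have e2 : InWord w (h : ℤ) := ⟨by positivity, by omega⟩
  have e3 : InWord w (n : ℤ) := ⟨by positivity, by omega⟩
  have e4 : InWord w ((i : ℤ) / h) := by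
    have := Nat.div_le_self i h
    refine ⟨by positivity, ?_⟩
    have : ((i / h : ℕ) : ℤ) ≤ i := by exact_mod_cast this
    push_cast at this
    linarith [e1.2]
  simp [srcExpr, expExpr, h23, h24, h40, e1, e2, e3, e4]

/-- Everything below E + 4R, including the sequence itself, stays intact until both halves of the
result lie in the buffer. Therefore `key` quantifies over all memories that agree with the initial
one there. -/
theorem runs_mapComplex {w R : ℕ} {E : ℤ} {s : ZState} (hf : Fits w E R) (hp : HasParams E R s)
    {eRe eIm : Expr} {re' im' : ℕ → ℤ}
    (key : ∀ i < R, ∀ M : ℤ → ℤ, (∀ a < E + 4 * R, M a = s.mem a) →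
      (eRe.Ok w ⟨(s.set 40 i).reg, M⟩ ∧ eRe.evalZ ⟨(s.set 40 i).reg, M⟩ = re' i) ∧
      (eIm.Ok w ⟨(s.set 40 i).reg, M⟩ ∧ eIm.evalZ ⟨(s.set 40 i).reg, M⟩ = im' i)) :
    Runs w (mapComplex eRe eIm) s (R * (eRe.cost + eIm.cost + 90) + 30) fun s' =>
      (∀ r, r ≠ 40 → s'.reg r = s.reg r) ∧ (∀ a < E + 2 * R, s'.mem a = s.mem a) ∧
      ∀ j < R, s'.mem (E + 2 * R + (j : ℕ)) = re' j ∧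
        s'.mem (E + 2 * R + R + (j : ℕ)) = im' j := by
  have hR4 := hf.four_le
  have hE := hf.nonneg
  have hlt := hf.lt
  refine Runs.mono (Runs.seq (P := fun s' => (∀ r, r ≠ 40 → s'.reg r = s.reg r) ∧
      (∀ a < E + 4 * R, s'.mem a = s.mem a) ∧ ∀ j < R, s'.mem (E + 4 * R + (j : ℕ)) = re' j)
    (Runs.fill hf.pos R (E + 4 * R) re' (by simp) (by simp)
      (by simp [hp.r5, hp.r13]) (by simp [hp.r13]) (by omega) (by omega) ?_ ?_) fun s₁ h₁ =>
    Runs.seq (P := fun s' => (∀ r, r ≠ 40 → s'.reg r = s.reg r) ∧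
      (∀ a < E + 4 * R, s'.mem a = s.mem a) ∧
      ∀ j < R, s'.mem (E + 4 * R + (j : ℕ)) = re' j ∧ s'.mem (E + 5 * R + (j : ℕ)) = im' j)
    (Runs.fill hf.pos R (E + 5 * R) im'
      (by simp) (by simp) (by simp [h₁.1, hp.r5, hp.r13]) (by simp [h₁.1, hp.r13])
      (by omega) (by omega) ?_ ?_) fun s₂ h₂ =>
    Runs.fill hf.pos (2 * R) (E + 2 * R) (fun j => s₂.mem (E + 4 * R + (j : ℕ)))
      (Q := fun s' => (∀ r, r ≠ 40 → s'.reg r = s.reg r) ∧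
      (∀ a < E + 2 * R, s'.mem a = s.mem a) ∧
      ∀ j < R, s'.mem (E + 2 * R + (j : ℕ)) = re' j ∧ s'.mem (E + 2 * R + R + (j : ℕ)) = im' j)
      (by simp) (by simp) (by simp [h₂.1, hp.r5, hp.r13]) (by simp [h₂.1, hp.r13])
      (by omega) (by push_cast; omega) ?_ ?_) ?_ fun s' h => h
  · intro k hk M hM hM'
    exact (key k hk M fun a ha => hM' a (Or.inl ha)).1
  · intro M hM hM'
    exact ⟨fun r hr => by simp [hr], fun a ha => hM' a (Or.inl ha), hM⟩
  · obtain ⟨h1, h2, h3⟩ := h₁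
    intro k hk M hM hM'
    have hreg : (s₁.set 40 k).reg = (s.set 40 k).reg := by
      funext r; by_cases hr : r = 40 <;> simp [hr, h1]
    rw [hreg]
    exact (key k hk M fun a ha => by rw [hM' a (Or.inl (by omega)), h2 a ha]).2
  · obtain ⟨h1, h2, h3⟩ := h₁
    intro M hM hM'
    refine ⟨fun r hr => by simp [hr, h1], fun a ha => ?_, fun j hj => ⟨?_, hM j hj⟩⟩
    · simp only; rw [hM' a (Or.inl (by omega)), h2 a ha]
    · simp only; rw [hM' _ (Or.inl (by omega)), h3 j hj]
  · obtain ⟨h1, h2, h3⟩ := h₂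
    intro k hk M hM hM'
    have : M (E + 4 * R + k) = s₂.mem (E + 4 * R + k) := hM' _ (Or.inr (by omega))
    simp [h1, hp.r5, hp.r13, InWord, this]
    omega
  · obtain ⟨h1, h2, h3⟩ := h₂
    intro M hM hM'
    refine ⟨fun r hr => by simp [hr, h1], fun a ha => ?_, fun j hj => ?_⟩
    · simp only; rw [hM' a (Or.inl (by omega)), h2 a (by omega)]
    · simp only
      rw [hM j (by omega), (h3 j hj).1]
      have h4 := hM (R + j) (by omega)
      push_cast at h4
      rw [add_assoc, h4, ← (h3 j hj).2]
      refine ⟨rfl, ?_⟩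
      congr 1; ring
  · simp
    nlinarith

/-- The size of the errors and values in a transform. -/
structure SmallError (R : ℕ) (A e : ℝ) : Prop where
  nonneg : 0 ≤ A
  nonneg_error : 0 ≤ e
  le_pow : R * A ≤ (R : ℝ) ^ 4
  le_scale : R * (e + (2 + (R : ℝ) ^ 15 * (R * A + 1))) ≤ scale R

theorem runs_fftStep {w R h n : ℕ} {E : ℤ} {s : ZState} (hf : Fits w E R) (hp : HasParams E R s)
    (hw : HoldsRoots s.mem E R) (hR : n * (2 * h) = R) (h23 : s.reg 23 = h) (h24 : s.reg 24 = n)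
    {z : ℕ → ℂ} {e B : ℝ} (hx : HoldsApprox s.mem (E + 2 * R) R (stage R (2 * h) n z) e)
    (hB : ∀ i, ‖stage R (2 * h) n z i‖ ≤ B) (heS : e ≤ scale R) (hBR : B ≤ (R : ℝ) ^ 4) :
    Runs w (mapComplex stepRe stepIm) s (280 * R + 50) fun s' => (∀ r, r ≠ 40 → s'.reg r = s.reg r) ∧
      (∀ a < E + 2 * R, s'.mem a = s.mem a) ∧
      HoldsApprox s'.mem (E + 2 * R) R (stage R h (2 * n) z)
        (2 * e + (2 + (R : ℝ) ^ 15 * (B + 1))) := by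
  have hR4 := hf.four_le
  have hE := hf.nonneg
  have hlt := hf.lt
  have hSp := scale_pos hR4
  obtain ⟨wr, wi, hwa, hwm⟩ := hw
  obtain ⟨re, im, hxa, hxm⟩ := hx
  have hstep := hwa.step hR (by omega) hSp hxa hB heS
  have hsrc : ∀ i, srcIndex h n i + h < R := fun i => srcIndex_lt hR (by omega)
  have hbd : ∀ i < R, |wr (i - i % h) * re (srcIndex h n i + h) -
        wi (i - i % h) * im (srcIndex h n i + h)| ≤ scale R ^ 3 ∧
      |wr (i - i % h) * im (srcIndex h n i + h) +
        wi (i - i % h) * re (srcIndex h n i + h)| ≤ scale R ^ 3 := by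
    intro i hi
    have : (1 : ℝ) ≤ R := by exact_mod_cast (show 1 ≤ R by omega)
    exact abs_mul_le_scale hR4 (hwa (i - i % h) (by omega))
      (by rw [norm_root_pow]; exact one_le_pow₀ this) (pow_le_scale hR4 (by norm_num))
      (hxa (srcIndex h n i + h) (hsrc i)) ((hB _).trans hBR) heS le_rfl
  have key : ∀ i < R, ∀ M : ℤ → ℤ, (∀ a < E + 4 * R, M a = s.mem a) →
      (stepRe.Ok w ⟨(s.set 40 i).reg, M⟩ ∧ stepRe.evalZ ⟨(s.set 40 i).reg, M⟩ =
        re (srcIndex h n i) + (wr (i - i % h) * re (srcIndex h n i + h) -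
        wi (i - i % h) * im (srcIndex h n i + h)) / scale R) ∧
      (stepIm.Ok w ⟨(s.set 40 i).reg, M⟩ ∧ stepIm.evalZ ⟨(s.set 40 i).reg, M⟩ =
        im (srcIndex h n i) + (wr (i - i % h) * im (srcIndex h n i + h) +
        wi (i - i % h) * re (srcIndex h n i + h)) / scale R) := by
    intro i hi M hM
    set t : ZState := ⟨(s.set 40 i).reg, M⟩ with ht
    have t5 : t.reg 5 = E := by simp [ht, hp.r5]
    have t13 : t.reg 13 = R := by simp [ht, hp.r13]
    have t14 : t.reg 14 = scale R := by simp [ht, hp.r14]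
    have t15 : t.reg 15 = scale R ^ 2 := by simp [ht, hp.r15]
    have t23 : t.reg 23 = h := by simp [ht, h23]
    have t24 : t.reg 24 = n := by simp [ht, h24]
    have t40 : t.reg 40 = i := by simp [ht]
    have tm : t.mem = M := rfl
    have v1 := evalZ_srcExpr t23 t24 t40
    have v2 := evalZ_expExpr t23 t40
    have o := ok_srcExpr (w := w) t23 t24 t40 hR hi (by linarith)
    have hs := hsrc i
    have hq : i - i % h < R := by omega
    have x1 := hxm (srcIndex h n i) (by omega)
    have x2 := hxm (srcIndex h n i + h) hs
    have w1 := hwm (i - i % h) hq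
    set q := i - i % h
    set u := srcIndex h n i
    push_cast at x2
    have m1 : M (E + 2 * R + u) = re u := by rw [hM _ (by omega), x1.1]
    have m2 : M (E + 3 * R + u) = im u := by
      rw [hM _ (by omega), ← x1.2]; congr 1; ring
    have m3 : M (E + 2 * R + (u + h)) = re (u + h) := by rw [hM _ (by omega), x2.1]
    have m4 : M (E + 3 * R + (u + h)) = im (u + h) := by
      rw [hM _ (by omega), ← x2.2]; congr 1; ring
    have m5 : M (E + q) = wr q := by rw [hM _ (by omega), w1.1]
    have m6 : M (E + R + q) = wi q := by rw [hM _ (by omega), w1.2]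
    have hb := hbd i hi
    refine ⟨⟨?_, ?_⟩, ?_, ?_⟩
    · rw [stepRe, Expr.ok_add]
      refine ⟨?_, ok_rdiv hSp t14 t15 hf.scale_lt ?_ ?_⟩
      · simp [o, t5, t13, v1, InWord]; omega
      · simp [o, t5, t13, t23, v1, v2, InWord]; omega
      · simpa [t5, t13, t23, v1, v2, tm, m3, m4, m5, m6] using hb.1
    · rw [stepRe, Expr.evalZ_add, evalZ_rdiv hSp t14 t15]
      simp [t5, t13, t23, v1, v2, tm, m1, m3, m4, m5, m6]
    · rw [stepIm, Expr.ok_add]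
      refine ⟨?_, ok_rdiv hSp t14 t15 hf.scale_lt ?_ ?_⟩
      · simp [o, t5, t13, v1, InWord]; omega
      · simp [o, t5, t13, t23, v1, v2, InWord]; omega
      · simpa [t5, t13, t23, v1, v2, tm, m3, m4, m5, m6] using hb.2
    · rw [stepIm, Expr.evalZ_add, evalZ_rdiv hSp t14 t15]
      simp [t5, t13, t23, v1, v2, tm, m2, m3, m4, m5, m6]
  set re' : ℕ → ℤ := fun i => re (srcIndex h n i) + (wr (i - i % h) * re (srcIndex h n i + h) -
        wi (i - i % h) * im (srcIndex h n i + h)) / scale R with hre'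
  set im' : ℕ → ℤ := fun i => im (srcIndex h n i) + (wr (i - i % h) * im (srcIndex h n i + h) +
        wi (i - i % h) * re (srcIndex h n i + h)) / scale R with him'
  refine Runs.mono (runs_mapComplex hf hp key) (by simp [stepRe, stepIm, srcExpr, expExpr]; omega)
    fun s' h => ⟨h.1, h.2.1, re', im', hstep, h.2.2⟩

theorem runs_fft {w ρ R : ℕ} {E : ℤ} {s : ZState} (hRρ : R = 2 ^ ρ) (hf : Fits w E R)
    (hp : HasParams E R s) (hw : HoldsRoots s.mem E R) {z : ℕ → ℂ} {e A : ℝ}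
    (hx : HoldsApprox s.mem (E + 2 * R) R z e) (hA : ∀ i, ‖z i‖ ≤ A) (hs : SmallError R A e) :
    Runs w fft s (ρ * (280 * R + 70) + 20) fun s' => Frame 20 (E + 2 * R) s s' ∧
      HoldsApprox s'.mem (E + 2 * R) R (dft R z)
        (R * (e + (2 + (R : ℝ) ^ 15 * (R * A + 1)))) := by
  have hR4 := hf.four_le
  have hE := hf.nonneg
  have hlt := hf.lt
  set κ : ℝ := 2 + (R : ℝ) ^ 15 * (R * A + 1) with hκ
  have hA0 := hs.nonneg
  have he0 := hs.nonneg_error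
  have hκ0 : 0 ≤ κ := by positivity
  have hsplit : ∀ l < ρ, (2 : ℤ) ^ (ρ - l) = 2 * 2 ^ (ρ - (l + 1)) := fun l hl => by
    rw [← pow_succ']; congr 1; omega
  have hword : ∀ l ≤ ρ, InWord w ((2 : ℤ) ^ (ρ - l)) := fun l hl => by
    refine ⟨by positivity, ?_⟩
    have : (2 : ℤ) ^ (ρ - l) ≤ 2 ^ ρ := pow_le_pow_right₀ (by norm_num) (by omega)
    have h2 : (R : ℤ) = 2 ^ ρ := by rw [hRρ]; push_cast; rfl
    omega
  -- One step maps the error e to 2e + κ, with R A bounding the values at all stages. The solution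
  -- of this recursion is 2^l (e + κ) - κ, at most R (e + κ) at the end.
  have herr : ∀ l ≤ ρ, 2 ^ l * (e + κ) - κ ≤ scale R := fun l hl => by
    have h1 : (2 : ℝ) ^ l ≤ R := by
      rw [hRρ]; push_cast; exact pow_le_pow_right₀ (by norm_num) hl
    have := mul_le_mul_of_nonneg_right h1 (by positivity : 0 ≤ e + κ)
    linarith [hs.le_scale]
  let I : ℕ → ZState → Prop := fun l s' => (∀ r < 20, s'.reg r = s.reg r) ∧
    (∀ a < E + 2 * R, s'.mem a = s.mem a) ∧ s'.reg 23 = 2 ^ (ρ - l) / 2 ∧ s'.reg 24 = 2 ^ l ∧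
    HoldsApprox s'.mem (E + 2 * R) R (stage R (2 ^ (ρ - l)) (2 ^ l) z) (2 ^ l * (e + κ) - κ)
  refine Runs.mono (Runs.assign_seq ?_ <| Runs.assign_seq (by simp) <|
    Runs.loop hf.pos ρ (fun _ => 280 * R + 50 + 8) I ?_ ?_ ?_ ?_
    (Q := fun s' => Frame 20 (E + 2 * R) s s' ∧
      HoldsApprox s'.mem (E + 2 * R) R (dft R z) (R * (e + κ))) ?_) ?_ fun s' h => h
  · simp [hp.r13]
    exact ⟨⟨by positivity, by omega⟩, by norm_num, by omega⟩
  · refine ⟨fun r hr => ?_, fun a ha => rfl, ?_, by simp, ?_⟩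
    · simp [show r ≠ 24 by omega, show r ≠ 23 by omega]
    · simp [hp.r13, hRρ]
    · obtain ⟨re, im, h1, h2⟩ := hx
      refine ⟨re, im, fun i hi => ?_, h2⟩
      rw [Nat.sub_zero, ← hRρ, pow_zero, pow_zero, stage_start z hi]
      simpa using h1 i hi
  · rintro l hl s' ⟨-, -, h3, -⟩
    have h := hword l hl
    simp only [Expr.ok_less, Expr.ok_ofNat, Expr.ok_reg, Expr.evalZ_reg, Expr.evalZ_ofNat, h3,
      true_and]
    exact ⟨⟨le_rfl, by positivity⟩, Int.ediv_nonneg h.1 (by norm_num),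
      lt_of_le_of_lt (Int.ediv_le_self _ h.1) h.2⟩
  · rintro l hl s' ⟨-, -, h3, -⟩
    simp only [Expr.evalZ_ofNat, Expr.evalZ_reg, h3, hsplit l hl]
    rw [Int.mul_ediv_cancel_left _ (by norm_num)]
    positivity
  · rintro s' ⟨h1, h2, h3, h4, h5⟩
    refine ⟨by simp [h3], ⟨h1, h2⟩, ?_⟩
    obtain ⟨re, im, h6, h7⟩ := h5
    refine ⟨re, im, fun i hi => ?_, h7⟩
    have := h6 i hi
    rw [Nat.sub_self, pow_zero, ← hRρ, stage_end] at this
    have h2 : (2 : ℝ) ^ ρ = R := by rw [hRρ]; push_cast; rfl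
    rw [h2] at this
    linarith
  · rintro l hl s' ⟨h1, h2, h3, h4, h5⟩
    rw [hsplit l hl, Int.mul_ediv_cancel_left _ (by norm_num)] at h3
    have hp' := hp.of_frame h1
    have hh : ((2 ^ (ρ - (l + 1)) : ℕ) : ℤ) = 2 ^ (ρ - (l + 1)) := by push_cast; rfl
    have h2h : 2 ^ (ρ - l) = 2 * 2 ^ (ρ - (l + 1)) := by exact_mod_cast hsplit l hl
    have hprod : 2 ^ l * (2 * 2 ^ (ρ - (l + 1))) = R := by
      rw [← h2h, ← pow_add, hRρ]; congr 1; omega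
    rw [h2h] at h5
    have hB : ∀ i, ‖stage R (2 * 2 ^ (ρ - (l + 1))) (2 ^ l) z i‖ ≤ R * A := fun i => by
      refine (norm_partialDFT_le z _ _ hA).trans (mul_le_mul_of_nonneg_right ?_ hA0)
      rw [hRρ]; push_cast; exact pow_le_pow_right₀ (by norm_num) hl.le
    refine Runs.mono (Runs.seq (runs_fftStep hf hp' (hw.congr fun a _ ha => h2 a ha) hprod
      (by rw [h3, hh]) (by rw [h4]; push_cast; rfl) h5 hB (herr l hl.le) hs.le_pow)
      fun s'' hs'' => Runs.assign_seq ?_ <| Runs.assign (Q := I (l + 1)) (by simp) ?_) (by simp)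
      fun s' h => h
    · obtain ⟨g1, g2, g3⟩ := hs''
      have := hword (l + 1) (by omega)
      simp [g1, h3, this]
      exact ⟨by norm_num, by omega⟩
    · obtain ⟨g1, g2, g3⟩ := hs''
      refine ⟨fun r hr => ?_, fun a ha => ?_, ?_, ?_, ?_⟩
      · simp [show r ≠ 24 by omega, show r ≠ 23 by omega, g1 r (by omega), h1 r hr]
      · simp [g2 a ha, h2 a ha]
      · simp [g1, h3]
      · simp [g1, h4, pow_succ]
      · have e1 : 2 * (2 ^ l * (e + κ) - κ) + κ = 2 ^ (l + 1) * (e + κ) - κ := by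
          rw [pow_succ]; ring
        rw [← hκ, e1, ← pow_succ'] at g3
        exact g3
  · simp only [Finset.sum_const, Finset.card_range, smul_eq_mul]
    simp
    nlinarith

end WordRAM

namespace WordRAM

/-! ### Binary digits -/

/-- The carries in the binary normalisation of the digits `z`. -/
def carry (z : ℕ → ℤ) : ℕ → ℤ
  | 0 => 0
  | i + 1 => (z i + carry z i) / 2

/-- Nested floors compose, also for negative digits: the carry into place i is the value of the
lower digits divided by 2^i, rounded down. -/
theorem carry_eq (z : ℕ → ℤ) (i : ℕ) :
    carry z i = (∑ j ∈ Finset.range i, z j * 2 ^ j) / 2 ^ i := by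
  induction i with
  | zero => simp [carry]
  | succ i ih =>
    rw [carry, ih, Finset.sum_range_succ, pow_succ, ← Int.ediv_ediv_of_nonneg (by positivity),
      Int.add_mul_ediv_right _ _ (by positivity), add_comm]

/-- A digit and a carry in [-B, B] add up to at most 2B in absolute value, and halving returns the
next carry to [-B, B]. -/
theorem abs_carry_le {z : ℕ → ℤ} {B : ℤ} {n : ℕ} (hB : 0 ≤ B) (hz : ∀ i < n, |z i| ≤ B) :
    ∀ i ≤ n, |carry z i| ≤ B := by
  intro i
  induction i with
  | zero => intro _; simpa [carry] using hB
  | succ i ih =>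
    intro hi
    have h1 := abs_le.1 (ih (by omega))
    have h2 := abs_le.1 (hz i (by omega))
    rw [carry, abs_le]
    constructor <;> omega

/-- After division by 2^i the digits above place i contribute an even integer. -/
theorem add_carry_emod_two (z : ℕ → ℤ) {i n : ℕ} (hi : i < n) :
    (z i + carry z i) % 2 = (∑ j ∈ Finset.range n, z j * 2 ^ j) / 2 ^ i % 2 := by
  have hp : (2 : ℤ) ^ i ≠ 0 := by positivity
  obtain ⟨k, hk⟩ : ∃ k, ∑ j ∈ Finset.range n, z j * 2 ^ j =
      ∑ j ∈ Finset.range (i + 1), z j * 2 ^ j + 2 * k * 2 ^ i := by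
    obtain ⟨d, rfl⟩ := Nat.exists_eq_add_of_le (Nat.succ_le_of_lt hi)
    refine ⟨∑ j ∈ Finset.range d, z (i.succ + j) * 2 ^ j, ?_⟩
    rw [Finset.sum_range_add, Finset.mul_sum, Finset.sum_mul]
    congr 1
    refine Finset.sum_congr rfl fun j _ => ?_
    rw [pow_add, pow_succ]; ring
  rw [hk, Finset.sum_range_succ, add_assoc, ← add_mul, Int.add_mul_ediv_right _ _ hp, ← carry_eq,
    ← add_assoc, Int.add_mul_emod_self_left, add_comm]

theorem ediv_emod_two_of_modEq {V : ℤ} {v L i : ℕ} (h : V ≡ v [ZMOD 2 ^ L]) (hi : i < L) :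
    V / 2 ^ i % 2 = (v.testBit i).toNat := by
  have hp : (2 : ℤ) ^ i ≠ 0 := by positivity
  obtain ⟨k, hk⟩ := h.symm.dvd
  have hV : V = v + 2 * (2 ^ (L - (i + 1)) * k) * 2 ^ i := by
    have : (2 : ℤ) ^ L = 2 * 2 ^ (L - (i + 1)) * 2 ^ i := by
      rw [← pow_succ', ← pow_add]; congr 1; omega
    rw [this] at hk
    linear_combination hk
  rw [hV, Int.add_mul_ediv_right _ _ hp, Int.add_mul_emod_self_left]
  have := Nat.testBit_eq_decide_div_mod_eq (x := v) (i := i)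
  rw [this]
  have h2 : ((v / 2 ^ i % 2 : ℕ) : ℤ) = (v : ℤ) / 2 ^ i % 2 := by push_cast; rfl
  rw [← h2]
  rcases Nat.mod_two_eq_zero_or_one (v / 2 ^ i) with h | h <;> simp [h]

theorem sum_testBit_mul (v n : ℕ) :
    ∑ i ∈ Finset.range n, ((v.testBit i).toNat : ℤ) * 2 ^ i = (v % 2 ^ n : ℕ) := by
  induction n with
  | zero => simp [Nat.mod_one]
  | succ n ih =>
    rw [Finset.sum_range_succ, ih, Nat.mod_pow_succ, Nat.testBit_eq_decide_div_mod_eq]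
    rcases Nat.mod_two_eq_zero_or_one (v / 2 ^ n) with h | h <;> simp [h]

theorem sum_range_mul_eq (f : ℕ → ℤ) (U M : ℕ) :
    ∑ i ∈ Finset.range (U * M), f i =
      ∑ x ∈ Finset.range U, ∑ c ∈ Finset.range M, f (x * M + c) := by
  induction U with
  | zero => simp
  | succ U ih => rw [add_mul, one_mul, Finset.sum_range_add, ih, Finset.sum_range_succ]

/-- The digits of a number whose digits in base `2 ^ M` are given. -/
theorem testBit_sum_mul_pow {h : ℕ → ℕ} {M U : ℕ} (hh : ∀ x < U, h x < 2 ^ M) {x c : ℕ}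
    (hx : x < U) (hc : c < M) :
    (∑ x ∈ Finset.range U, h x * (2 ^ M) ^ x).testBit (x * M + c) = (h x).testBit c := by
  induction U generalizing x h with
  | zero => omega
  | succ U ih =>
    have e : ∑ x ∈ Finset.range (U + 1), h x * (2 ^ M) ^ x =
        2 ^ M * (∑ x ∈ Finset.range U, h (x + 1) * (2 ^ M) ^ x) + h 0 := by
      rw [Finset.sum_range_succ', Finset.mul_sum, pow_zero, mul_one]
      congr 1
      refine Finset.sum_congr rfl fun y _ => ?_
      rw [pow_succ]; ring
    rw [e, Nat.testBit_two_pow_mul_add _ (hh 0 (by omega))]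
    rcases x with _ | x
    · simp [hc]
    · rw [if_neg (by rw [add_mul]; omega), show (x + 1) * M + c - M = x * M + c by
        rw [add_mul]; omega]
      exact ih (h := fun y => h (y + 1)) (fun y hy => hh (y + 1) (by omega)) (by omega)

/-- The product of two numbers given by digits, up to the place of the last digit. -/
theorem sum_mul_sum_modEq (a c : ℕ → ℤ) (b : ℤ) (N : ℕ) :
    (∑ i ∈ Finset.range N, a i * b ^ i) * (∑ i ∈ Finset.range N, c i * b ^ i) ≡
      ∑ j ∈ Finset.range N, (∑ k ∈ Finset.range (j + 1), a k * c (j - k)) * b ^ j [ZMOD b ^ N] := by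
  have h1 : ∑ j ∈ Finset.range N, (∑ k ∈ Finset.range (j + 1), a k * c (j - k)) * b ^ j =
      ∑ i ∈ Finset.range N, ∑ k ∈ Finset.range (N - i), a i * b ^ i * (c k * b ^ k) := by
    rw [← Finset.sum_range_diag_flip N (fun i k => a i * b ^ i * (c k * b ^ k))]
    refine Finset.sum_congr rfl fun j _ => ?_
    rw [Finset.sum_mul]
    refine Finset.sum_congr rfl fun k hk => ?_
    have : j = k + (j - k) := by have := Finset.mem_range.1 hk; omega
    conv_lhs => rw [this, pow_add]
    rw [Nat.add_sub_cancel_left]; ring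
  rw [h1, Finset.sum_mul_sum]
  refine Int.ModEq.sum fun i hi => ?_
  have hi := Finset.mem_range.1 hi
  obtain ⟨d, hd⟩ := Nat.exists_eq_add_of_le (show N - i ≤ N by omega)
  -- For fixed i the product has terms for all k < N, the truncated convolution only those with k <
  -- N - i; the others have i + k ≥ N and are divisible by b^N.
  rw [show Finset.range N = Finset.range (N - i + d) by rw [← hd], Finset.sum_range_add]
  refine (Int.modEq_iff_dvd.2 ?_)
  rw [sub_add_cancel_left, dvd_neg]
  refine Finset.dvd_sum fun k _ => ?_
  refine ⟨a i * c (N - i + k) * b ^ k, ?_⟩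
  have hN : b ^ N = b ^ i * b ^ (N - i) := by rw [← pow_add]; congr 1; omega
  rw [hN, pow_add]
  ring

/-- The sequence of digits at the address `a`, in rows of length `m`, is re-spaced to rows of
length `2 m`. -/
def spread (M : ℤ → ℤ) (a : ℤ) (m N i : ℕ) : ℤ :=
  if i < N ∧ i % (2 * m) < m then M (a + (i / (2 * m) * m + i % (2 * m) : ℕ)) else 0

theorem sum_spread {M : ℤ → ℤ} {a : ℤ} {m U : ℕ} {f : ℕ → ℕ} (hf : ∀ x < U, f x < 2 ^ m)
    (hM : ∀ x < U, ∀ c < m, M (a + (x * m + c : ℕ)) = ((f x).testBit c).toNat) :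
    ∑ i ∈ Finset.range (U * (2 * m)), spread M a m (U * (2 * m)) i * 2 ^ i =
      ∑ x ∈ Finset.range U, (f x : ℤ) * (2 ^ (2 * m)) ^ x := by
  rw [sum_range_mul_eq]
  refine Finset.sum_congr rfl fun x hx => ?_
  have hx := Finset.mem_range.1 hx
  have hs : ∀ c < 2 * m, spread M a m (U * (2 * m)) (x * (2 * m) + c) =
      if c < m then (((f x).testBit c).toNat : ℤ) else 0 := by
    intro c hc
    have h1 : (x * (2 * m) + c) % (2 * m) = c := by
      rw [add_comm, Nat.add_mul_mod_self_right, Nat.mod_eq_of_lt hc]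
    have h2 : (x * (2 * m) + c) / (2 * m) = x := by
      rw [add_comm, Nat.add_mul_div_right _ _ (by omega), Nat.div_eq_of_lt hc, zero_add]
    have h3 : x * (2 * m) + c < U * (2 * m) := by
      calc x * (2 * m) + c < (x + 1) * (2 * m) := by rw [add_mul]; omega
        _ ≤ U * (2 * m) := Nat.mul_le_mul_right _ hx
    rw [spread, h1, h2]
    by_cases hcm : c < m
    · rw [if_pos ⟨h3, hcm⟩, if_pos hcm, hM x hx c hcm]
    · rw [if_neg (fun h => hcm h.2), if_neg hcm]
  rw [show 2 * m = m + m by ring, Finset.sum_range_add, ← show 2 * m = m + m by ring]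
  have e1 : ∑ c ∈ Finset.range m, spread M a m (U * (2 * m)) (x * (2 * m) + c) *
      2 ^ (x * (2 * m) + c) = f x * (2 ^ (2 * m)) ^ x := by
    have : ∀ c ∈ Finset.range m, spread M a m (U * (2 * m)) (x * (2 * m) + c) *
        2 ^ (x * (2 * m) + c) = (((f x).testBit c).toNat * 2 ^ c) * (2 ^ (2 * m)) ^ x := by
      intro c hc
      have hc := Finset.mem_range.1 hc
      rw [hs c (by omega), if_pos hc, pow_add, ← pow_mul, mul_comm (2 * m) x]; ring
    rw [Finset.sum_congr rfl this, ← Finset.sum_mul, sum_testBit_mul,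
      Nat.mod_eq_of_lt (hf x hx)]
  have e2 : ∑ c ∈ Finset.range m, spread M a m (U * (2 * m)) (x * (2 * m) + (m + c)) *
      2 ^ (x * (2 * m) + (m + c)) = 0 := by
    refine Finset.sum_eq_zero fun c hc => ?_
    have hc := Finset.mem_range.1 hc
    rw [hs (m + c) (by omega), if_neg (by omega), zero_mul]
  rw [e1, e2, add_zero]

/-- The convolution of two re-spaced sequences of digits has the product as its value. -/
theorem sum_conv_spread {M M' : ℤ → ℤ} {a a' : ℤ} {m U : ℕ} {f g h : ℕ → ℕ}
    (hf : ∀ x < U, f x < 2 ^ m) (hg : ∀ x < U, g x < 2 ^ m)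
    (hM : ∀ x < U, ∀ c < m, M (a + (x * m + c : ℕ)) = ((f x).testBit c).toNat)
    (hM' : ∀ x < U, ∀ c < m, M' (a' + (x * m + c : ℕ)) = ((g x).testBit c).toNat)
    (hh : ∀ x, h x = ∑ k ∈ Finset.range (x + 1), f k * g (x - k)) :
    ∑ j ∈ Finset.range (U * (2 * m)), (∑ k ∈ Finset.range (j + 1),
      spread M a m (U * (2 * m)) k * spread M' a' m (U * (2 * m)) (j - k)) * 2 ^ j ≡
      ((∑ x ∈ Finset.range U, h x * (2 ^ (2 * m)) ^ x : ℕ) : ℤ) [ZMOD 2 ^ (U * (2 * m))] := by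
  refine (sum_mul_sum_modEq _ _ 2 _).symm.trans ?_
  rw [sum_spread hf hM, sum_spread hg hM']
  have := sum_mul_sum_modEq (fun x => (f x : ℤ)) (fun x => (g x : ℤ)) (2 ^ (2 * m)) U
  rw [← pow_mul, mul_comm (2 * m) U] at this
  refine this.trans (congrArg (· % (2 : ℤ) ^ (U * (2 * m))) ?_)
  push_cast
  refine Finset.sum_congr rfl fun x _ => ?_
  rw [hh]; push_cast; rfl

end WordRAM

namespace WordRAM

open Complex

/-! ### Products of blocks -/

/-- Write the binary digits of the number with the signed digits at the address in register `25`
to the address in register `26`. The number of digits is in register `27`, the address of the work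
space in register `28`, a bound for the digits in register `29`. -/
def normalize : Cmd :=
  .store (.reg 28) 0 ;;
  .fill 40 (.reg 28 + 1) (.reg 27)
    ((.load (.reg 25 + .reg 40) + .load (.reg 28 + .reg 40) + 2 * .reg 29) / 2 - .reg 29) ;;
  .fill 40 (.reg 26) (.reg 27)
    ((.load (.reg 25 + .reg 40) + .load (.reg 28 + .reg 40) + 2 * .reg 29) % 2)

/-- A digit plus its carry has absolute value at most 2B, so adding 2B makes it a word without
changing its parity; the quotient by 2 is corrected by B. All carries are tabulated first, and then
the bits are read off in a second pass. -/
theorem runs_normalize {w : ℕ} {s : ZState} (hw : 0 < w) (L : ℕ) (z : ℕ → ℤ) {B zb ob cb : ℤ}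
    (h25 : s.reg 25 = zb) (h26 : s.reg 26 = ob) (h27 : s.reg 27 = L) (h28 : s.reg 28 = cb)
    (h29 : s.reg 29 = B) (hz : ∀ i < L, s.mem (zb + (i : ℕ)) = z i) (hzB : ∀ i < L, |z i| ≤ B)
    (hB : 0 < B) (hBw : 4 * B < 2 ^ w) (hzb : 0 ≤ zb) (hob : 0 ≤ ob) (hcb : 0 ≤ cb)
    (hzw : zb + L < 2 ^ w) (how : ob + L < 2 ^ w) (hcw : cb + 1 + L < 2 ^ w)
    (d1 : zb + L ≤ cb ∨ cb + L + 1 ≤ zb) (d2 : ob + L ≤ cb ∨ cb + L + 1 ≤ ob)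
    (d3 : ob + L ≤ zb ∨ zb + L ≤ ob) :
    Runs w normalize s (60 * L + 30) fun s' => (∀ r, r ≠ 40 → s'.reg r = s.reg r) ∧
      (∀ a, (a < ob ∨ ob + L ≤ a) → (a < cb ∨ cb + L + 1 ≤ a) → s'.mem a = s.mem a) ∧
      ∀ i < L, s'.mem (ob + (i : ℕ)) = (∑ j ∈ Finset.range L, z j * 2 ^ j) / 2 ^ i % 2 := by
  have hc := abs_carry_le hB.le hzB
  have hval : ∀ i < L, InWord w (z i + carry z i + 2 * B) := fun i hi => by
    have h1 := abs_le.1 (hzB i hi)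
    have h2 := abs_le.1 (hc i hi.le)
    exact ⟨by linarith, by linarith⟩
  have h2w : InWord w 2 := ⟨by norm_num, by linarith⟩
  have ev : ∀ k < L, ∀ t : ZState, t.reg 25 = zb → t.reg 28 = cb → t.reg 29 = B → t.reg 40 = k →
      t.mem (zb + k) = z k → t.mem (cb + k) = carry z k →
      ((Expr.load (.reg 25 + .reg 40) + .load (.reg 28 + .reg 40) + 2 * .reg 29) / 2 -
        .reg 29).Ok w t ∧
      ((Expr.load (.reg 25 + .reg 40) + .load (.reg 28 + .reg 40) + 2 * .reg 29) / 2 -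
        .reg 29).evalZ t = carry z (k + 1) ∧
      ((Expr.load (.reg 25 + .reg 40) + .load (.reg 28 + .reg 40) + 2 * .reg 29) % 2).Ok w t ∧
      ((Expr.load (.reg 25 + .reg 40) + .load (.reg 28 + .reg 40) + 2 * .reg 29) % 2).evalZ t =
        (∑ j ∈ Finset.range L, z j * 2 ^ j) / 2 ^ k % 2 := by
    intro k hk t t25 t28 t29 t40 m1 m2
    have e := hval k hk
    have a1 : InWord w (zb + k) := ⟨by omega, by omega⟩
    have a2 : InWord w (cb + k) := ⟨by omega, by omega⟩
    refine ⟨?_, ?_, ?_, ?_⟩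
    · simp [t25, t28, t29, t40, m1, m2, e, a1, a2, h2w]
    · simp [t25, t28, t29, t40, m1, m2, carry]; omega
    · simp [t25, t28, t29, t40, m1, m2, e, a1, a2, h2w]
    · rw [← add_carry_emod_two z hk]
      simp [t25, t28, t29, t40, m1, m2]
  refine Runs.mono (Runs.store_seq (by simp) (by simp)
    (by simp [h28]; exact ⟨hcb, by linarith⟩) <|
    Runs.seq (P := fun s' => (∀ r, r ≠ 40 → s'.reg r = s.reg r) ∧
      (∀ a, (a < cb ∨ cb + L + 1 ≤ a) → s'.mem a = s.mem a) ∧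
      ∀ i ≤ L, s'.mem (cb + (i : ℕ)) = carry z i)
    (Runs.fill hw L (cb + 1) (fun i => carry z (i + 1)) (by simp) (by simp)
      (by simp [h28]) (by simp [h27]) (by omega) (by omega) ?_ ?_) fun s₁ h₁ =>
    Runs.fill hw L ob (fun i => (∑ j ∈ Finset.range L, z j * 2 ^ j) / 2 ^ i % 2)
      (Q := fun s' => (∀ r, r ≠ 40 → s'.reg r = s.reg r) ∧
      (∀ a, (a < ob ∨ ob + L ≤ a) → (a < cb ∨ cb + L + 1 ≤ a) → s'.mem a = s.mem a) ∧
      ∀ i < L, s'.mem (ob + (i : ℕ)) = (∑ j ∈ Finset.range L, z j * 2 ^ j) / 2 ^ i % 2)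
      (by simp) (by simp) (by simp [h₁.1, h26]) (by simp [h₁.1, h27])
      (by omega) (by omega) ?_ ?_) ?_ fun s' h => h
  · intro k hk M hM hM'
    have := ev k hk ⟨((s.put cb 0).set 40 k).reg, M⟩ (by simp [h25]) (by simp [h28])
      (by simp [h29]) (by simp) ?_ ?_
    · simp only [Expr.evalZ_reg, Expr.evalZ_ofNat, h28]
      exact ⟨this.1, this.2.1⟩
    · simp only
      rw [hM' _ (by omega), ← hz k hk]
      simp [h28]; omega
    · simp only
      rcases k with _ | k
      · rw [hM' _ (by left; push_cast; omega)]; simp [carry, h28]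
      · rw [← hM k (by omega)]; congr 1; push_cast; ring
  · intro M hM hM'
    refine ⟨fun r hr => by simp [hr], fun a ha => ?_, fun i hi => ?_⟩
    · simp only; rw [hM' a (by omega)]; simp [h28]; omega
    · rcases i with _ | i
      · simp only; rw [hM' _ (by left; push_cast; omega)]; simp [carry, h28]
      · change M _ = _
        rw [← hM i (by omega)]; congr 1; push_cast; ring
  · obtain ⟨g1, g2, g3⟩ := h₁
    intro k hk M hM hM'
    have := ev k hk ⟨(s₁.set 40 k).reg, M⟩ (by simp [g1, h25]) (by simp [g1, h28])
      (by simp [g1, h29]) (by simp)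
      (by simp only; rw [hM' _ (by omega), g2 _ (by omega), hz k hk])
      (by simp only; rw [hM' _ (by omega), g3 _ hk.le])
    exact this.2.2
  · obtain ⟨g1, g2, g3⟩ := h₁
    intro M hM hM'
    refine ⟨fun r hr => by simp [hr, g1], fun a h1 h2 => ?_, hM⟩
    simp only; rw [hM' a h1, g2 a h2]
  · simp; omega

/-- The scaled digit of the block with the address `b`, re-spaced. -/
def spreadExpr (b : Expr) : Expr :=
  .reg 14 * .less (.reg 40) (.reg 12) * .less (.reg 40 % (2 * .reg 11)) (.reg 11) *
    .load (b + (.reg 40 / (2 * .reg 11) * .reg 11 + .reg 40 % (2 * .reg 11)))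

/-- Square the complex numbers. -/
def squareAll : Cmd :=
  mapComplex
    (rdiv (.load (.reg 5 + 2 * .reg 13 + .reg 40) * .load (.reg 5 + 2 * .reg 13 + .reg 40) -
      .load (.reg 5 + 3 * .reg 13 + .reg 40) * .load (.reg 5 + 3 * .reg 13 + .reg 40)))
    (rdiv (.load (.reg 5 + 2 * .reg 13 + .reg 40) * .load (.reg 5 + 3 * .reg 13 + .reg 40) +
      .load (.reg 5 + 3 * .reg 13 + .reg 40) * .load (.reg 5 + 2 * .reg 13 + .reg 40)))

/-- Read off the convolution of the real and the imaginary parts from the transform of the square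
of the transform. -/
def roundAll : Cmd :=
  .fill 40 (.reg 5 + 4 * .reg 13) (.reg 12)
    ((.load (.reg 5 + 3 * .reg 13 + (.reg 13 - .reg 40) % .reg 13) + .reg 13 * .reg 14) /
      (2 * .reg 13 * .reg 14))

/-- Replace two adjacent blocks of digits at the address in register `10`, with rows of length `m`,
the register `11`, by their product, with rows of length `2 m`; the register `12` holds the number
of digits of the product. -/
def mulBlocks : Cmd :=
  mapComplex (spreadExpr (.reg 10)) (spreadExpr (.reg 10 + .reg 12 / 2)) ;;
  fft ;;
  squareAll ;;
  fft ;;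
  roundAll ;;
  25 ::= .reg 5 + 4 * .reg 13 ;;
  26 ::= .reg 10 ;;
  27 ::= .reg 12 ;;
  28 ::= .reg 5 + 5 * .reg 13 ;;
  29 ::= .reg 13 ;;
  normalize

/-- The first transform: its input is represented exactly and has norm at most 2. -/
theorem SmallError.first {R : ℕ} (hR : 4 ≤ R) : SmallError R 2 0 ∧
    (R : ℝ) * (0 + (2 + (R : ℝ) ^ 15 * (R * 2 + 1))) ≤ (R : ℝ) ^ 18 := by
  have h4 : (4 : ℝ) ≤ R := by exact_mod_cast hR
  have h0 : (0 : ℝ) ≤ R := by linarith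
  have hP : (1 : ℝ) ≤ (R : ℝ) ^ 15 := one_le_pow₀ (by linarith)
  have key : (R : ℝ) * (0 + (2 + (R : ℝ) ^ 15 * (R * 2 + 1))) ≤ (R : ℝ) ^ 18 := by
    have e : (R : ℝ) ^ 18 = R * (R ^ 15 * (R * R)) := by ring
    rw [e]
    refine mul_le_mul_of_nonneg_left ?_ h0
    generalize (R : ℝ) ^ 15 = P at hP ⊢
    have h3 : R * 2 + 3 ≤ (R : ℝ) * R := by nlinarith
    nlinarith [mul_le_mul_of_nonneg_left h3 (by linarith : 0 ≤ P)]
  refine ⟨⟨by norm_num, le_rfl, ?_, key.trans (pow_le_scale hR (by norm_num))⟩, key⟩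
  have e : (R : ℝ) ^ 4 = R * (R * R * R) := by ring
  rw [e]
  exact mul_le_mul_of_nonneg_left (by nlinarith) h0

/-- The second transform: transformed values are at most 2R, so their squares are at most (2R)^2,
and squaring turns the error e into 2R e + 2 + e (2R + 1). After the second transform the error is
still at most R^22, below the scale R^24. -/
theorem SmallError.second {R : ℕ} (hR : 4 ≤ R) {e : ℝ} (he0 : 0 ≤ e) (he : e ≤ (R : ℝ) ^ 18) :
    SmallError R ((R * 2) ^ 2) (R * 2 * e + 2 + e * (R * 2 + 1)) := by
  have h4 : (4 : ℝ) ≤ R := by exact_mod_cast hR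
  have h0 : (0 : ℝ) ≤ R := by linarith
  refine ⟨by positivity, by positivity, ?_, ?_⟩
  · have e : (R : ℝ) ^ 4 = R * (R ^ 2 * R) := by ring
    rw [e, mul_pow]
    refine mul_le_mul_of_nonneg_left (mul_le_mul_of_nonneg_left ?_ (by positivity)) h0
    linarith
  · refine le_trans ?_ (pow_le_scale hR (k := 22) (by norm_num))
    have e22 : (R : ℝ) ^ 22 = R * (R ^ 15 * (R ^ 3 * (R ^ 3))) := by ring
    rw [e22]
    refine mul_le_mul_of_nonneg_left ?_ h0
    have e18 : (R : ℝ) ^ 18 = R ^ 15 * R ^ 3 := by ring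
    rw [e18] at he
    have hP : (1 : ℝ) ≤ (R : ℝ) ^ 15 := one_le_pow₀ (by linarith)
    have hQR : 16 * (R : ℝ) ≤ (R : ℝ) ^ 3 := by
      have h16 : 16 ≤ (R : ℝ) * R := by nlinarith
      have e3 : (R : ℝ) ^ 3 = R * R * R := by ring
      rw [e3]; exact mul_le_mul_of_nonneg_right h16 h0
    have hQ : (64 : ℝ) ≤ (R : ℝ) ^ 3 := by linarith
    have h1 : e * (4 * R + 1) ≤ (R : ℝ) ^ 15 * R ^ 3 * (4 * R + 1) :=
      mul_le_mul_of_nonneg_right he (by positivity)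
    have e2 : (R : ℝ) * (R * 2) ^ 2 = 4 * R ^ 3 := by ring
    rw [e2]
    generalize (R : ℝ) ^ 15 = P at *
    generalize (R : ℝ) ^ 3 = Q at *
    have h2 : P * Q * (4 * R + 1) + 4 + P * (4 * Q + 1) ≤ P * (Q * Q) := by
      have h3 : Q * (4 * R + 1) + 4 + (4 * Q + 1) ≤ Q * Q := by nlinarith
      have := mul_le_mul_of_nonneg_left h3 (by linarith : 0 ≤ P)
      nlinarith
    linarith

theorem abs_im_sub_le {a b : ℤ} {S : ℤ} {Z : ℂ} {e : ℝ} (h : ‖cx a b - S * Z‖ ≤ e) :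
    |(b : ℝ) - S * Z.im| ≤ e := by
  have := (Complex.abs_im_le_norm _).trans h
  simpa using this

end WordRAM

/-! ### Correctness and cost of the product of two blocks -/

namespace WordRAM

open Complex

/-- The two comparisons are factors 0 or 1. The load is carried out even where they vanish, so its
address must be a word for every i < R, not only for the digits in use. -/
theorem evalZ_spreadExpr {w : ℕ} {t : ZState} {b : Expr} {m N i R : ℕ} {a S lo : ℤ} {M : ℤ → ℤ}
    (hb : b.Ok w t ∧ b.evalZ t = a) (h11 : t.reg 11 = m) (h12 : t.reg 12 = N) (h14 : t.reg 14 = S)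
    (h40 : t.reg 40 = i) (hi : i < R) (hN : N ≤ R) (hm : 1 ≤ m) (hmR : 2 * m ≤ R) (ha : 0 ≤ a)
    (hw : a + 2 * R < 2 ^ w)
    (hM : ∀ x < lo, t.mem x = M x) (hlo : ∀ j < N, j % (2 * m) < m →
      a + (j / (2 * m) * m + j % (2 * m) : ℕ) < lo) :
    (spreadExpr b).Ok w t ∧ (spreadExpr b).evalZ t = S * spread M a m N i := by
  have hdm := Nat.div_add_mod i (2 * m)
  have hle : i / (2 * m) * m + i % (2 * m) ≤ i := by
    have : i / (2 * m) * m ≤ 2 * m * (i / (2 * m)) := by nlinarith [Nat.zero_le (i / (2 * m))]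
    omega
  have hmod := Nat.mod_lt i (show 0 < 2 * m by omega)
  have e1 : InWord w (i : ℤ) := ⟨by positivity, by omega⟩
  have e2 : InWord w (N : ℤ) := ⟨by positivity, by omega⟩
  have e3 : InWord w (2 * m : ℤ) := ⟨by positivity, by omega⟩
  have e4 : InWord w (m : ℤ) := ⟨by positivity, by omega⟩
  have e5 : (i : ℤ) % (2 * m) = (i % (2 * m) : ℕ) := by push_cast; rfl
  have e6 : (i : ℤ) / (2 * m) * m + (i : ℤ) % (2 * m) =
    (i / (2 * m) * m + i % (2 * m) : ℕ) := by push_cast; rfl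
  have e7 : InWord w ((i : ℤ) % (2 * m)) := by rw [e5]; exact ⟨by positivity, by omega⟩
  have e8 : InWord w (a + ((i : ℤ) / (2 * m) * m + (i : ℤ) % (2 * m))) := by
    rw [e6]; exact ⟨by positivity, by omega⟩
  constructor
  · simp [spreadExpr, hb, h11, h12, h40, e1, e2, e3, e4, e7, e8]
  · simp only [spreadExpr, Expr.evalZ_mul, Expr.evalZ_less, Expr.evalZ_load, Expr.evalZ_add,
      Expr.evalZ_mod, Expr.evalZ_div, Expr.evalZ_reg, Expr.evalZ_ofNat, h11, h12, h14, h40, hb.2,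
      e6, spread]
    by_cases h1 : i < N
    · by_cases h2 : i % (2 * m) < m
      · rw [if_pos (by exact_mod_cast h1), if_pos (by rw [e5]; exact_mod_cast h2),
          if_pos ⟨h1, h2⟩, hM _ (hlo i h1 h2)]
        ring
      · rw [if_neg (c := (i : ℤ) % (2 * m) < m) (by rw [e5]; exact_mod_cast h2),
          if_neg (c := i < N ∧ i % (2 * m) < m) (fun hh => h2 hh.2)]
        ring
    · rw [if_neg (c := (i : ℤ) < N) (by exact_mod_cast h1),
        if_neg (c := i < N ∧ i % (2 * m) < m) (fun hh => h1 hh.1)]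
      ring

theorem row_index_lt {m U j : ℕ} (hj : j < U * (2 * m)) (hjm : j % (2 * m) < m) :
    j / (2 * m) < U ∧ j / (2 * m) * m + j % (2 * m) < U * m := by
  have h1 : j / (2 * m) < U := Nat.div_lt_of_lt_mul (by rwa [mul_comm])
  refine ⟨h1, ?_⟩
  calc j / (2 * m) * m + j % (2 * m) < (j / (2 * m) + 1) * m := by rw [add_mul]; omega
    _ ≤ U * m := Nat.mul_le_mul_right _ h1

theorem spread_nonneg_le {M : ℤ → ℤ} {a : ℤ} {m U : ℕ} {f : ℕ → ℕ}
    (hM : ∀ x < U, ∀ c < m, M (a + (x * m + c : ℕ)) = ((f x).testBit c).toNat) (i : ℕ) :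
    0 ≤ spread M a m (U * (2 * m)) i ∧ spread M a m (U * (2 * m)) i ≤ 1 := by
  rw [spread]
  split_ifs with h
  · rw [hM _ (row_index_lt h.1 h.2).1 _ h.2]
    cases (f (i / (2 * m))).testBit (i % (2 * m)) <;> simp
  · simp

/-- Bounds for the rounding: its dividend is at most S + 2R²S + RS, its divisor is 2RS, and both
must be words. -/
theorem mul_sq_scale_le {R : ℕ} (hR : 4 ≤ R) :
    scale R * (2 * R * R + R + 1) ≤ 2 * scale R ^ 3 ∧ 2 * R * scale R ≤ 2 * scale R ^ 3 := by
  have hS := scale_pos hR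
  have h1 : (R : ℤ) ≤ scale R := le_self_pow₀ (by omega) (by norm_num)
  have h4 : (4 : ℤ) ≤ R := by exact_mod_cast hR
  have h2 : (R : ℤ) * R ≤ scale R * scale R := mul_le_mul h1 h1 (by omega) hS.le
  have h3 : (R : ℤ) ^ 3 ≤ scale R := pow_le_pow_right₀ (by omega) (by norm_num)
  have h5 : 4 * ((R : ℤ) * R) ≤ R ^ 3 := by nlinarith
  have h6 : scale R * 1 ≤ scale R * scale R := mul_le_mul_of_nonneg_left (by omega) hS.le
  generalize scale R = S at *
  constructor
  · have : 2 * (R : ℤ) * R + R + 1 ≤ 2 * (S * S) := by nlinarith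
    nlinarith [mul_le_mul_of_nonneg_left this hS.le]
  · nlinarith [mul_le_mul_of_nonneg_left (h1.trans (by omega : S ≤ S * S)) hS.le]

theorem runs_squareAll {w R : ℕ} {E : ℤ} {s : ZState} (hf : Fits w E R) (hp : HasParams E R s)
    {Z : ℕ → ℂ} {e A : ℝ} (hx : HoldsApprox s.mem (E + 2 * R) R Z e) (hA : ∀ i, ‖Z i‖ ≤ A)
    (hAR : A ≤ (R : ℝ) ^ 4) (heS : e ≤ scale R) :
    Runs w squareAll s (R * 176 + 30) fun s' => (∀ r, r ≠ 40 → s'.reg r = s.reg r) ∧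
      (∀ a < E + 2 * R, s'.mem a = s.mem a) ∧
      HoldsApprox s'.mem (E + 2 * R) R (fun k => Z k ^ 2) (A * e + 2 + e * (A + 1)) := by
  have hR4 := hf.four_le
  have hE := hf.nonneg
  have hlt := hf.lt
  have hSp := scale_pos hR4
  obtain ⟨re, im, h1, h2⟩ := hx
  refine Runs.mono (runs_mapComplex hf hp
    (re' := fun i => (re i * re i - im i * im i) / scale R)
    (im' := fun i => (re i * im i + im i * re i) / scale R) ?_) (by simp) fun s' h => ?_
  · intro i hi M hM
    have m1 : M (E + 2 * R + i) = re i := by rw [hM _ (by omega), (h2 i hi).1]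
    have m2 : M (E + 3 * R + i) = im i := by
      rw [hM _ (by omega), ← (h2 i hi).2]; congr 1; ring
    have w1 : InWord w (E + 2 * R + i) := ⟨by omega, by omega⟩
    have w2 : InWord w (E + 3 * R + i) := ⟨by omega, by omega⟩
    obtain ⟨b1, b2⟩ := abs_mul_le_scale hR4 (h1 i hi) (hA i) heS (h1 i hi) (hA i) heS hAR
    have r14 : (⟨(s.set 40 i).reg, M⟩ : ZState).reg 14 = scale R := by simp [hp.r14]
    have r15 : (⟨(s.set 40 i).reg, M⟩ : ZState).reg 15 = scale R ^ 2 := by simp [hp.r15]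
    refine ⟨⟨ok_rdiv hSp r14 r15 hf.scale_lt ?_ ?_, ?_⟩, ok_rdiv hSp r14 r15 hf.scale_lt ?_ ?_, ?_⟩
    · simp [hp.r5, hp.r13, w1, w2]
    · simpa [hp.r5, hp.r13, m1, m2] using b1
    · rw [evalZ_rdiv hSp r14 r15]; simp [hp.r5, hp.r13, m1, m2]
    · simp [hp.r5, hp.r13, w1, w2]
    · simpa [hp.r5, hp.r13, m1, m2] using b2
    · rw [evalZ_rdiv hSp r14 r15]; simp [hp.r5, hp.r13, m1, m2]
  · refine ⟨h.1, h.2.1, _, _, fun i hi => ?_, h.2.2⟩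
    simp only [sq]
    exact norm_round_mul_sub_le hSp (hA i) (h1 i hi) (h1 i hi) (hA i) heS

theorem runs_roundAll {w R N : ℕ} {E : ℤ} {s : ZState} (hf : Fits w E R) (hp : HasParams E R s)
    (h12 : s.reg 12 = N) (hN : 2 * N ≤ R) {α β : ℕ → ℤ} {z : ℕ → ℂ}
    (hz : ∀ i, z i = α i + β i * I) (hz0 : ∀ i, N ≤ i → z i = 0)
    (hx : HoldsApprox s.mem (E + 2 * R) R (dft R fun k => dft R z k ^ 2) (scale R))
    (hc : ∀ j < N, 0 ≤ ∑ k ∈ Finset.range (j + 1), α k * β (j - k) ∧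
      ∑ k ∈ Finset.range (j + 1), α k * β (j - k) ≤ R) :
    Runs w roundAll s (R * 35 + 10) fun s' => (∀ r, r ≠ 40 → s'.reg r = s.reg r) ∧
      (∀ a < E + 2 * R, s'.mem a = s.mem a) ∧
      ∀ j < N, s'.mem (E + 4 * R + (j : ℕ)) = ∑ k ∈ Finset.range (j + 1), α k * β (j - k) := by
  have hR4 := hf.four_le
  have hE := hf.nonneg
  have hlt := hf.lt
  have hSp := scale_pos hR4
  obtain ⟨re, im, h1, h2⟩ := hx
  refine Runs.mono (Runs.fill hf.pos N (E + 4 * R)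
    (fun j => ∑ k ∈ Finset.range (j + 1), α k * β (j - k))
    (Q := fun s' => (∀ r, r ≠ 40 → s'.reg r = s.reg r) ∧ (∀ a < E + 2 * R, s'.mem a = s.mem a) ∧
      ∀ j < N, s'.mem (E + 4 * R + (j : ℕ)) = ∑ k ∈ Finset.range (j + 1), α k * β (j - k))
    (by simp) (by simp) (by simp [hp.r5, hp.r13]) (by simp [h12]) (by omega) (by omega) ?_ ?_)
    (by simp; omega) fun s' h => h
  · intro j hj M hM hM'
    have hjR : (R - j) % R < R := Nat.mod_lt _ (by omega)
    have em : (((R : ℤ) - j) % R) = ((R - j) % R : ℕ) := by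
      push_cast [show j ≤ R by omega]; rfl
    set i := (R - j) % R with hi
    have m2 : M (E + 3 * R + i) = im i := by
      rw [hM' _ (by omega), ← (h2 i hjR).2]; congr 1; ring
    have w1 : InWord w (E + 3 * R + i) := ⟨by omega, by omega⟩
    have hb := abs_im_sub_le (h1 i hjR)
    have him : ∀ (x : ℕ) (y : ℂ), ((x : ℂ) * y).im = x * y.im := fun x y => by simp
    -- The hypothesis becomes |im i - S R (2 c)| ≤ S for the j-th convolution entry c, which is the
    -- situation of `round_eq`.
    rw [dft_sq_dft hN z hz0 hj, him, im_sum_mul z hz] at hb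
    obtain ⟨c0, cR⟩ := hc j hj
    obtain ⟨v0, v1⟩ := round_eq hSp (by omega) hb
    have hb' : im i ≤ scale R + scale R * (R * (2 *
        ∑ k ∈ Finset.range (j + 1), α k * β (j - k))) := by
      have := (abs_le.1 hb).2
      have : (im i : ℝ) ≤ scale R + scale R * (R * (2 *
        ((∑ k ∈ Finset.range (j + 1), α k * β (j - k) : ℤ) : ℝ))) := by linarith only [this]
      exact_mod_cast this
    generalize ∑ k ∈ Finset.range (j + 1), α k * β (j - k) = c at *
    obtain ⟨s1, s2⟩ := mul_sq_scale_le hR4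
    have hsl := hf.scale_lt
    have w2 : InWord w (2 * R * scale R) := ⟨by positivity, by linarith only [s2, hsl]⟩
    have w3 : InWord w (im i + R * scale R) := by
      constructor
      · have : 0 ≤ 2 * R * scale R * c := by positivity
        linarith only [v0, this]
      · have : scale R * (R * (2 * c)) ≤ scale R * (R * (2 * R)) := by gcongr
        linarith only [hb', this, s1, hsl]
    have w4 : InWord w ((R : ℤ) - j) := ⟨by omega, by omega⟩
    have w5 : InWord w (R : ℤ) := ⟨by omega, by omega⟩
    constructor
    · simp [hp.r5, hp.r13, hp.r14, em, m2, w1, w2, w3, w4, w5]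
    · simp [hp.r5, hp.r13, hp.r14, em, m2, v1]
  · intro M hM hM'
    exact ⟨fun r hr => by simp [hr], fun a ha => hM' a (by omega), hM⟩

theorem runs_mulBlocks {w ρ R m U : ℕ} {E a : ℤ} {s : ZState} (hRρ : R = 2 ^ ρ) (hf : Fits w E R)
    (hp : HasParams E R s) (hw : HoldsRoots s.mem E R) (h10 : s.reg 10 = a) (h11 : s.reg 11 = m)
    (h12 : s.reg 12 = (U * (2 * m) : ℕ)) (hm : 1 ≤ m) (hU : 1 ≤ U) (hNR : 2 * (U * (2 * m)) ≤ R)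
    (ha : 0 ≤ a) (haE : a + (U * (2 * m) : ℕ) ≤ E) {f g h : ℕ → ℕ}
    (hfb : ∀ x < U, f x < 2 ^ m) (hgb : ∀ x < U, g x < 2 ^ m) (hhb : ∀ x < U, h x < 2 ^ (2 * m))
    (hM : ∀ x < U, ∀ c < m, s.mem (a + (x * m + c : ℕ)) = ((f x).testBit c).toNat)
    (hM' : ∀ x < U, ∀ c < m, s.mem (a + (U * m : ℕ) + (x * m + c : ℕ)) = ((g x).testBit c).toNat)
    (hh : ∀ x, h x = ∑ k ∈ Finset.range (x + 1), f k * g (x - k)) :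
    Runs w mulBlocks s (1000 * (ρ * R)) fun s' => (∀ r < 20, s'.reg r = s.reg r) ∧
      (∀ x < E + 2 * R, (x < a ∨ a + (U * (2 * m) : ℕ) ≤ x) → s'.mem x = s.mem x) ∧
      ∀ x < U, ∀ c < 2 * m, s'.mem (a + (x * (2 * m) + c : ℕ)) = ((h x).testBit c).toNat := by
  have hR4 := hf.four_le
  have hE := hf.nonneg
  have hlt := hf.lt
  have hSp := scale_pos hR4
  set N := U * (2 * m) with hN
  have hNm : U * m * 2 = N := by rw [hN]; ring
  have hmN : 2 * m ≤ N := by rw [hN]; nlinarith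
  set α := spread s.mem a m N with hα
  set β := spread s.mem (a + (U * m : ℕ)) m N with hβ
  have hα1 : ∀ i, 0 ≤ α i ∧ α i ≤ 1 := spread_nonneg_le hM
  have hβ1 : ∀ i, 0 ≤ β i ∧ β i ≤ 1 := spread_nonneg_le hM'
  -- Both factors are packed into a single complex sequence, so two transforms suffice for the
  -- convolution.
  set z : ℕ → ℂ := fun i => α i + β i * I with hz
  have hz2 : ∀ i, ‖z i‖ ≤ 2 := by
    intro i
    have e1 : |(α i : ℝ)| ≤ 1 := by
      have : (0 : ℝ) ≤ α i ∧ (α i : ℝ) ≤ 1 := by exact_mod_cast hα1 i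
      rw [abs_le]; constructor <;> linarith
    have e2 : |(β i : ℝ)| ≤ 1 := by
      have : (0 : ℝ) ≤ β i ∧ (β i : ℝ) ≤ 1 := by exact_mod_cast hβ1 i
      rw [abs_le]; constructor <;> linarith
    refine (norm_add_le _ _).trans ?_
    rw [norm_mul, norm_I, mul_one, Complex.norm_intCast, Complex.norm_intCast]
    linarith
  have hz0 : ∀ i, N ≤ i → z i = 0 := by
    intro i hi
    simp [hz, hα, hβ, spread, show ¬ i < N by omega]
  have hdft : ∀ k, ‖dft R z k‖ ≤ R * 2 := fun k => norm_partialDFT_le z _ _ hz2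
  have hdft2 : ∀ k, ‖dft R z k ^ 2‖ ≤ (R * 2) ^ 2 := fun k => by
    rw [norm_pow]; exact pow_le_pow_left₀ (norm_nonneg _) (hdft k) 2
  obtain ⟨herr1, hle1⟩ := SmallError.first hR4
  set e₁ : ℝ := R * (0 + (2 + (R : ℝ) ^ 15 * (R * 2 + 1))) with he₁
  have he₁0 : 0 ≤ e₁ := by positivity
  have herr2 := SmallError.second hR4 he₁0 hle1
  have he₁S : e₁ ≤ scale R := hle1.trans (pow_le_scale hR4 (by norm_num))
  set cv : ℕ → ℤ := fun j => ∑ k ∈ Finset.range (j + 1), α k * β (j - k) with hcv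
  -- The digits are 0 or 1, so an entry of the convolution is at most j + 1 ≤ N ≤ R. This is the
  -- digit bound used for the carries.
  have hcv0 : ∀ j < N, 0 ≤ cv j ∧ cv j ≤ R := by
    intro j hj
    constructor
    · exact Finset.sum_nonneg fun k _ => mul_nonneg (hα1 k).1 (hβ1 _).1
    · have : cv j ≤ ∑ k ∈ Finset.range (j + 1), 1 := by
        refine Finset.sum_le_sum fun k _ => ?_
        have h1 := hα1 k
        have h2 := hβ1 (j - k)
        nlinarith
      simp at this
      omega
  -- Only the residue modulo 2^N is available and needed: the coefficients cut off by the truncation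
  -- belong to multiples of (2^(2m))^U = 2^N.
  have hmod := sum_conv_spread hfb hgb hM hM' hh
  rw [← hN, ← hα, ← hβ] at hmod
  have hscale := hf.scale_lt
  have hle2 : (R : ℝ) * (R * 2 * e₁ + 2 + e₁ * (R * 2 + 1) +
      (2 + (R : ℝ) ^ 15 * (R * (R * 2) ^ 2 + 1))) ≤ scale R := herr2.le_scale
  have hAR : (R : ℝ) * 2 ≤ (R : ℝ) ^ 4 := herr1.le_pow
  refine Runs.mono (Runs.seq (runs_mapComplex hf hp (re' := fun i => scale R * α i)
      (im' := fun i => scale R * β i) ?_) fun s₁ h₁ =>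
    Runs.seq (P := fun s' => (∀ r < 20, s'.reg r = s.reg r) ∧
        (∀ a < E + 2 * R, s'.mem a = s.mem a) ∧
        HoldsApprox s'.mem (E + 2 * R) R (dft R z) e₁)
      (Runs.mono (runs_fft hRρ hf (hp.of_frame fun r hr => h₁.1 r (by omega))
        (hw.congr fun a _ h => h₁.2.1 a (by omega)) (z := z) (e := 0) (A := 2) ?_ hz2 herr1) le_rfl
        fun s' h => ⟨fun r hr => ?_, fun a ha => ?_, h.2⟩)
      fun s₂ h₂ =>
    Runs.seq (P := fun s' => (∀ r < 20, s'.reg r = s.reg r) ∧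
        (∀ a < E + 2 * R, s'.mem a = s.mem a) ∧
        HoldsApprox s'.mem (E + 2 * R) R (fun k => dft R z k ^ 2)
          (R * 2 * e₁ + 2 + e₁ * (R * 2 + 1)))
      (Runs.mono (runs_squareAll hf (hp.of_frame h₂.1) h₂.2.2 hdft hAR he₁S) le_rfl
        fun s' h => ⟨fun r hr => ?_, fun a ha => ?_, h.2.2⟩) fun s₃ h₃ =>
    Runs.seq (P := fun s' => (∀ r < 20, s'.reg r = s.reg r) ∧
        (∀ a < E + 2 * R, s'.mem a = s.mem a) ∧
        HoldsApprox s'.mem (E + 2 * R) R (dft R fun k => dft R z k ^ 2) (scale R))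
      (Runs.mono (runs_fft hRρ hf (hp.of_frame h₃.1)
        (hw.congr fun a _ h => h₃.2.1 a (by omega)) h₃.2.2 hdft2 herr2) le_rfl
        fun s' h => ⟨fun r hr => ?_, fun a ha => ?_, ?_⟩)
      fun s₄ h₄ =>
    Runs.seq (P := fun s' => (∀ r < 20, s'.reg r = s.reg r) ∧
        (∀ a < E + 2 * R, s'.mem a = s.mem a) ∧
        ∀ j < N, s'.mem (E + 4 * R + (j : ℕ)) = cv j)
      (Runs.mono (runs_roundAll hf (hp.of_frame h₄.1) ((h₄.1 12 (by norm_num)).trans h12) hNR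
        (fun i => rfl) hz0 h₄.2.2 hcv0) le_rfl
        fun s' h => ⟨fun r hr => ?_, fun a ha => ?_, h.2.2⟩) fun s₅ h₅ =>
    Runs.assign_seq (by simp) <| Runs.assign_seq (by simp) <| Runs.assign_seq (by simp) <|
    Runs.assign_seq (by simp) <| Runs.assign_seq (by simp) <|
    Runs.mono (runs_normalize (zb := E + 4 * R) (ob := a) (cb := E + 5 * R) (B := R) hf.pos N cv
      ?_ ?_ ?_ ?_ ?_ ?_ ?_ ?_ ?_ ?_ ?_ ?_ ?_ ?_ ?_ ?_ ?_ ?_) le_rfl ?_)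
    ?_ fun s' h => h
  · intro i hi M' hM''
    have base : ∀ j < N, j % (2 * m) < m → a + (U * m : ℕ) +
        (j / (2 * m) * m + j % (2 * m) : ℕ) < E := by
      intro j hj hjm
      have := (row_index_lt (hN ▸ hj) hjm).2
      omega
    constructor
    · exact evalZ_spreadExpr (lo := E) ⟨by simp, by simp [h10]⟩ (by simp [h11]) (by simp [h12])
        (by simp [hp.r14]) (by simp) hi (by omega) hm (by omega) ha (by omega)
        (fun x hx => hM'' x (by omega)) (fun j hj hjm => by have := base j hj hjm; omega)
    · refine evalZ_spreadExpr (lo := E) ⟨?_, ?_⟩ (by simp [h11]) (by simp [h12])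
        (by simp [hp.r14]) (by simp) hi (by omega) hm (by omega) (by omega) (by omega)
        (fun x hx => hM'' x (by omega)) base
      · simp [h12, InWord]; omega
      · simp [h10, h12]; omega
  · refine ⟨_, _, fun i hi => ?_, h₁.2.2⟩
    have : cx (scale R * α i) (scale R * β i) - scale R * z i = 0 := by
      simp only [cx, hz]; push_cast; ring
    rw [this, norm_zero]
  · rw [h.1.1 r hr, h₁.1 r (by omega)]
  · rw [h.1.2 a ha, h₁.2.1 a ha]
  · rw [h.1 r (by omega), h₂.1 r hr]
  · rw [h.2.1 a ha, h₂.2.1 a ha]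
  · rw [h.1.1 r hr, h₃.1 r hr]
  · rw [h.1.2 a ha, h₃.2.1 a ha]
  · obtain ⟨re, im, g1, g2⟩ := h.2
    exact ⟨re, im, fun i hi => (g1 i hi).trans hle2, g2⟩
  · rw [h.1 r (by omega), h₄.1 r hr]
  · rw [h.2.1 a ha, h₄.2.1 a ha]
  · simp [h₅.1, hp.r5, hp.r13]
  · simp [h₅.1, h10]
  · simp [h₅.1, h12]
  · simp [h₅.1, hp.r5, hp.r13]
  · simp [h₅.1, hp.r13]
  · intro i hi
    simpa using h₅.2.2 i hi
  · intro i hi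
    obtain ⟨c0, c1⟩ := hcv0 i hi
    rw [abs_of_nonneg c0]; exact c1
  · omega
  · omega
  · omega
  · omega
  · omega
  · omega
  · omega
  · omega
  · omega
  · omega
  · omega
  · rintro s' ⟨g1, g2, g3⟩
    refine ⟨fun r hr => ?_, fun x hx hxa => ?_, fun x hx c hc => ?_⟩
    · rw [g1 r (by omega)]
      simp [show r ≠ 25 by omega, show r ≠ 26 by omega, show r ≠ 27 by omega,
        show r ≠ 28 by omega, show r ≠ 29 by omega, h₅.1 r hr]
    · rw [g2 x (by omega) (by omega)]
      simp [h₅.2.1 x hx]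
    · have hlt' : x * (2 * m) + c < N := by
        calc x * (2 * m) + c < (x + 1) * (2 * m) := by rw [add_mul]; omega
          _ ≤ N := Nat.mul_le_mul_right _ hx
      rw [g3 _ hlt', ediv_emod_two_of_modEq hmod hlt', testBit_sum_mul_pow hhb hx hc]
  -- The two transforms contribute 560 ρ R; the linear terms are absorbed using ρ ≥ 2, which R ≥ 4
  -- forces.
  · have hρ : 2 ≤ ρ := by
      by_contra hρ
      have : 2 ^ ρ ≤ 2 ^ 1 := Nat.pow_le_pow_right (by norm_num) (by omega)
      omega
    have h1 : 2 * R ≤ ρ * R := Nat.mul_le_mul_right _ hρ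
    have h2 : ρ * 4 ≤ ρ * R := Nat.mul_le_mul_left _ hR4
    have h3 : ρ * (280 * R + 70) = 280 * (ρ * R) + 70 * ρ := by ring
    simp [spreadExpr, h3]
    omega

end WordRAM

namespace WordRAM

open Complex

/-! ### Preparations for a level of products -/

/-- Set the register `i` to `b` and double it until it is at least `lim`; the register `41` counts
the steps. -/
def doubleUpTo (i : ℕ) (b lim : Expr) : Cmd :=
  i ::= b ;; 41 ::= 0 ;;
  .loop (.less (.reg i) lim) (i ::= 2 * .reg i ;; 41 ::= .reg 41 + 1)

theorem exists_double {b : ℕ} (hb : 0 < b) (n : ℕ) :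
    ∃ r, n ≤ b * 2 ^ r ∧ ∀ i < r, b * 2 ^ i < n := by
  classical
  have h : ∃ r, n ≤ b * 2 ^ r :=
    ⟨n, (Nat.lt_two_pow_self).le.trans (Nat.le_mul_of_pos_left _ hb)⟩
  exact ⟨Nat.find h, Nat.find_spec h, fun i hi => not_le.1 (Nat.find_min h hi)⟩

theorem runs_doubleUpTo {w : ℕ} {s : ZState} (hw : 0 < w) {i : ℕ} (hi : i ≠ 41) {e lim : Expr}
    {b n r : ℕ} (h1 : n ≤ b * 2 ^ r) (h2 : ∀ i < r, b * 2 ^ i < n)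
    (he : e.Ok w s ∧ e.evalZ s = b) (hl : lim.Ok w s ∧ lim.evalZ s = n) (hli : lim.Indep i)
    (hlj : lim.Indep 41) (hn : n < 2 ^ w) (hb : b * 2 ^ r < 2 ^ w) :
    Runs w (doubleUpTo i e lim) s (r * (lim.cost + 20) + lim.cost + e.cost + 20) fun s' =>
      (∀ k, k ≠ i → k ≠ 41 → s'.reg k = s.reg k) ∧ s'.mem = s.mem ∧
      s'.reg i = (b * 2 ^ r : ℕ) ∧ s'.reg 41 = r := by
  have hword : ∀ k ≤ r, InWord w (b * 2 ^ k : ℕ) := fun k hk => ⟨by positivity, by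
    have : b * 2 ^ k ≤ b * 2 ^ r := Nat.mul_le_mul_left _ (Nat.pow_le_pow_right (by norm_num) hk)
    exact_mod_cast this.trans_lt hb⟩
  have hlim : ∀ s' : ZState, (∀ k, k ≠ i → k ≠ 41 → s'.reg k = s.reg k) →
      lim.Ok w s' ∧ lim.evalZ s' = n := by
    intro s' hs
    have e1 : ∀ k ≠ i, s'.reg k = (s.set 41 (s'.reg 41)).reg k := fun k hk => by
      by_cases h : k = 41
      · simp [h]
      · simp [h, hs k hk h]
    have e2 : ∀ k ≠ 41, (s.set 41 (s'.reg 41)).reg k = s.reg k := fun k hk => by simp [hk]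
    rw [hli.ok_iff e1, hlj.ok_iff e2, hli.evalZ_eq e1, hlj.evalZ_eq e2]
    exact hl
  refine Runs.mono (Runs.assign_seq he.1 <| Runs.assign_seq (by simp) <|
    Runs.loop hw r (fun _ => 8) (fun k s' => (∀ k, k ≠ i → k ≠ 41 → s'.reg k = s.reg k) ∧
      s'.mem = s.mem ∧ s'.reg i = (b * 2 ^ k : ℕ) ∧ s'.reg 41 = k) ?_ ?_ ?_ ?_ ?_) ?_ fun s' h => h
  · refine ⟨fun k h1 h2 => by simp [h1, h2], rfl, by simp [hi, he.2], by simp⟩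
  · intro k hk s' h
    have := hlim s' h.1
    rw [Expr.ok_less, this.2, Expr.evalZ_reg, h.2.2.1]
    exact ⟨trivial, this.1, hword k hk, by positivity, by exact_mod_cast hn⟩
  · intro k hk s' h
    rw [(hlim s' h.1).2, Expr.evalZ_reg, h.2.2.1]
    exact_mod_cast h2 k hk
  · intro s' h
    refine ⟨?_, h⟩
    rw [(hlim s' h.1).2, Expr.evalZ_reg, h.2.2.1]
    exact_mod_cast h1
  · rintro k hk s' ⟨g1, g2, g3, g4⟩
    refine Runs.mono (Runs.assign_seq (by simp) <| Runs.assign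
      (Q := fun s' => (∀ k, k ≠ i → k ≠ 41 → s'.reg k = s.reg k) ∧
      s'.mem = s.mem ∧ s'.reg i = (b * 2 ^ (k + 1) : ℕ) ∧ s'.reg 41 = (k + 1 : ℕ)) (by simp) ?_)
      (by simp) fun s' h => h
    refine ⟨fun k h1 h2 => by simp [h1, h2, g1 k h1 h2], g2, ?_, ?_⟩
    · simp [hi, g3]; ring
    · simp [hi.symm, g4]
  · simp; ring_nf; omega

/-- It pays for the quadratic number of steps in log R that the cosine takes, within a time linear
in R. -/
theorem sq_le_two_mul_two_pow (n : ℕ) : n ^ 2 ≤ 2 * 2 ^ n := by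
  rcases lt_or_ge n 3 with h | h
  · interval_cases n <;> norm_num
  · induction n, h using Nat.le_induction with
    | base => norm_num
    | succ n hn ih => rw [pow_succ 2 n]; nlinarith

/-- Choose the length of the transforms and compute the roots of unity. -/
def prepare : Cmd :=
  doubleUpTo 13 4 (2 * .reg 12) ;; setScale ;; rootCos ;; fillRoots

/-- The length R is the least 4 · 2^r that is at least 2N, so it is at most 4N. Thus the preparation
costs O(N) and can be repeated at every level of the tree. -/
theorem runs_prepare {w N : ℕ} {E : ℤ} {s : ZState} (h5 : s.reg 5 = E) (h12 : s.reg 12 = N)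
    (hN : 1 ≤ N) (hw : ((4 * N : ℕ) : ℤ) ^ 80 < 2 ^ w) (hE : 0 ≤ E) (hEw : E + 8 * (4 * N : ℕ) < 2 ^ w) :
    Runs w prepare s (10000 * N) fun s' => (∀ r < 13, s'.reg r = s.reg r) ∧
      (∀ a < E, s'.mem a = s.mem a) ∧ ∃ ρ R, R = 2 ^ ρ ∧ 2 * N ≤ R ∧ R ≤ 4 * N ∧ Fits w E R ∧
        HasParams E R s' ∧ HoldsRoots s'.mem E R := by
  obtain ⟨r, h1, h2⟩ := exists_double (show 0 < 4 by norm_num) (2 * N)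
  obtain ⟨R, hR⟩ : ∃ R, R = 2 ^ (r + 2) := ⟨_, rfl⟩
  have hR' : 4 * 2 ^ r = R := by rw [hR]; ring
  have hR4 : 4 ≤ R := by rw [← hR']; have := Nat.one_le_two_pow (n := r); omega
  have hRN : R ≤ 4 * N := by
    rcases r with _ | r
    · omega
    · have := h2 r (by omega)
      rw [pow_succ] at hR'; omega
  have hf : Fits w E R := by
    refine ⟨hR4, lt_of_le_of_lt ?_ hw, hE, ?_⟩
    · exact pow_le_pow_left₀ (by positivity) (by exact_mod_cast hRN) 80
    · push_cast at hEw; omega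
  have h4w : 4 * N < 2 ^ w := by
    have : ((4 * N : ℕ) : ℤ) < 2 ^ w := by push_cast at hEw ⊢; linarith only [hEw, hE]
    exact_mod_cast this
  refine Runs.mono (Runs.seq (runs_doubleUpTo hf.pos (by norm_num) h1 h2 (by simp)
      (by simp [h12]) (by simp) (by simp) (by omega) (by omega)) fun s₁ h₁ =>
    Runs.seq (runs_setScale (R := R) (by rw [h₁.2.2.1, hR'])) fun s₂ h₂ =>
    Runs.seq (runs_rootCos hR (by rw [h₂.2.1 _ (by norm_num) (by norm_num), h₁.2.2.1, hR'])
      h₂.2.2.1 hf.pow_lt) fun s₃ h₃ =>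
    Runs.mono (runs_fillRoots hR hf ⟨?_, ?_, ?_, ?_⟩ h₃.2.2.1 h₃.2.2.2.1 h₃.2.2.2.2) le_rfl
      fun s' h => ⟨fun k hk => ?_, fun a ha => ?_, r + 2, R, hR, by omega, hRN, hf,
        ⟨?_, ?_, ?_, ?_⟩, h.2⟩) ?_ fun s' h => h
  · rw [h₃.2.1 _ (by norm_num), h₂.2.1 _ (by norm_num) (by norm_num),
      h₁.1 _ (by norm_num) (by norm_num), h5]
  · rw [h₃.2.1 _ (by norm_num), h₂.2.1 _ (by norm_num) (by norm_num), h₁.2.2.1, hR']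
  · rw [h₃.2.1 _ (by norm_num), h₂.2.2.1]
  · rw [h₃.2.1 _ (by norm_num), h₂.2.2.2]
  · have e1 := sq_le_two_mul_two_pow (r + 2)
    have e2 : r < 2 ^ r := Nat.lt_two_pow_self
    have e3 : r * (576 * (r + 2) + 60) ≤ 576 * (r + 2) ^ 2 + 60 * r := by ring_nf; omega
    rw [← hR] at e1
    simp only [Expr.cost_mul, Expr.cost_ofNat, Expr.cost_reg]
    omega
  · rw [h.1.1 _ (by omega), h₃.2.1 _ (by omega), h₂.2.1 _ (by omega) (by omega),
      h₁.1 _ (by omega) (by omega)]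
  · rw [h.1.2 a ha, h₃.1, h₂.1, h₁.2.1]
  · rw [h.1.1 _ (by norm_num), h₃.2.1 _ (by norm_num), h₂.2.1 _ (by norm_num) (by norm_num),
      h₁.1 _ (by norm_num) (by norm_num), h5]
  · rw [h.1.1 _ (by norm_num), h₃.2.1 _ (by norm_num), h₂.2.1 _ (by norm_num) (by norm_num),
      h₁.2.2.1, hR']
  · rw [h.1.1 _ (by norm_num), h₃.2.1 _ (by norm_num), h₂.2.2.1]
  · rw [h.1.1 _ (by norm_num), h₃.2.1 _ (by norm_num), h₂.2.2.2]

end WordRAM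

namespace WordRAM

open Polynomial

/-! ### The product tree -/

/-- The product of the `b`-th block of `m` factors. -/
noncomputable def block (φ : ℕ → ℕ[X]) (m b : ℕ) : ℕ[X] := ∏ i ∈ Finset.range m, φ (b * m + i)

theorem block_mul_block (φ : ℕ → ℕ[X]) (m b : ℕ) :
    block φ m (2 * b) * block φ m (2 * b + 1) = block φ (2 * m) b := by
  rw [block, block, block, two_mul m, Finset.prod_range_add]
  congr 1
  · refine Finset.prod_congr rfl fun i _ => by congr 1; ring
  · refine Finset.prod_congr rfl fun i _ => by congr 1; ring

theorem coeff_block_two_mul (φ : ℕ → ℕ[X]) (m b x : ℕ) : (block φ (2 * m) b).coeff x =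
    ∑ k ∈ Finset.range (x + 1), (block φ m (2 * b)).coeff k *
      (block φ m (2 * b + 1)).coeff (x - k) := by
  rw [← block_mul_block, coeff_mul, Finset.Nat.sum_antidiagonal_eq_sum_range_succ_mk]

/-- The factors have constant coefficient `1` and at most one further term. -/
def IsFactor (f : ℕ[X]) : Prop := f.coeff 0 = 1 ∧ f.eval 1 ≤ 2

/-- The coefficients of a block sum to its value at 1, at most 2^m. The constant coefficient takes 1
of this, so any other one is at most 2^m - 1; the constant one itself is below 2^m because m ≥ 1.
Hence m bits suffice. -/
theorem coeff_block_lt {φ : ℕ → ℕ[X]} (hφ : ∀ i, IsFactor (φ i)) {m : ℕ} (hm : 1 ≤ m) (b x : ℕ) :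
    (block φ m b).coeff x < 2 ^ m := by
  have h0 : (block φ m b).coeff 0 = 1 := by
    rw [block, coeff_zero_prod]
    exact Finset.prod_eq_one fun i _ => (hφ _).1
  have h1 : (block φ m b).eval 1 ≤ 2 ^ m := by
    rw [block, eval_prod]
    calc _ ≤ ∏ _i ∈ Finset.range m, 2 := Finset.prod_le_prod' fun i _ => (hφ _).2
      _ = 2 ^ m := by simp
  have h2 : 1 < 2 ^ m := Nat.one_lt_two_pow (by omega)
  rcases Nat.eq_zero_or_pos x with rfl | hx
  · omega
  · refine lt_of_lt_of_le ?_ h1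
    rw [eval_eq_sum_range' (n := max (block φ m b).natDegree x + 1) (by omega)]
    simp only [one_pow, mul_one]
    have := Finset.sum_le_sum_of_subset (f := (block φ m b).coeff)
      (s := {0, x}) (t := Finset.range (max (block φ m b).natDegree x + 1)) (by
        intro y; simp; omega)
    rw [Finset.sum_pair (by omega)] at this
    omega

/-- The memory holds the blocks `b₀, …, b₁ - 1` of `m` factors, from the address `D` on. -/
def HoldsBlocks (M : ℤ → ℤ) (D : ℤ) (U : ℕ) (φ : ℕ → ℕ[X]) (m b₀ b₁ : ℕ) : Prop :=
  ∀ b, b₀ ≤ b → b < b₁ → ∀ x < U, ∀ c < m,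
    M (D + (b * (U * m) : ℕ) + (x * m + c : ℕ)) = (((block φ m b).coeff x).testBit c).toNat

/-- Multiply the adjacent blocks. -/
def mulPairs : Cmd :=
  .forLoop 7 (.reg 3 / (2 * .reg 6)) (10 ::= .reg 2 + .reg 7 * .reg 12 ;; mulBlocks)

theorem row_lt {x U m c : ℕ} (hx : x < U) (hc : c < m) : x * m + c < U * m :=
  calc x * m + c < (x + 1) * m := by rw [add_mul]; omega
    _ ≤ U * m := Nat.mul_le_mul_right _ hx

theorem runs_mulPairs {w ρ R m U n : ℕ} {D E : ℤ} {s : ZState} (hRρ : R = 2 ^ ρ) (hf : Fits w E R)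
    (hp : HasParams E R s) (hw : HoldsRoots s.mem E R) (h2 : s.reg 2 = D)
    (h3 : s.reg 3 = (n * (2 * m) : ℕ)) (h6 : s.reg 6 = m) (h11 : s.reg 11 = m)
    (h12 : s.reg 12 = (U * (2 * m) : ℕ)) (hm : 1 ≤ m) (hU : 1 ≤ U) (hNR : 2 * (U * (2 * m)) ≤ R)
    (hD : 0 ≤ D) (hDE : D + (n * (U * (2 * m)) : ℕ) = E) {φ : ℕ → ℕ[X]} (hφ : ∀ i, IsFactor (φ i))
    (hM : HoldsBlocks s.mem D U φ m 0 (2 * n)) :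
    Runs w mulPairs s (n * (1000 * (ρ * R) + 25) + 15) fun s' => (∀ r < 7, s'.reg r = s.reg r) ∧
      (∀ a < D, s'.mem a = s.mem a) ∧ HoldsBlocks s'.mem D U φ (2 * m) 0 n := by
  have hE := hf.nonneg
  have hlt := hf.lt
  have hR4 := hf.four_le
  have hUm : 1 ≤ U * m := Nat.mul_pos hU hm
  obtain ⟨N, hN⟩ : ∃ N, N = U * (2 * m) := ⟨_, rfl⟩
  have hNm : 2 * (U * m) = N := by rw [hN]; ring
  have hmN : 2 * m ≤ N := by rw [hN]; exact Nat.le_mul_of_pos_left _ hU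
  have hnN : n * (2 * m) ≤ n * N := Nat.mul_le_mul_left _ hmN
  have hn : n ≤ n * (2 * m) := Nat.le_mul_of_pos_right _ (by omega)
  rw [← hN] at hDE h12 hNR
  have hlen : (Expr.reg 3 / (2 * Expr.reg 6)).Ok w s ∧
      (Expr.reg 3 / (2 * Expr.reg 6)).evalZ s = n := by
    constructor
    · have a1 : InWord w ((n * (2 * m) : ℕ) : ℤ) := ⟨by positivity, by omega⟩
      have a2 : InWord w ((2 * m : ℕ) : ℤ) := ⟨by positivity, by omega⟩
      push_cast at a1 a2
      simp [h3, h6, a1, a2]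
    · simp only [Expr.evalZ_div, Expr.evalZ_reg, Expr.evalZ_mul, Expr.evalZ_ofNat, h3, h6]
      push_cast
      exact Int.mul_ediv_cancel _ (by omega)
  -- The product of the blocks 2j and 2j + 1 fills exactly their 2 U m cells. So after j passes
  -- there are j finished blocks followed by the untouched blocks from 2j on.
  refine Runs.mono (Runs.forLoop hf.pos n (fun _ => 1000 * (ρ * R) + 6) (fun j s' =>
      (∀ r < 20, r ≠ 7 → r ≠ 10 → s'.reg r = s.reg r) ∧ (∀ a < D, s'.mem a = s.mem a) ∧
      HoldsRoots s'.mem E R ∧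
      HoldsBlocks s'.mem D U φ m (2 * j) (2 * n) ∧ HoldsBlocks s'.mem D U φ (2 * m) 0 j) ?_ ?_ ?_ ?_
      ?_) ?_ fun s' h => h
  · have : (n : ℤ) < 2 ^ w := by omega
    exact_mod_cast this
  · exact ⟨fun r _ h7 _ => by simp [h7], fun a _ => rfl, hw, hM, fun b _ hb => absurd hb (by omega)⟩
  · intro k hk s' _ h
    have hs : ∀ r < 7, s'.reg r = s.reg r := fun r hr => h.1 r (by omega) (by omega) (by omega)
    have := hlen
    simp only [Expr.ok_div, Expr.ok_mul, Expr.ok_reg, Expr.ok_ofNat, Expr.evalZ_div,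
      Expr.evalZ_reg, Expr.evalZ_mul, Expr.evalZ_ofNat] at this ⊢
    rw [hs 3 (by norm_num), hs 6 (by norm_num)]
    exact this
  · rintro s' _ ⟨g1, g2, -, -, g5⟩
    exact ⟨fun r hr => g1 r (by omega) (by omega) (by omega), g2, g5⟩
  · rintro j hj s' g0 ⟨g1, g2, g3, g4, g5⟩
    have hjn : j * N + N ≤ n * N := by
      calc j * N + N = (j + 1) * N := by ring
        _ ≤ n * N := Nat.mul_le_mul_right _ hj
    have ej : ∀ b, b * (U * (2 * m)) = b * N := fun b => by rw [hN]
    have ej' : 2 * j * (U * m) = j * N := by rw [← hNm]; ring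
    have ej'' : (2 * j + 1) * (U * m) = j * N + U * m := by rw [← hNm]; ring
    refine Runs.mono (Runs.assign_seq (by simp) <|
      Runs.mono (runs_mulBlocks (s := s'.set 10 _) (a := D + (j * N : ℕ)) hRρ hf ⟨?_, ?_, ?_, ?_⟩ g3 ?_ ?_ ?_ hm hU ?_ ?_ ?_
        (f := (block φ m (2 * j)).coeff) (g := (block φ m (2 * j + 1)).coeff)
        (h := (block φ (2 * m) j).coeff) (fun x _ => coeff_block_lt hφ hm _ x)
        (fun x _ => coeff_block_lt hφ hm _ x) (fun x _ => coeff_block_lt hφ (by omega) _ x)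
        ?_ ?_ (coeff_block_two_mul φ m j)) le_rfl ?_) ?_ fun s' h => h
    · simp [g1 5, hp.r5]
    · simp [g1 13, hp.r13]
    · simp [g1 14, hp.r14]
    · simp [g1 15, hp.r15]
    · simp [g0, g1 2, g1 12, h2, h12]
    · simp [g1 11, h11]
    · simp [g1 12, h12, hN]
    · rw [← hN]; exact hNR
    · positivity
    · rw [← hN]; omega
    · intro x hx c hc
      have := g4 (2 * j) (by omega) (by omega) x hx c hc
      rwa [ej'] at this
    · intro x hx c hc
      have := g4 (2 * j + 1) (by omega) (by omega) x hx c hc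
      rw [ej''] at this
      simp only [ZState.set_mem]
      rw [← this]; congr 1; push_cast; ring
    · rintro s'' ⟨f1, f2, f3⟩
      rw [← hN] at f2
      refine ⟨by rw [f1 7 (by norm_num)]; simpa using g0, fun r hr h7 h10 => ?_, fun a ha => ?_,
        g3.congr fun a ha ha' => ?_, fun b hb hb' x hx c hc => ?_, fun b _ hb x hx c hc => ?_⟩
      · simp [h7, f1 r hr, h10, g1 r hr h7 h10]
      · simp only [ZState.set_mem]
        rw [f2 a (by omega) (by omega)]
        simp [g2 a ha]
      · simp only [ZState.set_mem]
        rw [f2 a (by omega) (by omega)]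
        simp
      · rw [← g4 b (by omega) hb' x hx c hc]
        have := row_lt hx hc
        have e1 : (j + 1) * N ≤ b * (U * m) := by
          rw [← hNm, ← mul_assoc, mul_comm (j + 1) 2]; exact Nat.mul_le_mul_right _ hb
        have e2 : (b + 1) * (U * m) ≤ n * N := by
          rw [← hNm, ← mul_assoc n, mul_comm n 2]; exact Nat.mul_le_mul_right _ hb'
        rw [add_mul] at e1 e2
        simp only [ZState.set_mem]
        rw [f2 _ (by omega) (by omega)]
        simp
      · rcases Nat.lt_succ_iff_lt_or_eq.1 hb with hb | rfl
        · rw [← g5 b (by omega) hb x hx c hc]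
          have := row_lt hx hc
          have e1 : (b + 1) * N ≤ j * N := Nat.mul_le_mul_right _ hb
          rw [add_mul] at e1
          rw [← hN] at this
          rw [ej]
          simp only [ZState.set_mem]
          rw [f2 _ (by omega) (by omega)]
          simp
        · rw [← f3 x hx c hc, ej]; rfl
    · simp; omega
  · simp
    ring_nf; omega

end WordRAM

/-! ### All levels of the product tree -/

namespace WordRAM

open Polynomial

/-- Multiply all blocks. -/
def mulTree : Cmd :=
  6 ::= 1 ;;
  .loop (.less (.reg 6) (.reg 3)) (
    11 ::= .reg 6 ;; 12 ::= .reg 4 * (2 * .reg 6) ;; prepare ;; mulPairs ;; 6 ::= 2 * .reg 6)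

/-- A level consists of n products with N digits each, and n N = V at every level, so its cost O(V
log V) does not depend on the level. -/
theorem level_time_le {n N V ρ R l : ℕ} (hV : n * N = V) (hn : 1 ≤ n) (hN : 1 ≤ N)
    (hR : R ≤ 4 * N) (hρ : ρ ≤ l) (hl : 1 ≤ l) :
    10000 * N + (n * (1000 * (ρ * R) + 25) + 15) + 16 ≤ 20000 * (l * V) := by
  have e1 : N ≤ V := hV ▸ Nat.le_mul_of_pos_left _ hn
  have e2 : n ≤ V := hV ▸ Nat.le_mul_of_pos_right _ hN
  have e3 : V ≤ l * V := Nat.le_mul_of_pos_left _ hl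
  have e4 : n * (ρ * R) ≤ n * (l * (4 * N)) := by gcongr
  have e5 : n * (l * (4 * N)) = 4 * (l * V) := by rw [← hV]; ring
  have e6 : n * (1000 * (ρ * R) + 25) = 1000 * (n * (ρ * R)) + 25 * n := by ring
  omega

theorem runs_mulTree {w q l U : ℕ} {D : ℤ} {s : ZState} (hU : 1 ≤ U) (h2 : s.reg 2 = D)
    (h3 : s.reg 3 = (2 ^ q : ℕ)) (h4 : s.reg 4 = U) (h5 : s.reg 5 = D + (2 ^ q * U : ℕ)) (hD : 0 ≤ D)
    (hw : ((4 * (2 ^ q * U) : ℕ) : ℤ) ^ 80 < 2 ^ w)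
    (hDw : D + (2 ^ q * U : ℕ) + 8 * (4 * (2 ^ q * U) : ℕ) < 2 ^ w)
    (hl : 4 * (2 ^ q * U) < 2 ^ (l + 1)) {φ : ℕ → ℕ[X]} (hφ : ∀ i, IsFactor (φ i))
    (hM : HoldsBlocks s.mem D U φ 1 0 (2 ^ q)) :
    Runs w mulTree s (q * (20010 * (l * (2 ^ q * U))) + 20) fun s' =>
      (∀ r < 6, s'.reg r = s.reg r) ∧ (∀ a < D, s'.mem a = s.mem a) ∧
      HoldsBlocks s'.mem D U φ (2 ^ q) 0 1 := by
  obtain ⟨V, hV⟩ : ∃ V, V = 2 ^ q * U := ⟨_, rfl⟩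
  rw [← hV] at h5 hw hDw hl ⊢
  have hpow : 2 ^ q ≤ V := hV ▸ Nat.le_mul_of_pos_right _ hU
  have hV1 : 1 ≤ V := Nat.one_le_two_pow.trans hpow
  have hl1 : 1 ≤ l := by
    rcases Nat.eq_zero_or_pos l with rfl | h
    · norm_num at hl; omega
    · exact h
  have hw0 : 0 < w := by
    rcases Nat.eq_zero_or_pos w with rfl | h
    · norm_num at hDw; omega
    · exact h
  have hword : ∀ i ≤ q, InWord w ((2 ^ i : ℕ) : ℤ) := fun i hi => ⟨by positivity, by
    have : 2 ^ i ≤ 2 ^ q := Nat.pow_le_pow_right (by norm_num) hi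
    omega⟩
  refine Runs.mono (Runs.assign_seq (by simp) <| Runs.loop hw0 q (fun _ => 20000 * (l * V))
    (fun i s' => (∀ r < 6, s'.reg r = s.reg r) ∧ (∀ a < D, s'.mem a = s.mem a) ∧
      s'.reg 6 = (2 ^ i : ℕ) ∧ HoldsBlocks s'.mem D U φ (2 ^ i) 0 (2 ^ (q - i))) ?_ ?_ ?_ ?_ ?_) ?_
      fun s' h => h
  · exact ⟨fun r hr => by simp [show r ≠ 6 by omega], fun a _ => rfl, by simp, by simpa using hM⟩
  · intro i hi s' h
    rw [Expr.ok_less, Expr.evalZ_reg, Expr.evalZ_reg, h.2.2.1, h.1 3 (by norm_num), h3]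
    exact ⟨trivial, trivial, hword i hi, hword q le_rfl⟩
  · intro i hi s' h
    rw [Expr.evalZ_reg, Expr.evalZ_reg, h.2.2.1, h.1 3 (by norm_num), h3]
    exact_mod_cast Nat.pow_lt_pow_right (by norm_num) hi
  · intro s' h
    refine ⟨?_, h.1, h.2.1, by simpa using h.2.2.2⟩
    rw [Expr.evalZ_reg, Expr.evalZ_reg, h.2.2.1, h.1 3 (by norm_num), h3]
  · rintro i hi s' ⟨g1, g2, g3, g4⟩
    obtain ⟨n, hn⟩ : ∃ n, n = 2 ^ (q - (i + 1)) := ⟨_, rfl⟩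
    obtain ⟨N, hN⟩ : ∃ N, N = U * (2 * 2 ^ i) := ⟨_, rfl⟩
    have e1 : n * (2 * 2 ^ i) = 2 ^ q := by
      rw [hn, ← pow_succ', ← pow_add]; congr 1; omega
    have e2 : 2 ^ (q - i) = 2 * n := by
      rw [hn, ← pow_succ']; congr 1; omega
    have e3 : n * N = V := by rw [hN, hV, ← e1]; ring
    have hn1 : 1 ≤ n := by rw [hn]; exact Nat.one_le_two_pow
    have hN1 : 1 ≤ N := by rw [hN]; exact Nat.mul_pos hU (by positivity)
    have hNV : N ≤ V := e3 ▸ Nat.le_mul_of_pos_left _ hn1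
    rw [e2] at g4
    refine Runs.mono (Runs.assign_seq (by simp) <| Runs.assign_seq (by simp) <|
      Runs.seq (T₁ := 10000 * N) (P := fun s₁ => (∀ r < 13, s₁.reg r =
          ((s'.set 11 (2 ^ i : ℕ)).set 12 N).reg r) ∧
        (∀ a < D + V, s₁.mem a = s'.mem a) ∧ ∃ ρ R, R = 2 ^ ρ ∧ 2 * N ≤ R ∧ R ≤ 4 * N ∧
        Fits w (D + V) R ∧ HasParams (D + V) R s₁ ∧ HoldsRoots s₁.mem (D + V) R)
      (Runs.mono (runs_prepare (N := N) (E := D + V) ?_ ?_ hN1 ?_ ?_ ?_) le_rfl ?_) fun s₁ h₁ =>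
      Runs.seq (T₁ := 20000 * (l * V) - 10000 * N - 16) (P := fun s₂ => (∀ r < 7, s₂.reg r = s₁.reg r) ∧
        (∀ a < D, s₂.mem a = s₁.mem a) ∧ HoldsBlocks s₂.mem D U φ (2 * 2 ^ i) 0 n)
        ?_ fun s₂ h₂ =>
      Runs.assign (Q := fun s' => (∀ r < 6, s'.reg r = s.reg r) ∧ (∀ a < D, s'.mem a = s.mem a) ∧
        s'.reg 6 = (2 ^ (i + 1) : ℕ) ∧ HoldsBlocks s'.mem D U φ (2 ^ (i + 1)) 0 (2 ^ (q - (i + 1))))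
        (by simp) ?_) ?_ fun s' h => h
    · simp [g1 5, h5]
    · simp [g1 4, h4, g3, hN]
    · refine lt_of_le_of_lt (pow_le_pow_left₀ (by positivity) ?_ 80) hw
      exact_mod_cast (by omega : 4 * N ≤ 4 * V)
    · positivity
    · push_cast at hDw ⊢
      omega
    · rintro s₁ ⟨f1, f2, f3⟩
      refine ⟨fun r hr => ?_, f2, f3⟩
      rw [f1 r hr]
      simp [g1 4, h4, g3, hN]
    · obtain ⟨f1, f2, ρ, R, hR, hNR, hRN, hf, hp, hroots⟩ := h₁
      have hρ : ρ ≤ l := by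
        have : 2 ^ ρ < 2 ^ (l + 1) := by omega
        have := (Nat.pow_lt_pow_iff_right (by norm_num)).1 this
        omega
      refine Runs.mono (runs_mulPairs (m := 2 ^ i) (n := n) hR hf hp hroots (D := D) ?_ ?_ ?_ ?_ ?_
        Nat.one_le_two_pow hU ?_ hD ?_ hφ ?_) ?_ fun s' h => h
      · simp [f1 2, g1 2, h2]
      · rw [f1 3 (by norm_num), e1]; simp [g1 3, h3]
      · rw [f1 6 (by norm_num)]; simp [g3]
      · rw [f1 11 (by norm_num)]; simp
      · rw [f1 12 (by norm_num)]; simp [hN]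
      · omega
      · rw [← hN, e3]
      · intro b hb hb' x hx c hc
        rw [f2 _ ?_]
        · exact g4 b hb hb' x hx c hc
        · have := row_lt hx hc
          have : (b + 1) * (U * 2 ^ i) ≤ 2 * n * (U * 2 ^ i) := Nat.mul_le_mul_right _ hb'
          have e4 : 2 * n * (U * 2 ^ i) = V := by rw [← e3, hN]; ring
          rw [add_mul] at this
          omega
      · have := level_time_le e3 hn1 hN1 hRN hρ hl1
        omega
    · obtain ⟨f1, f2, -⟩ := h₁
      obtain ⟨f4, f5, f6⟩ := h₂
      refine ⟨fun r hr => ?_, fun a ha => ?_, ?_, ?_⟩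
      · simp [show r ≠ 6 by omega, f4 r (by omega), f1 r (by omega), show r ≠ 11 by omega,
          show r ≠ 12 by omega, g1 r hr]
      · simp [f5 a ha, f2 a (by omega), g2 a ha]
      · simp only [Expr.evalZ_mul, Expr.evalZ_ofNat, Expr.evalZ_reg]
        rw [f4 6 (by norm_num), f1 6 (by norm_num)]
        simp [g3]; ring
      · rw [← hn, pow_succ']; exact f6
    · have e4 : V ≤ l * V := Nat.le_mul_of_pos_left _ hl1
      simp
      omega
  · have e1 : q ≤ q * (l * V) := Nat.le_mul_of_pos_right _ (Nat.mul_pos hl1 hV1)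
    simp
    rw [show q * (20000 * (l * V) + 1 + 1 + 2) = 20000 * (q * (l * V)) + 4 * q by ring,
      show q * (20010 * (l * V)) = 20010 * (q * (l * V)) by ring]
    omega

end WordRAM

namespace WordRAM

open Polynomial

/-! ### Subset sums -/

/-- The factor of a weight; the weight `0` is a placeholder. -/
noncomputable def factor (s : ℕ) : ℕ[X] := if s = 0 then 1 else 1 + X ^ s

theorem isFactor_factor (s : ℕ) : IsFactor (factor s) := by
  rw [factor]
  split_ifs with h
  · simp [IsFactor]
  · simp [IsFactor, Ne.symm h]

theorem testBit_coeff_factor (s x : ℕ) :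
    (((factor s).coeff x).testBit 0).toNat = if x = 0 ∨ x = s then 1 else 0 := by
  rw [factor]
  split_ifs with h1 h2 h2 <;> simp_all [coeff_one, coeff_X_pow]
  · rcases h2 with rfl | rfl <;> simp [h1, Ne.symm h1]

/-- Places beyond the end of the list read the default 0, whose factor is 1, so padding does not
change the product. -/
theorem prod_getD (g : ℕ → ℕ[X]) (hg : g 0 = 1) (F : List ℕ) (p : ℕ) (hp : F.length ≤ p) :
    ∏ i ∈ Finset.range p, g (F.getD i 0) = (F.map g).prod := by
  induction F generalizing p with
  | nil => simp [hg]
  | cons a F ih =>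
    obtain ⟨p, rfl⟩ : ∃ p', p = p' + 1 := ⟨p - 1, by simp at hp; omega⟩
    rw [Finset.prod_range_succ', List.map_cons, List.prod_cons, ← ih p (by simpa using hp), mul_comm]
    simp

theorem coeff_prod_one_add (A : Finset ℕ) (x : ℕ) :
    (∏ s ∈ A, (1 + X ^ s : ℕ[X])).coeff x = (A.powerset.filter fun T => ∑ s ∈ T, s = x).card := by
  rw [Finset.prod_one_add, finsetSum_coeff, Finset.card_filter]
  refine Finset.sum_congr rfl fun T _ => ?_
  rw [Finset.prod_pow_eq_pow_sum, coeff_X_pow]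
  simp [eq_comm]

/-- A subset with sum x ≤ u contains no weight above u, so discarding those weights loses no subset.
Distinctness turns the product over the list into one over a set. -/
theorem coeff_block_factor {S : Finset ℕ} {l : List ℕ} {u p x : ℕ} (hS : ∀ s ∈ S, 0 < s)
    (hl : l.Nodup) (hlS : l.toFinset = S) (hp : (l.filter (· ≤ u)).length ≤ p) (hx : x ≤ u) :
    (block (fun i => factor ((l.filter (· ≤ u)).getD i 0)) p 0).coeff x = subsetSumCount S x := by
  have e1 : block (fun i => factor ((l.filter (· ≤ u)).getD i 0)) p 0 =
      ∏ s ∈ S.filter (· ≤ u), (1 + X ^ s) := by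
    rw [block]
    simp only [zero_mul, zero_add]
    rw [prod_getD factor (by simp [factor]) _ _ hp, ← List.prod_toFinset _ (hl.filter _),
      List.toFinset_filter, hlS]
    refine Finset.prod_congr (by simp) fun s hs => ?_
    have := hS s (Finset.mem_filter.1 hs).1
    rw [factor, if_neg (by omega)]
  rw [e1, coeff_prod_one_add, subsetSumCount]
  congr 1
  ext T
  simp only [Finset.mem_filter, Finset.mem_powerset]
  constructor
  · rintro ⟨h1, h2⟩
    exact ⟨h1.trans (Finset.filter_subset _ _), h2⟩
  · rintro ⟨h1, h2⟩
    refine ⟨fun s hs => Finset.mem_filter.2 ⟨h1 hs, ?_⟩, h2⟩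
    have := Finset.single_le_sum (f := fun s => s) (fun _ _ => Nat.zero_le _) hs
    omega

/-- Distinct positive integers up to u number at most u. This is why the time bound has log u where
log (n u) would be expected. -/
theorem length_filter_le_bound {S : Finset ℕ} {l : List ℕ} {u : ℕ} (hS : ∀ s ∈ S, 0 < s)
    (hl : l.Nodup) (hlS : l.toFinset = S) : (l.filter (· ≤ u)).length ≤ u := by
  rw [← List.toFinset_card_of_nodup (hl.filter _), List.toFinset_filter, hlS]
  calc _ ≤ (Finset.Icc 1 u).card := Finset.card_le_card fun s hs => by
        have := Finset.mem_filter.1 hs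
        have := hS s this.1
        simp at *
        omega
    _ = u := by simp

/-! ### The list of the weights that are not too large -/

/-- Copy the input that is at most the register `1` to the cells behind the input, and count it in
the register `8`. -/
def filterInput : Cmd :=
  8 ::= 0 ;;
  .forLoop 7 (.reg 0) (
    .store (.reg 0 + .reg 8) (.load (.reg 7) * .less (.load (.reg 7)) (.reg 4)) ;;
    8 ::= .reg 8 + .less (.load (.reg 7)) (.reg 4))

/-- The input in the memory. -/
def HoldsInput (M : ℤ → ℤ) (l : List ℕ) : Prop := ∀ j < l.length, M j = l.getD j 0

theorem filter_take_succ {l : List ℕ} {k : ℕ} (hk : k < l.length) (P : ℕ → Bool) :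
    (l.take (k + 1)).filter P = (l.take k).filter P ++ if P (l.getD k 0) then [l.getD k 0] else [] := by
  rw [List.take_succ_eq_append_getElem hk, List.filter_append]
  rw [List.getD_eq_getElem _ _ hk, List.filter_cons]
  simp

/-- Each weight, multiplied by the outcome 0 or 1 of its test, is written to the next free cell, and
the counter advances only if it is kept. A rejected weight leaves a 0, in agreement with the default
value of `getD`. -/
theorem runs_filterInput {w u : ℕ} {l : List ℕ} {s : ZState} (hw : 0 < w) (h0 : s.reg 0 = l.length)
    (h4 : s.reg 4 = (u + 1 : ℕ)) (hlw : (2 * l.length : ℤ) < 2 ^ w) (huw : (u + 1 : ℤ) < 2 ^ w)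
    (hl : ∀ x ∈ l, x < 2 ^ w) (hM : ∀ j : ℕ, s.mem j = l.getD j 0) :
    Runs w filterInput s (50 * l.length + 20) fun s' =>
      (∀ r < 7, s'.reg r = s.reg r) ∧ HoldsInput s'.mem l ∧
      s'.reg 8 = (l.filter (· ≤ u)).length ∧
      ∀ j : ℕ, s'.mem (l.length + j) = (l.filter (· ≤ u)).getD j 0 := by
  refine Runs.mono (Runs.assign_seq (by simp) <| Runs.forLoop hw l.length (fun _ => 30)
    (fun k s' => (∀ r < 7, s'.reg r = s.reg r) ∧ HoldsInput s'.mem l ∧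
      s'.reg 8 = ((l.take k).filter (· ≤ u)).length ∧
      ∀ j : ℕ, s'.mem (l.length + j) = ((l.take k).filter (· ≤ u)).getD j 0) (by zify; omega) ?_ ?_ ?_ ?_)
      (by simp; omega) fun s' h => h
  · refine ⟨fun r hr => by simp [show r ≠ 7 by omega, show r ≠ 8 by omega], fun j _ => hM j,
      by simp, fun j => ?_⟩
    have := hM (l.length + j)
    push_cast at this
    simp [this]
  · intro k _ s' _ h
    simp [h.1 0, h0]
  · intro s' _ h
    simpa using h
  · rintro k hk s' hk7 ⟨g1, g2, g3, g4⟩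
    have hF : ((l.take k).filter (· ≤ u)).length ≤ k :=
      (List.length_filter_le _ _).trans (List.length_take_le _ _)
    set F := (l.take k).filter (· ≤ u) with hFdef
    have hx := hl (l.getD k 0) (by rw [List.getD_eq_getElem _ _ hk]; exact List.getElem_mem hk)
    have hkx := g2 k hk
    have hsucc := filter_take_succ hk (· ≤ u)
    rw [← hFdef] at hsucc
    rw [hsucc]
    set x := l.getD k 0 with hxdef
    have w1 : InWord w (k : ℤ) := ⟨by positivity, by omega⟩
    have w2 : InWord w (x : ℤ) := ⟨by positivity, by exact_mod_cast hx⟩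
    have w3 : InWord w ((u : ℤ) + 1) := ⟨by positivity, by omega⟩
    have w4 : InWord w ((l.length : ℤ) + F.length) := ⟨by positivity, by omega⟩
    have hux : (x : ℤ) < (u : ℤ) + 1 ↔ x ≤ u := by omega
    refine Runs.mono (Runs.store_seq (by simp) ?_ ?_ <| Runs.assign
      (Q := fun s'' => s''.reg 7 = (k : ℤ) ∧ (∀ r < 7, s''.reg r = s.reg r) ∧
        HoldsInput s''.mem l ∧ s''.reg 8 = (F ++ if x ≤ u then [x] else []).length ∧
      ∀ j : ℕ, s''.mem (l.length + j) = (F ++ if x ≤ u then [x] else []).getD j 0)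
      ?_ ?_) ?_ fun s' h => ?_
    · simp [hk7, hkx, g1 4, h4, w1, w2, w3]
    · simpa [g1 0, h0, g3] using w4
    · simp [hk7, hkx, g1 4, h4, w1, w3, g1 0, h0, g3, show (k : ℤ) ≠ l.length + F.length by omega, w2]
    · refine ⟨by simp [hk7], fun r hr => by simp [show r ≠ 8 by omega, g1 r hr], fun j hj => ?_,
        ?_, fun j => ?_⟩
      · simp [g1 0, h0, g3, show (j : ℤ) ≠ l.length + F.length by omega, g2 j hj]
      · simp only [ZState.set_reg, if_true, Expr.evalZ_add, Expr.evalZ_reg, Expr.evalZ_load,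
          Expr.evalZ_less, ZState.put_reg, ZState.put_mem, hk7, g1 0 (by norm_num), h0, g3,
          if_neg (show ¬ (k : ℤ) = l.length + F.length by omega), hkx, g1 4 (by norm_num), h4]
        push_cast
        by_cases hu : x ≤ u
        · simp [hu, hux]
        · simp [hu, hux]
      · simp only [ZState.set_mem, ZState.put_mem, Expr.evalZ_add, Expr.evalZ_reg, Expr.evalZ_load,
          Expr.evalZ_less, Expr.evalZ_mul, hk7, g1 0 (by norm_num), h0, g3, hkx,
          g1 4 (by norm_num), h4]
        push_cast
        rcases lt_trichotomy j F.length with hj | rfl | hj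
        · rw [if_neg (by omega), g4, List.getD_append _ _ _ _ hj]
        · rw [if_pos rfl, List.getD_append_right _ _ _ _ le_rfl]
          by_cases hu : x ≤ u
          · simp [hu, hux]
          · simp [hu, hux]
        · rw [if_neg (by omega), g4, List.getD_append_right _ _ _ _ hj.le,
            List.getD_eq_default _ _ hj.le]
          by_cases hu : x ≤ u
          · simp only [hu, if_true]
            rw [List.getD_eq_default _ _ (by simp; omega)]
          · simp [hu]
    · simp
    · obtain ⟨h1, h2, h3, h4, h5⟩ := h
      refine ⟨h1, fun r hr => by simp [show r ≠ 7 by omega, h2 r hr], h3, ?_, ?_⟩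
      · simpa using h4
      · simpa using h5

end WordRAM

namespace WordRAM

open Polynomial

/-! ### The table of the subset counts -/

/-- Compute the table of the subset counts at the address in register `2`, with rows of the length
in register `3`. -/
def countSubsets : Cmd :=
  4 ::= .reg 1 + 1 ;;
  filterInput ;;
  doubleUpTo 3 1 (.reg 8) ;;
  2 ::= .reg 0 + .reg 3 ;;
  5 ::= .reg 2 + .reg 3 * .reg 4 ;;
  .fill 40 (.reg 2) (.reg 3 * .reg 4) (.less 0 (.same (.reg 40 % .reg 4) 0 +
    .same (.reg 40 % .reg 4) (.load (.reg 0 + .reg 40 / .reg 4)))) ;;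
  mulTree

theorem lt_two_pow {w X : ℕ} (hX : 2 ≤ X) (h : X ^ 1000 ≤ 2 ^ w) {y : ℤ} (hy : y ≤ (X : ℤ) ^ 900) :
    y < 2 ^ w := by
  have h1 : X ^ 900 < X ^ 1000 := Nat.pow_lt_pow_right (by omega) (by norm_num)
  have h2 : (X : ℤ) ^ 900 < 2 ^ w := by exact_mod_cast h1.trans_le h
  exact hy.trans_lt h2

/-- Since X ≥ 2, ten further powers of X absorb any constant up to 1024. -/
theorem mul_pow_le_pow {X a k : ℕ} (hX : 2 ≤ X) (ha : a ≤ 1024) : a * X ^ k ≤ X ^ (k + 10) := by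
  rw [pow_add, mul_comm]
  exact Nat.mul_le_mul_left _ (ha.trans ((by norm_num : 1024 ≤ 2 ^ 10).trans
    (Nat.pow_le_pow_left hX 10)))

/-- The state after the computation of the table of the subset counts. -/
structure HoldsCounts (S : Finset ℕ) (l : List ℕ) (u q : ℕ) (s : ZState) : Prop where
  r0 : s.reg 0 = l.length
  r1 : s.reg 1 = u
  r2 : s.reg 2 = (l.length + 2 ^ q : ℕ)
  r3 : s.reg 3 = (2 ^ q : ℕ)
  r4 : s.reg 4 = (u + 1 : ℕ)
  input : HoldsInput s.mem l
  count_lt : ∀ x ≤ u, subsetSumCount S x < 2 ^ 2 ^ q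
  count : ∀ x ≤ u, ∀ c < 2 ^ q, s.mem ((l.length + 2 ^ q : ℕ) + (x * 2 ^ q + c : ℕ)) =
    ((subsetSumCount S x).testBit c).toNat

/-- The depth q is the least one with 2^q at least the number of kept weights. Its minimality,
recorded as 2^i < n and 2^i < u for i < q, is what the time estimates use. -/
theorem runs_countSubsets {w u : ℕ} {S : Finset ℕ} {l : List ℕ} {s : ZState} (hS : ∀ s ∈ S, 0 < s)
    (hl : l.Nodup) (hlS : l.toFinset = S) (hlw : ∀ x ∈ l, x < 2 ^ w)
    (hX : (l.length + u + 2) ^ 1000 ≤ 2 ^ w) (h0 : s.reg 0 = l.length) (h1 : s.reg 1 = u)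
    (hM : ∀ j : ℕ, s.mem j = l.getD j 0) :
    ∃ q, (∀ i < q, 2 ^ i < l.length ∧ 2 ^ i < u) ∧
      Runs w countSubsets s (100 * (l.length + 1) + 300 * (2 ^ q * (u + 1)) +
        20010 * (q * (Nat.log 2 (4 * (2 ^ q * (u + 1))) * (2 ^ q * (u + 1)))))
        (HoldsCounts S l u q) := by
  obtain ⟨X, hXdef⟩ : ∃ X, X = l.length + u + 2 := ⟨_, rfl⟩
  rw [← hXdef] at hX
  have hX2 : 2 ≤ X := by omega
  set F := l.filter (· ≤ u) with hF
  have hFn : F.length ≤ l.length := List.length_filter_le _ _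
  have hFu : F.length ≤ u := length_filter_le_bound hS hl hlS
  obtain ⟨q, hq1, hq2⟩ := exists_double one_pos F.length
  rw [one_mul] at hq1
  have hq2' : ∀ i < q, 2 ^ i < F.length := fun i hi => by simpa using hq2 i hi
  refine ⟨q, fun i hi => ⟨(hq2' i hi).trans_le hFn, (hq2' i hi).trans_le hFu⟩, ?_⟩
  obtain ⟨p, hp⟩ : ∃ p, p = 2 ^ q := ⟨_, rfl⟩
  have hp1 : 1 ≤ p := hp ▸ Nat.one_le_two_pow
  have hpX : p ≤ 2 * X := by
    rcases Nat.eq_zero_or_pos q with rfl | hq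
    · simp at hp; omega
    · have := hq2' (q - 1) (by omega)
      have e : 2 ^ q = 2 * 2 ^ (q - 1) := by rw [← pow_succ']; congr 1; omega
      omega
  obtain ⟨U, hU⟩ : ∃ U, U = u + 1 := ⟨_, rfl⟩
  obtain ⟨V, hV⟩ : ∃ V, V = p * U := ⟨_, rfl⟩
  have hVX : V ≤ 2 * X ^ 2 := by
    calc V ≤ 2 * X * X := hV ▸ Nat.mul_le_mul hpX (by omega)
      _ = 2 * X ^ 2 := by ring
  have hX1 : X ≤ X ^ 2 := Nat.le_self_pow (by norm_num) X
  have hbound : 2 * l.length + u + 1 + p + V + 8 * (4 * V) ≤ X ^ 900 := by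
    calc _ ≤ 100 * X ^ 2 := by omega
      _ ≤ X ^ 12 := mul_pow_le_pow hX2 (by norm_num)
      _ ≤ X ^ 900 := Nat.pow_le_pow_right (by omega) (by norm_num)
  have hbound' : (4 * V) ^ 80 ≤ X ^ 900 := by
    calc (4 * V) ^ 80 ≤ (X ^ 11) ^ 80 := by
          refine Nat.pow_le_pow_left ?_ 80
          calc 4 * V ≤ 8 * X ^ 2 := by omega
            _ ≤ X ^ 3 * X ^ 2 := Nat.mul_le_mul_right _ (Nat.pow_le_pow_left hX2 3)
            _ = X ^ 5 := by ring
            _ ≤ X ^ 11 := Nat.pow_le_pow_right (by omega) (by norm_num)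
      _ = X ^ 880 := by rw [← pow_mul]
      _ ≤ X ^ 900 := Nat.pow_le_pow_right (by omega) (by norm_num)
  have hw : ((2 * l.length + u + 1 + p + V + 8 * (4 * V) : ℕ) : ℤ) < 2 ^ w :=
    lt_two_pow hX2 hX (by exact_mod_cast hbound)
  have hw' : ((4 * V : ℕ) : ℤ) ^ 80 < 2 ^ w := lt_two_pow hX2 hX (by exact_mod_cast hbound')
  push_cast at hw
  have hw0 : 0 < w := by
    rcases Nat.eq_zero_or_pos w with rfl | h
    · norm_num at hw; omega
    · exact h
  set φ : ℕ → ℕ[X] := fun i => factor (F.getD i 0) with hφ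
  have hqp : q ≤ p := hp ▸ Nat.lt_two_pow_self.le
  have hpV : p ≤ V := hV ▸ Nat.le_mul_of_pos_right _ (by omega)
  clear hX hbound hbound'
  refine Runs.mono (Runs.assign_seq (by simp) <|
    Runs.seq (P := fun s' => s'.reg 0 = l.length ∧ s'.reg 1 = u ∧ s'.reg 4 = U ∧
        HoldsInput s'.mem l ∧ s'.reg 8 = F.length ∧ ∀ j : ℕ, s'.mem (l.length + j) = F.getD j 0)
      (Runs.mono (runs_filterInput (l := l) (u := u) hw0 ?_ ?_ ?_ ?_ hlw ?_) le_rfl ?_) fun s₁ h₁ =>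
    Runs.seq (P := fun s' => s'.reg 0 = l.length ∧ s'.reg 1 = u ∧ s'.reg 4 = U ∧ s'.reg 3 = p ∧
        HoldsInput s'.mem l ∧ ∀ j : ℕ, s'.mem (l.length + j) = F.getD j 0)
      (Runs.mono (runs_doubleUpTo (b := 1) (n := F.length) (r := q) hw0 (by norm_num) (by omega) hq2
        (by simp) (by simp [h₁.2.2.2.2.1]) (by simp) (by simp) ?_ ?_) le_rfl ?_) fun s₂ h₂ =>
    Runs.assign_seq (by simp) <| Runs.assign_seq (by simp) <|
    Runs.seq (P := fun s' => s'.reg 0 = l.length ∧ s'.reg 1 = u ∧ s'.reg 2 = (l.length + p : ℕ) ∧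
        s'.reg 3 = p ∧ s'.reg 4 = U ∧ s'.reg 5 = (l.length + p + V : ℕ) ∧
        HoldsInput s'.mem l ∧ HoldsBlocks s'.mem (l.length + p : ℕ) U φ 1 0 p)
      (Runs.fill hw0 V (l.length + p : ℕ)
        (fun k => if k % U = 0 ∨ k % U = F.getD (k / U) 0 then 1 else 0) ?_ ?_ ?_ ?_ ?_ ?_ ?_ ?_)
      fun s₃ h₃ =>
    Runs.mono (runs_mulTree (U := U) (q := q) (l := Nat.log 2 (4 * (2 ^ q * (u + 1))))
      (D := (l.length + p : ℕ)) (φ := φ) ?_ ?_ ?_ ?_ ?_ ?_ ?_ ?_ ?_ ?_ ?_) le_rfl ?_)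
    ?_ fun s' h => h
  · simp [h0]
  · simp [h1]
  · omega
  · omega
  · simpa using hM
  · rintro s' ⟨f1, f2, f3, f4⟩
    refine ⟨?_, ?_, ?_, f2, f3, f4⟩
    · simp [f1 0, h0]
    · simp [f1 1, h1]
    · simp [f1 4, h1, hU]
  · zify; omega
  · rw [one_mul, ← hp]; zify; omega
  · rintro s' ⟨f1, f2, f3, -⟩
    obtain ⟨g1, g2, g3, g4, -, g6⟩ := h₁
    refine ⟨by simp [f1, g1], by simp [f1, g2], by simp [f1, g3], by rw [f3, one_mul, hp], ?_, ?_⟩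
    · rw [f2]; exact g4
    · rw [f2]; exact g6
  · simp
  · simp
  · simp [h₂.1, h₂.2.2.2.1]
  · simp [h₂.2.2.1, h₂.2.2.2.1, hV]
  · positivity
  · push_cast; omega
  · intro k hk M hM1 hM2
    obtain ⟨g1, g2, g3, g4, -, g6⟩ := h₂
    have hkU : k / U < p := Nat.div_lt_of_lt_mul (by rwa [mul_comm, ← hV])
    have hmod : k % U < U := Nat.mod_lt _ (by omega)
    have eF : M (l.length + ((k / U : ℕ) : ℤ)) = F.getD (k / U) 0 := by
      rw [hM2 _ (by left; push_cast; omega)]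
      exact g6 (k / U)
    have hFw : ∀ i, F.getD i 0 ≤ u := by
      intro i
      rcases lt_or_ge i F.length with hi | hi
      · rw [List.getD_eq_getElem _ _ hi]
        simpa using (List.mem_filter.1 (List.getElem_mem hi)).2
      · rw [List.getD_eq_default _ _ hi]; omega
    have := hFw (k / U)
    have e1 : (k : ℤ) / U = (k / U : ℕ) := by push_cast; rfl
    have e2 : (k : ℤ) % U = (k % U : ℕ) := by push_cast; rfl
    have w1 : InWord w (k : ℤ) := ⟨by positivity, by omega⟩
    have w2 : InWord w (U : ℤ) := ⟨by positivity, by omega⟩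
    have w3 : InWord w (l.length + ((k / U : ℕ) : ℤ)) := ⟨by positivity, by omega⟩
    have w4 : InWord w ((k % U : ℕ) : ℤ) := ⟨by positivity, by omega⟩
    have w5 : InWord w ((F.getD (k / U) 0 : ℕ) : ℤ) := ⟨by positivity, by omega⟩
    have w6 : InWord w 0 := ⟨le_rfl, by positivity⟩
    have w7 : ∀ P Q : Prop, ∀ _ : Decidable P, ∀ _ : Decidable Q,
        InWord w ((if P then 1 else 0) + if Q then 1 else 0) := by
      intro P Q _ _
      constructor <;> split_ifs <;> omega
    generalize F.getD (k / U) 0 = y at *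
    constructor
    · simp only [Expr.ok_less, Expr.ok_same, Expr.ok_add, Expr.ok_mod, Expr.ok_div, Expr.ok_load,
        Expr.ok_reg, Expr.ok_ofNat, Expr.evalZ_add, Expr.evalZ_same, Expr.evalZ_mod, Expr.evalZ_div,
        Expr.evalZ_load, Expr.evalZ_reg, Expr.evalZ_ofNat, ZState.set_reg]
      simp only [show (0 : ℕ) ≠ 40 by norm_num, show (4 : ℕ) ≠ 40 by norm_num,
        show (0 : ℕ) ≠ 5 by norm_num, show (0 : ℕ) ≠ 2 by norm_num, show (4 : ℕ) ≠ 5 by norm_num,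
        show (4 : ℕ) ≠ 2 by norm_num, if_false, if_true, g1, g3, e1, e2, eF, w1, w2, w3, w4, w5, w6,
        w7, and_self]
    · simp only [Expr.evalZ_less, Expr.evalZ_add, Expr.evalZ_same, Expr.evalZ_mod, Expr.evalZ_div,
        Expr.evalZ_load, Expr.evalZ_reg, Expr.evalZ_ofNat, ZState.set_reg]
      simp only [show (0 : ℕ) ≠ 40 by norm_num, show (4 : ℕ) ≠ 40 by norm_num,
        show (0 : ℕ) ≠ 5 by norm_num, show (0 : ℕ) ≠ 2 by norm_num, show (4 : ℕ) ≠ 5 by norm_num,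
        show (4 : ℕ) ≠ 2 by norm_num, if_false, if_true, g1, g3, e1, e2, eF]
      norm_cast
      by_cases c1 : k % U = 0 <;> by_cases c2 : k % U = y <;> simp [c1, c2]
  · intro M hM1 hM2
    obtain ⟨g1, g2, g3, g4, g5, g6⟩ := h₂
    refine ⟨by simp [g1], by simp [g2], by simp [g1, g4], by simp [g4], by simp [g3], ?_, ?_, ?_⟩
    · simp [g1, g4, g3, hV]
    · intro j hj
      simp only
      rw [hM2 _ (by left; push_cast; omega)]
      exact g5 j hj
    · intro b _ hb x hx c hc
      obtain rfl : c = 0 := by omega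
      have e : b * U + x < V := by
        calc b * U + x < (b + 1) * U := by rw [add_mul]; omega
          _ ≤ V := hV ▸ Nat.mul_le_mul_right _ hb
      have := hM1 (b * U + x) e
      have ec : ((l.length + p : ℕ) : ℤ) + (b * (U * 1) : ℕ) + (x * 1 + 0 : ℕ) =
        ((l.length + p : ℕ) : ℤ) + (b * U + x : ℕ) := by push_cast; ring
      rw [ec]
      change M _ = _
      rw [this, Nat.mul_add_mod_of_lt hx, show (b * U + x) / U = b by
        rw [mul_comm, Nat.mul_add_div (by omega), Nat.div_eq_of_lt hx, add_zero], block]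
      simp only [Finset.range_one, Finset.prod_singleton, mul_one, add_zero, hφ,
        testBit_coeff_factor]
      push_cast
      rfl
  · omega
  · exact h₃.2.2.1
  · rw [h₃.2.2.2.1, hp]
  · exact h₃.2.2.2.2.1
  · rw [h₃.2.2.2.2.2.1, ← hp, ← hV]; push_cast; ring
  · positivity
  · rw [← hp, ← hV]; exact hw'
  · rw [← hp, ← hV]; push_cast; omega
  · rw [← hp, ← hU, ← hV]; exact Nat.lt_pow_succ_log_self (by norm_num) _
  · exact fun i => isFactor_factor _
  · rw [← hp]; exact h₃.2.2.2.2.2.2.2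
  · rintro s' ⟨f1, f2, f3⟩
    obtain ⟨g1, g2, g3, g4, g5, g6, g7, g8⟩ := h₃
    have ec : ∀ x ≤ u, (block φ (2 ^ q) 0).coeff x = subsetSumCount S x := fun x hx =>
      coeff_block_factor hS hl hlS hq1 hx
    refine ⟨by rw [f1 0 (by norm_num), g1], by rw [f1 1 (by norm_num), g2],
      by rw [f1 2 (by norm_num), g3, hp], by rw [f1 3 (by norm_num), g4, hp],
      by rw [f1 4 (by norm_num), g5, hU], fun j hj => ?_, fun x hx => ?_, fun x hx c hc => ?_⟩
    · rw [f2 _ (by omega), g7 j hj]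
    · rw [← ec x hx]
      exact coeff_block_lt (fun i => isFactor_factor _) Nat.one_le_two_pow _ _
    · rw [← ec x hx, ← f3 0 le_rfl one_pos x (by omega) c hc, hp]
      congr 1; simp
  · rw [← hp, ← hU, ← hV]
    have : q * (20010 * (Nat.log 2 (4 * V) * V)) = 20010 * (q * (Nat.log 2 (4 * V) * V)) := by ring
    simp [this]
    omega

end WordRAM

namespace WordRAM

/-! ### Running times -/

/-- The factor in a time bound for a logarithm. -/
noncomputable def logFactor (x : ℝ) : ℝ := max (Real.logb 2 x) 1

theorem one_le_logFactor (x : ℝ) : 1 ≤ logFactor x := le_max_right _ _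

theorem logb_le_logFactor (x : ℝ) : Real.logb 2 x ≤ logFactor x := le_max_left _ _

theorem logFactor_mono {x y : ℝ} (hx : 0 < x) (h : x ≤ y) : logFactor x ≤ logFactor y :=
  max_le_max_right _ (Real.logb_le_logb_of_le (by norm_num) hx h)

theorem natLog_le_logb {x : ℕ} (hx : x ≠ 0) : (Nat.log 2 x : ℝ) ≤ Real.logb 2 x := by
  rw [Real.le_logb_iff_rpow_le (by norm_num) (by positivity), Real.rpow_natCast]
  exact_mod_cast Nat.pow_log_le_self 2 hx

theorem two_pow_le_of_forall {q n : ℕ} (h : ∀ i < q, 2 ^ i < n) : 2 ^ q ≤ 2 * max n 1 := by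
  rcases q with _ | q
  · simp; omega
  · have := h q (by omega)
    rw [pow_succ]; omega

theorem le_two_mul_logFactor {q n : ℕ} (h : ∀ i < q, 2 ^ i < n) : (q : ℝ) ≤ 2 * logFactor n := by
  have h1 := one_le_logFactor n
  rcases q with _ | q
  · simp; linarith
  · have h2 := h q (by omega)
    have h3 : (q : ℝ) ≤ Real.logb 2 n := by
      rw [Real.le_logb_iff_rpow_le (by norm_num) (by
        have : 0 < n := (Nat.zero_le _).trans_lt h2
        exact_mod_cast this), Real.rpow_natCast]
      exact_mod_cast h2.le
    have := logb_le_logFactor n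
    push_cast; linarith

/-- From q ≠ 0 it follows that u ≥ 2, so 2^q ≤ 2u and u + 1 ≤ 2u, and the argument of the logarithm
is at most 16 u². -/
theorem log_le_six_mul_logFactor {q u : ℕ} (h : ∀ i < q, 2 ^ i < u) (hq : q ≠ 0) :
    (Nat.log 2 (4 * (2 ^ q * (u + 1))) : ℝ) ≤ 6 * logFactor u := by
  have hu : 1 < u := by simpa using h 0 (by omega)
  have h1 := two_pow_le_of_forall h
  rw [max_eq_left (by omega)] at h1
  have h2 : 4 * (2 ^ q * (u + 1)) ≤ 2 ^ 4 * u ^ 2 := by nlinarith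
  have h3 : (0 : ℝ) < u := by exact_mod_cast (by omega : 0 < u)
  calc (Nat.log 2 (4 * (2 ^ q * (u + 1))) : ℝ) ≤ Nat.log 2 (2 ^ 4 * u ^ 2) := by
        exact_mod_cast Nat.log_mono_right h2
    _ ≤ Real.logb 2 ((2 ^ 4 * u ^ 2 : ℕ) : ℝ) := natLog_le_logb (by positivity)
    _ = 4 + 2 * Real.logb 2 u := by
        push_cast
        rw [Real.logb_mul (by norm_num) (by positivity), Real.logb_pow 2 (u : ℝ),
          show (16 : ℝ) = 2 ^ 4 by norm_num, Real.logb_pow, Real.logb_self_eq_one (by norm_num)]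
        norm_num
    _ ≤ 6 * logFactor u := by linarith [one_le_logFactor u, logb_le_logFactor u]

/-- For q = 0 no product is formed and the left side vanishes; only then could log u fail to bound
the logarithm of the length. -/
theorem mul_log_le {n u q : ℕ} (h : ∀ i < q, 2 ^ i < n ∧ 2 ^ i < u) :
    (q : ℝ) * Nat.log 2 (4 * (2 ^ q * (u + 1))) ≤ 12 * (logFactor u * logFactor n) := by
  have hlu := one_le_logFactor u
  have hln := one_le_logFactor n
  rcases eq_or_ne q 0 with rfl | hq
  · simp; positivity
  · calc _ ≤ 2 * logFactor n * (6 * logFactor u) :=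
          mul_le_mul (le_two_mul_logFactor fun i hi => (h i hi).1)
            (log_le_six_mul_logFactor (fun i hi => (h i hi).2) hq) (by positivity) (by positivity)
      _ = _ := by ring

/-- The logarithmic factor `Y` is left open: it is log u · log n for the first program and log² (n
u) for the second. -/
theorem countSubsets_time_le {n u q : ℕ} (h : ∀ i < q, 2 ^ i < n ∧ 2 ^ i < u) {Y : ℝ} (hY : 1 ≤ Y)
    (hq : (q : ℝ) * Nat.log 2 (4 * (2 ^ q * (u + 1))) ≤ 12 * Y) :
    ((100 * (n + 1) + 300 * (2 ^ q * (u + 1)) +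
      20010 * (q * (Nat.log 2 (4 * (2 ^ q * (u + 1))) * (2 ^ q * (u + 1)))) : ℕ) : ℝ) ≤
    1000000 * (max (n : ℝ) 1 * max (u : ℝ) 1 * Y) := by
  have h1 : ((2 ^ q : ℕ) : ℝ) ≤ 2 * max (n : ℝ) 1 := by
    have := two_pow_le_of_forall fun i hi => (h i hi).1
    exact_mod_cast this
  have hA : (1 : ℝ) ≤ max (n : ℝ) 1 := le_max_right _ _
  have hB : (1 : ℝ) ≤ max (u : ℝ) 1 := le_max_right _ _
  have hA' : (n : ℝ) ≤ max (n : ℝ) 1 := le_max_left _ _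
  have hB' : (u : ℝ) ≤ max (u : ℝ) 1 := le_max_left _ _
  generalize Nat.log 2 (4 * (2 ^ q * (u + 1))) = b at *
  push_cast at *
  generalize max (n : ℝ) 1 = A at *
  generalize max (u : ℝ) 1 = B at *
  have hV : (2 : ℝ) ^ q * (u + 1) ≤ 4 * (A * B) := by
    calc (2 : ℝ) ^ q * (u + 1) ≤ 2 * A * (2 * B) :=
          mul_le_mul h1 (by linarith) (by positivity) (by positivity)
      _ = _ := by ring
  have hAB : A ≤ A * B := le_mul_of_one_le_right (by linarith) hB
  have h4 : A * B ≤ A * B * Y := le_mul_of_one_le_right (by positivity) hY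
  have h5 : (q : ℝ) * (b * (2 ^ q * (u + 1))) ≤ 12 * Y * (4 * (A * B)) := by
    rw [← mul_assoc]
    exact mul_le_mul hq hV (by positivity) (by positivity)
  linarith

/-! ### The first program -/

/-- The initial state, with integers. -/
def initZState (l : List ℕ) (u : ℕ) : ZState where
  reg r := ((initState l u).reg r : ℕ)
  mem a := l.getD a.toNat 0

theorem toState_initZState {w u : ℕ} {l : List ℕ} (hlw : ∀ x ∈ l, x < 2 ^ w)
    (hX : (l.length + u + 2) ^ 1000 ≤ 2 ^ w) : (initZState l u).toState w = initState l u := by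
  have h : l.length + u + 2 ≤ 2 ^ w := (Nat.le_self_pow (by norm_num) _).trans hX
  have h1 : ∀ r, (initState l u).reg r < 2 ^ w := by
    intro r
    simp only [initState]
    split_ifs <;> omega
  have h2 : ∀ a, l.getD a 0 < 2 ^ w := by
    intro a
    rcases lt_or_ge a l.length with ha | ha
    · rw [List.getD_eq_getElem _ _ ha]; exact hlw _ (List.getElem_mem ha)
    · rw [List.getD_eq_default _ _ ha]; positivity
  have e : initState l u = ⟨(initState l u).reg, fun a => l.getD a 0⟩ := rfl
  rw [e]
  simp only [ZState.toState, initZState, State.mk.injEq, Int.toNat_natCast]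
  exact ⟨funext fun r => enc_natCast (h1 r), funext fun a => enc_natCast (h2 a)⟩

theorem initZState_mem (l : List ℕ) (u : ℕ) (j : ℕ) : (initZState l u).mem j = l.getD j 0 := rfl

theorem enc_boole {w : ℕ} (hw : 0 < w) (b : Bool) : enc w (b.toNat : ℤ) = b.toNat :=
  enc_natCast ((Bool.toNat_lt b).trans_le (by
    calc 2 = 2 ^ 1 := rfl
      _ ≤ 2 ^ w := Nat.pow_le_pow_right (by norm_num) hw))

theorem HoldsTable.of_mem {w m D L : ℕ} {f : ℕ → ℕ} {s : ZState} (hw : 0 < w) (h0 : s.reg 0 = D)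
    (h1 : s.reg 1 = L) (hD : D < 2 ^ w) (hL : L < 2 ^ w) (hf : ∀ x < m, f x < 2 ^ L)
    (h : ∀ x < m, ∀ c < L, s.mem (D + (x * L + c : ℕ)) = ((f x).testBit c).toNat) :
    HoldsTable (s.toState w) m f := by
  intro x hx
  simp only [ZState.toState, h0, h1, enc_natCast hD, enc_natCast hL]
  refine ⟨hf x hx, fun c hc => ?_⟩
  have := h x hx c hc
  beta_reduce
  rw [show ((D + x * L + c : ℕ) : ℤ) = D + (x * L + c : ℕ) by push_cast; ring, this, enc_boole hw]

theorem pos_of_pow_le {w X : ℕ} (hX : 2 ≤ X) (h : X ^ 1000 ≤ 2 ^ w) : 0 < w := by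
  rcases Nat.eq_zero_or_pos w with rfl | hw
  · have := (Nat.le_self_pow (Nat.succ_ne_zero 999) X).trans h
    omega
  · exact hw

/-- The program for the table of the subset counts. -/
def subsetSumProgram : Cmd := countSubsets ;; 0 ::= .reg 2 ;; 1 ::= .reg 3

theorem two_pow_le_of_forall_lt {q n : ℕ} (h : ∀ i < q, 2 ^ i < n) (hn : 1 ≤ n) : 2 ^ q ≤ 2 * n := by
  have := two_pow_le_of_forall h
  omega

theorem exec_subsetSumProgram {w u : ℕ} {S : Finset ℕ} {l : List ℕ} (hS : ∀ s ∈ S, 0 < s)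
    (hl : l.Nodup) (hlS : l.toFinset = S) (hlw : ∀ x ∈ l, x < 2 ^ w)
    (hX : (l.length + u + 2) ^ 1000 ≤ 2 ^ w) :
    ∃ t σ, Exec w subsetSumProgram (initState l u) t σ ∧
      (t : ℝ) ≤ 1000010 * (max (l.length : ℝ) 1 * max (u : ℝ) 1 * logFactor u *
        logFactor l.length) ∧
      HoldsTable σ (u + 1) (fun x => subsetSumCount S x) := by
  obtain ⟨q, hq, hrun⟩ := runs_countSubsets (s := initZState l u) hS hl hlS hlw hX rfl rfl
    (initZState_mem l u)
  have hX2 : 2 ≤ l.length + u + 2 := by omega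
  have hw0 := pos_of_pow_le hX2 hX
  have hq2 := two_pow_le_of_forall_lt (n := l.length + u + 2)
    (fun i hi => by have := (hq i hi).1; omega) (by omega)
  have hw : l.length + 2 ^ q < 2 ^ w := by
    have h1 : ((l.length + 2 ^ q : ℕ) : ℤ) < 2 ^ w := by
      refine lt_two_pow hX2 hX ?_
      have h2 : l.length + 2 ^ q ≤ (l.length + u + 2) ^ 900 := by
        calc l.length + 2 ^ q ≤ 3 * (l.length + u + 2) ^ 1 := by rw [pow_one]; omega
          _ ≤ (l.length + u + 2) ^ 11 := mul_pow_le_pow hX2 (by norm_num)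
          _ ≤ _ := Nat.pow_le_pow_right (by omega) (by norm_num)
      exact_mod_cast h2
    exact_mod_cast h1
  obtain ⟨t, s', hexec, ht, hres⟩ := Runs.seq hrun fun s₁ h₁ =>
    Runs.assign_seq (r := 0) (e := .reg 2) (Expr.ok_reg _ _ _) <|
    Runs.assign (s := s₁.set 0 (s₁.reg 2)) (r := 1) (e := .reg 3) (Q := fun s' => HoldsTable (s'.toState w) (u + 1)
      (fun x => subsetSumCount S x)) (by simp) <|
    HoldsTable.of_mem (D := l.length + 2 ^ q) (L := 2 ^ q) hw0 (by simp [h₁.r2])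
      (by simp [h₁.r3]) hw (by omega) (fun x hx => h₁.count_lt x (by omega))
      (fun x hx c hc => h₁.count x (by omega) c hc)
  rw [toState_initZState hlw hX] at hexec
  refine ⟨t, _, hexec, ?_, hres⟩
  have h1 := countSubsets_time_le hq (one_le_mul_of_one_le_of_one_le (one_le_logFactor u)
    (one_le_logFactor l.length)) (mul_log_le hq)
  have h2 : (1 : ℝ) ≤ max (l.length : ℝ) 1 * max (u : ℝ) 1 * logFactor u * logFactor l.length :=
    one_le_mul_of_one_le_of_one_le (one_le_mul_of_one_le_of_one_le (one_le_mul_of_one_le_of_one_le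
      (le_max_right _ _) (le_max_right _ _)) (one_le_logFactor _)) (one_le_logFactor _)
  rw [mul_assoc _ (logFactor u)] at h2 ⊢
  have h3 : (t : ℝ) ≤ ((100 * (l.length + 1) + 300 * (2 ^ q * (u + 1)) + 20010 * (q *
      (Nat.log 2 (4 * (2 ^ q * (u + 1))) * (2 ^ q * (u + 1)))) : ℕ) : ℝ) + 4 := by
    have e : (Expr.reg 2).cost + 1 + ((Expr.reg 3).cost + 1) = 4 := rfl
    rw [e] at ht
    exact_mod_cast ht
  linarith

end WordRAM

namespace WordRAM

/-! ### Swings -/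

/-- The number of coalitions with a total weight below `y`. -/
def countBelow (S : Finset ℕ) (y : ℕ) : ℕ := (S.powerset.filter fun T => ∑ s ∈ T, s < y).card

theorem countBelow_eq_sum (S : Finset ℕ) (y : ℕ) :
    countBelow S y = ∑ x ∈ Finset.range y, subsetSumCount S x := by
  rw [countBelow, Finset.card_eq_sum_card_fiberwise (f := fun T => ∑ s ∈ T, s)
    (t := Finset.range y) (fun T hT => by simpa using (Finset.mem_filter.1 hT).2)]
  refine Finset.sum_congr rfl fun x hx => ?_
  rw [subsetSumCount, Finset.filter_filter]
  congr 1
  ext T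
  have := Finset.mem_range.1 hx
  simp only [Finset.mem_filter]
  constructor <;> rintro ⟨h1, h2⟩ <;> exact ⟨h1, by omega⟩

theorem countBelow_zero (S : Finset ℕ) : countBelow S 0 = 0 := by simp [countBelow]

/-- Coalitions are split by whether they contain s; those that do leave a coalition of the others of
weight below y - s. Truncated subtraction is right here: for y ≤ s there are none. -/
theorem countBelow_eq_add {S : Finset ℕ} {s : ℕ} (hs : s ∈ S) (y : ℕ) :
    countBelow S y = countBelow (S.erase s) y + countBelow (S.erase s) (y - s) := by
  conv_lhs => rw [← Finset.insert_erase hs]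
  simp only [countBelow, Finset.card_filter]
  rw [Finset.sum_powerset_insert (Finset.notMem_erase s S)]
  congr 1
  refine Finset.sum_congr rfl fun T hT => ?_
  rw [Finset.sum_insert fun h => Finset.notMem_erase s S (Finset.mem_powerset.1 hT h)]
  congr 1
  exact propext (by omega)

/-- Among the losing coalitions of the other voters, those of weight below u - s still lose when s
joins; the rest are the swings. -/
theorem swingCount_add_countBelow (S : Finset ℕ) (u s : ℕ) :
    swingCount S u s + countBelow (S.erase s) (u - s) = countBelow (S.erase s) u := by
  simp only [swingCount, countBelow, Finset.card_filter]
  rw [← Finset.sum_add_distrib]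
  refine Finset.sum_congr rfl fun T hT => ?_
  rw [Finset.sum_insert fun h => Finset.notMem_erase s S (Finset.mem_powerset.1 hT h)]
  split_ifs <;> omega

theorem swingCount_le (S : Finset ℕ) (u s : ℕ) (hs : s ∈ S) : swingCount S u s ≤ countBelow S u := by
  have := swingCount_add_countBelow S u s
  have := countBelow_eq_add hs u
  omega

/-- The sum `P u - 2 P (u - s) + 2 P (u - 2 s) - …` with `k + 1` terms. -/
def alternating (P : ℕ → ℤ) (u s : ℕ) : ℕ → ℤ
  | 0 => P u
  | k + 1 => alternating P u s k + 2 * (-1) ^ (k + 1) * P (u - (k + 1) * s)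

/-- Repeated use of B(y) = B_s(y) + B_s(y - s) expresses the counts without s by counts over all
voters. After k + 1 terms the remainder is twice a count without s at u - (k+1) s, up to sign. -/
theorem swingCount_eq_alternating {S : Finset ℕ} {u s : ℕ} (hs : s ∈ S) (h0 : 0 < s) :
    (swingCount S u s : ℤ) = alternating (fun y => countBelow S y) u s ((u - 1) / s) := by
  have key : ∀ k, (swingCount S u s : ℤ) = alternating (fun y => countBelow S y) u s k +
      2 * (-1) ^ (k + 1) * countBelow (S.erase s) (u - (k + 1) * s) := by
    intro k
    induction k with
    | zero =>
      have h1 : (swingCount S u s : ℤ) + countBelow (S.erase s) (u - s) =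
          countBelow (S.erase s) u := by exact_mod_cast swingCount_add_countBelow S u s
      have h2 : (countBelow S u : ℤ) = countBelow (S.erase s) u +
          countBelow (S.erase s) (u - s) := by exact_mod_cast countBelow_eq_add hs u
      simp only [alternating, zero_add, one_mul, pow_one]
      linarith
    | succ k ih =>
      have h2 : (countBelow S (u - (k + 1) * s) : ℤ) = countBelow (S.erase s) (u - (k + 1) * s) +
          countBelow (S.erase s) (u - (k + 1 + 1) * s) := by
        rw [add_mul (k + 1) 1, one_mul, ← Nat.sub_sub]
        exact_mod_cast countBelow_eq_add hs _
      rw [ih, alternating, h2]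
      ring
  -- This is the first k with (k+1) s ≥ u, so the remainder counts coalitions of weight below 0 and
  -- vanishes.
  have h := key ((u - 1) / s)
  have h1 : u - 1 < ((u - 1) / s + 1) * s := by
    rw [mul_comm]; exact Nat.lt_mul_div_succ _ h0
  rw [show u - ((u - 1) / s + 1) * s = 0 by omega, countBelow_zero] at h
  simpa using h

/-- The alternating sum is linear in its sequence, so it can be taken in each digit position without
carries. -/
theorem sum_alternating_mul (Q : ℕ → ℕ → ℤ) (u s k p : ℕ) :
    ∑ i ∈ Finset.range p, alternating (fun y => Q y i) u s k * 2 ^ i =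
      alternating (fun y => ∑ i ∈ Finset.range p, Q y i * 2 ^ i) u s k := by
  induction k with
  | zero => rfl
  | succ k ih =>
    simp only [alternating, ← ih, Finset.mul_sum, ← Finset.sum_add_distrib]
    exact Finset.sum_congr rfl fun i _ => by ring

theorem abs_alternating_le {P : ℕ → ℤ} {u : ℕ} (hP : ∀ y ≤ u, |P y| ≤ u) (s k : ℕ) :
    |alternating P u s k| ≤ u + 2 * u * k := by
  induction k with
  | zero => simpa [alternating] using hP u le_rfl
  | succ k ih =>
    rw [alternating]
    refine (abs_add_le _ _).trans ?_
    rw [abs_mul, abs_mul, abs_pow, abs_neg, abs_one, one_pow]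
    have := hP (u - (k + 1) * s) (by omega)
    simp only [Nat.abs_ofNat]
    push_cast
    linarith

/-- The `i`-th digits of the first `y` subset counts, added up. -/
def prefixDigit (S : Finset ℕ) (y i : ℕ) : ℤ :=
  ∑ x ∈ Finset.range y, (((subsetSumCount S x).testBit i).toNat : ℤ)

theorem prefixDigit_nonneg_le (S : Finset ℕ) (y i : ℕ) :
    0 ≤ prefixDigit S y i ∧ prefixDigit S y i ≤ y := by
  constructor
  · exact Finset.sum_nonneg fun _ _ => by positivity
  · calc prefixDigit S y i ≤ ∑ x ∈ Finset.range y, (1 : ℤ) := Finset.sum_le_sum fun x _ => by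
          exact_mod_cast Bool.toNat_le _
      _ = y := by simp

theorem sum_prefixDigit {S : Finset ℕ} {u p y : ℕ} (h : ∀ x ≤ u, subsetSumCount S x < 2 ^ p)
    (hy : y ≤ u + 1) :
    ∑ i ∈ Finset.range p, prefixDigit S y i * 2 ^ i = countBelow S y := by
  simp only [prefixDigit, Finset.sum_mul]
  rw [Finset.sum_comm, countBelow_eq_sum]
  push_cast
  refine Finset.sum_congr rfl fun x hx => ?_
  rw [sum_testBit_mul, Nat.mod_eq_of_lt (h x (by have := Finset.mem_range.1 hx; omega))]

/-- The signed digits of the number of swings. -/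
def swingDigit (S : Finset ℕ) (u p s k i : ℕ) : ℤ :=
  if i < p then alternating (fun y => prefixDigit S y i) u s k else 0

theorem abs_swingDigit_le (S : Finset ℕ) (u p s i : ℕ) :
    |swingDigit S u p s ((u - 1) / s) i| ≤ 2 * (u + 1) * (u + 1) := by
  rw [swingDigit]
  split_ifs
  · refine (abs_alternating_le (fun y hy => ?_) _ _).trans ?_
    · have := prefixDigit_nonneg_le S y i
      rw [abs_of_nonneg this.1]
      exact this.2.trans (by exact_mod_cast hy)
    · have : (u - 1) / s ≤ u := (Nat.div_le_self _ _).trans (Nat.sub_le _ _)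
      have : (((u - 1) / s : ℕ) : ℤ) ≤ u := by exact_mod_cast this
      nlinarith
  · simp; positivity

theorem sum_swingDigit {S : Finset ℕ} {u p s L : ℕ} (hs : s ∈ S) (h0 : 0 < s)
    (h : ∀ x ≤ u, subsetSumCount S x < 2 ^ p) (hL : p ≤ L) :
    ∑ i ∈ Finset.range L, swingDigit S u p s ((u - 1) / s) i * 2 ^ i = swingCount S u s := by
  have e1 : ∑ i ∈ Finset.range L, swingDigit S u p s ((u - 1) / s) i * 2 ^ i =
      ∑ i ∈ Finset.range p, alternating (fun y => prefixDigit S y i) u s ((u - 1) / s) * 2 ^ i := by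
    rw [← Finset.sum_subset (Finset.range_subset_range.2 hL)]
    · refine Finset.sum_congr rfl fun i hi => ?_
      rw [swingDigit, if_pos (Finset.mem_range.1 hi)]
    · intro i _ hi
      rw [swingDigit, if_neg (by simpa using hi), zero_mul]
  have key : ∀ k, alternating (fun y => ∑ i ∈ Finset.range p, prefixDigit S y i * 2 ^ i) u s k =
      alternating (fun y => countBelow S y) u s k := by
    intro k
    induction k with
    | zero => exact sum_prefixDigit h (by omega)
    | succ k ih => rw [alternating, alternating, ih, sum_prefixDigit h (by omega)]
  rw [e1, sum_alternating_mul, key, swingCount_eq_alternating hs h0]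

theorem countBelow_le {S : Finset ℕ} {u p : ℕ} (h : ∀ x ≤ u, subsetSumCount S x < 2 ^ p) :
    countBelow S u ≤ u * 2 ^ p := by
  rw [countBelow_eq_sum]
  calc _ ≤ ∑ _x ∈ Finset.range u, 2 ^ p := Finset.sum_le_sum fun x hx =>
        (h x (Finset.mem_range.1 hx).le).le
    _ = u * 2 ^ p := by simp

end WordRAM

namespace WordRAM

/-! ### The numbers of swings -/

/-- Compute the sums of digits at the address in register `16`, set the length of the output rows,
the register `17`, the addresses of the work space, the register `18`, and of the output, the
register `19`, and a bound for the signed digits, the register `11`. -/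
def prepareSwings : Cmd :=
  16 ::= .reg 2 + .reg 3 * .reg 4 ;;
  .fill 40 (.reg 16) (.reg 3) 0 ;;
  .fill 40 (.reg 16 + .reg 3) (.reg 1 * .reg 3) (.load (.reg 16 + .reg 40) +
    .load (.reg 2 + .reg 40)) ;;
  doubleUpTo 12 2 (.reg 0 * .reg 1 + 1) ;;
  17 ::= .reg 3 + (.reg 41 + 1) ;;
  18 ::= .reg 16 + .reg 3 * .reg 4 ;;
  19 ::= .reg 18 + 3 * .reg 17 + 1 ;;
  11 ::= 2 * .reg 4 * .reg 4 * (.reg 0 + 1) ;;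
  .fill 40 (.reg 18 + .reg 17) (.reg 17) 0

/-- The state in the computation of the numbers of swings, with the sums of digits of length `p` at
the address `A`, and with output rows of length `L`. -/
structure HoldsPrefix (S : Finset ℕ) (l : List ℕ) (u p L A : ℕ) (s : ZState) : Prop where
  r0 : s.reg 0 = l.length
  r1 : s.reg 1 = u
  r3 : s.reg 3 = p
  r11 : s.reg 11 = (2 * (u + 1) * (u + 1) * (l.length + 1) : ℕ)
  r16 : s.reg 16 = A
  r17 : s.reg 17 = L
  r18 : s.reg 18 = (A + p * (u + 1) : ℕ)
  r19 : s.reg 19 = (A + p * (u + 1) + 3 * L + 1 : ℕ)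
  input : HoldsInput s.mem l
  digits : ∀ y ≤ u, ∀ i < p, s.mem (A + (y * p + i : ℕ)) = prefixDigit S y i

theorem HoldsPrefix.congr {S : Finset ℕ} {l : List ℕ} {u p L A : ℕ} {s s' : ZState}
    (h : HoldsPrefix S l u p L A s) (hl : l.length ≤ A)
    (hr : ∀ r, r < 6 ∨ r = 11 ∨ r = 16 ∨ r = 17 ∨ r = 18 ∨ r = 19 → s'.reg r = s.reg r)
    (hm : ∀ a < ((A + p * (u + 1) : ℕ) : ℤ), s'.mem a = s.mem a) : HoldsPrefix S l u p L A s' where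
  r0 := by rw [hr 0 (by omega), h.r0]
  r1 := by rw [hr 1 (by omega), h.r1]
  r3 := by rw [hr 3 (by omega), h.r3]
  r11 := by rw [hr 11 (by omega), h.r11]
  r16 := by rw [hr 16 (by omega), h.r16]
  r17 := by rw [hr 17 (by omega), h.r17]
  r18 := by rw [hr 18 (by omega), h.r18]
  r19 := by rw [hr 19 (by omega), h.r19]
  input j hj := by
    rw [hm _ (by push_cast; nlinarith), h.input j hj]
  digits y hy i hi := by
    rw [hm _ _, h.digits y hy i hi]
    have := row_lt (show y < u + 1 by omega) hi
    rw [mul_comm (u + 1)] at this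
    push_cast at this ⊢
    exact_mod_cast Nat.add_lt_add_left this A

/-- The work space behind the V cells of prefix sums has L cells for the digits of one voter, L for
the running total and L + 1 for carries; then comes the output. Since 2 · 2^r exceeds n u, the row
length L = p + r + 1 leaves room for the sum of all swing numbers. -/
theorem runs_prepareSwings {w u q r : ℕ} {S : Finset ℕ} {l : List ℕ} {s : ZState} (hw : 0 < w)
    (h : HoldsCounts S l u q s) (h1 : l.length * u + 1 ≤ 2 * 2 ^ r)
    (h2 : ∀ i < r, 2 * 2 ^ i < l.length * u + 1)
    (hwb : ((l.length + 2 ^ q + 2 * (2 ^ q * (u + 1)) + 2 * (2 ^ q + (r + 1)) + 2 * 2 ^ r +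
      2 ^ q * (u + 1) : ℕ) : ℤ) < 2 ^ w) :
    Runs w prepareSwings s (100 * (2 ^ q * (u + 1)) + 100 * (r + 1)) fun s' =>
      HoldsPrefix S l u (2 ^ q) (2 ^ q + (r + 1)) (l.length + 2 ^ q + 2 ^ q * (u + 1)) s' ∧
      ∀ i < 2 ^ q + (r + 1), s'.mem ((l.length + 2 ^ q + 2 * (2 ^ q * (u + 1)) +
        (2 ^ q + (r + 1)) : ℕ) + (i : ℕ)) = 0 := by
  obtain ⟨k0, k1, k2, k3, k4, hin, -, hcount⟩ := h
  obtain ⟨p, hp⟩ : ∃ p, p = 2 ^ q := ⟨_, rfl⟩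
  have hp1 : 1 ≤ p := hp ▸ Nat.one_le_two_pow
  rw [← hp] at k2 k3 hcount hwb ⊢
  obtain ⟨V, hV⟩ : ∃ V, V = p * (u + 1) := ⟨_, rfl⟩
  obtain ⟨A, hA⟩ : ∃ A, A = l.length + p + V := ⟨_, rfl⟩
  obtain ⟨L, hL⟩ : ∃ L, L = p + (r + 1) := ⟨_, rfl⟩
  obtain ⟨T, hT⟩ : ∃ T, T = 2 ^ r := ⟨_, rfl⟩
  have hVp : V = u * p + p := by rw [hV]; ring
  rw [← hV, ← hL, ← hT] at hwb
  rw [← hV, ← hL]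
  rw [← hA]
  have eU : (p : ℤ) * ((u : ℤ) + 1) = V := by rw [hV]; push_cast; ring
  have eu : (u : ℤ) * p = (u * p : ℕ) := by push_cast; ring
  refine Runs.mono (Runs.assign_seq (by simp) <|
    Runs.seq (P := fun s' => (∀ r, r ≠ 40 → r ≠ 16 → s'.reg r = s.reg r) ∧ s'.reg 16 = A ∧
        (∀ a < (A : ℤ), s'.mem a = s.mem a) ∧ ∀ i < p, s'.mem (A + (i : ℕ)) = 0)
      (Runs.fill hw p A (fun _ => 0) ?_ ?_ ?_ ?_ ?_ ?_ ?_ ?_) fun s₁ h₁ =>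
    Runs.seq (P := fun s' => (∀ r, r ≠ 40 → r ≠ 16 → s'.reg r = s.reg r) ∧ s'.reg 16 = A ∧
        (∀ a < (A : ℤ), s'.mem a = s.mem a) ∧
        ∀ y ≤ u, ∀ i < p, s'.mem (A + (y * p + i : ℕ)) = prefixDigit S y i)
      (Runs.fill hw (u * p) (A + p : ℕ) (fun k => prefixDigit S (k / p + 1) (k % p))
        ?_ ?_ ?_ ?_ ?_ ?_ ?_ ?_) fun s₂ h₂ =>
    Runs.seq (runs_doubleUpTo (b := 2) (n := l.length * u + 1) (r := r) hw (by norm_num) h1 h2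
      (by simp) (by simp [h₂.1, k0, k1]) (by simp) (by simp) ?_ ?_) fun s₃ h₃ =>
    Runs.assign_seq (by simp) <| Runs.assign_seq (by simp) <| Runs.assign_seq (by simp) <|
    Runs.assign_seq (by simp) <| Runs.fill hw L (A + V + L : ℕ) (fun _ => 0)
      (Q := fun s' => HoldsPrefix S l u p L A s' ∧
        ∀ i < L, s'.mem ((l.length + p + 2 * V + L : ℕ) + (i : ℕ)) = 0)
      ?_ ?_ ?_ ?_ ?_ ?_ ?_ ?_) ?_ fun s' h => h
  · simp
  · simp
  · simp [k2, k3, k4, eU, hA]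
  · simp [k3]
  · positivity
  · push_cast at hwb; omega
  · intro k _ M _ _
    simp
  · intro M hM1 hM2
    refine ⟨fun r h1 h2 => by simp [h1, h2], by simp [k2, k3, k4, eU, hA], fun a ha => ?_, hM1⟩
    exact hM2 a (.inl ha)
  · simp
  · simp
  · simp [h₁.1, h₁.2.1, k3]
  · simp [h₁.1, k1, k3]
  · positivity
  · push_cast at hwb; push_cast; omega
  -- Row y + 1 of the prefix sums is row y plus row y of the counts. The cell of row y was zeroed
  -- beforehand if y = 0, and otherwise was written earlier in the same loop.
  · intro k hk M hM1 hM2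
    obtain ⟨g1, g2, g3, g4⟩ := h₁
    have hmod : k % p < p := Nat.mod_lt _ (by omega)
    have hdiv : k / p < u := Nat.div_lt_of_lt_mul (by rwa [mul_comm])
    have hk' := Nat.div_add_mod k p
    have e1 : M (A + (k : ℕ)) = prefixDigit S (k / p) (k % p) := by
      rcases lt_or_ge k p with hkp | hkp
      · rw [hM2 _ (by left; push_cast; omega)]
        simp [g4 k hkp, Nat.div_eq_of_lt hkp, prefixDigit]
      · obtain ⟨k, rfl⟩ : ∃ k', k = k' + p := ⟨k - p, by omega⟩
        rw [Nat.add_mod_right, Nat.add_div_right _ (by omega), ← hM1 k (by omega)]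
        congr 1; push_cast; ring
    have e2 : M ((l.length + p : ℕ) + (k : ℕ)) =
        ((subsetSumCount S (k / p)).testBit (k % p)).toNat := by
      rw [hM2 _ (by left; push_cast; omega)]
      rw [g3 _ (by push_cast; omega), ← hcount _ hdiv.le _ hmod]
      congr 2
      rw [mul_comm, hk']
    have w1 : InWord w ((A : ℤ) + k) := ⟨by positivity, by push_cast at hwb; omega⟩
    have w2 : InWord w ((l.length : ℤ) + p + k) := ⟨by positivity, by push_cast at hwb; omega⟩
    push_cast at e2
    constructor
    · simp [g1, g2, k2, w1, w2]
    · simp [g1, g2, k2, e1, e2, prefixDigit, Finset.sum_range_succ]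
  · intro M hM1 hM2
    obtain ⟨g1, g2, g3, g4⟩ := h₁
    refine ⟨fun r h1 h2 => by simp [h1, g1 r h1 h2], by simp [g2], fun a ha => ?_,
      fun y hy i hi => ?_⟩
    · change M a = _
      rw [hM2 a (by left; push_cast; omega)]
      exact g3 a ha
    · change M _ = _
      rcases y with _ | y
      · rw [hM2 _ (by left; push_cast; omega)]
        simpa [prefixDigit] using g4 i hi
      · have hlt : y * p + i < u * p := by
          calc y * p + i < (y + 1) * p := by rw [add_mul]; omega
            _ ≤ u * p := Nat.mul_le_mul_right _ hy
        have := hM1 (y * p + i) hlt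
        rw [Nat.mul_add_mod_of_lt hi, mul_comm y, Nat.mul_add_div (by omega),
          Nat.div_eq_of_lt hi, add_zero] at this
        rw [← this]
        congr 1; push_cast; ring
  · rw [← hT] at h1; zify at h1 ⊢; push_cast at hwb; omega
  · rw [← hT]; zify; push_cast at hwb; omega
  · simp
  · simp
  · obtain ⟨g1, g2, g3, g4⟩ := h₂
    obtain ⟨f1, f2, f3, f4⟩ := h₃
    simp [f1, f4, g1, g2, k3, k4, eU]
    rw [hL]; push_cast; ring
  · obtain ⟨f1, f2, f3, f4⟩ := h₃
    simp [f1, f4, h₂.1, k3, hL]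
  · positivity
  · push_cast at hwb; push_cast; omega
  · intro k _ M _ _
    simp
  · obtain ⟨g1, g2, g3, g4⟩ := h₂
    obtain ⟨f1, f2, f3, f4⟩ := h₃
    intro M hM1 hM2
    refine ⟨⟨?_, ?_, ?_, ?_, ?_, ?_, ?_, ?_, ?_, ?_⟩, ?_⟩
    · simp [f1, g1, k0]
    · simp [f1, g1, k1]
    · simp [f1, g1, k3]
    · simp [f1, g1, k0, k4]
    · simp [f1, g2]
    · simp [f1, f4, g1, k3, hL]
    · simp [f1, g1, g2, k3, k4]
    · simp [f1, f4, g1, g2, k3, k4, hL]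
    · intro j hj
      change M j = _
      rw [hM2 _ (by left; push_cast; omega)]
      simp only [ZState.set_mem, f2]
      rw [g3 _ (by omega), hin j hj]
    · intro y hy i hi
      have hlt : y * p + i < V := by
        rw [hV, mul_comm p]
        exact row_lt (by omega) hi
      change M _ = _
      rw [hM2 _ (by left; push_cast; omega)]
      simp only [ZState.set_mem, f2]
      exact g4 y hy i hi
    · intro i hi
      change M _ = _
      rw [← hM1 i hi, hA]
      congr 1; push_cast; ring
  · have : p ≤ V := by omega
    simp
    omega

end WordRAM

/-! ### The signed digits of the swing number of one voter -/

namespace WordRAM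

/-- Compute the signed digits of the number of swings of the voter whose number is in register
`6`. -/
def sumSwings : Cmd :=
  8 ::= .load (.reg 6) ;; 9 ::= .reg 1 ;; 10 ::= 0 - 2 ;;
  .fill 40 (.reg 18) (.reg 17) (.load (.reg 16 + .reg 1 * .reg 3 + .reg 40) *
    .less (.reg 40) (.reg 3)) ;;
  .loop (.less (.reg 8) (.reg 9)) (
    9 ::= .reg 9 - .reg 8 ;;
    .fill 40 (.reg 18) (.reg 3) (.load (.reg 18 + .reg 40) +
      .reg 10 * .load (.reg 16 + .reg 9 * .reg 3 + .reg 40)) ;;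
    10 ::= 0 - .reg 10)

/-- Register 9 descends through u, u - x, u - 2x, … and register 10 alternates between -2 and 2.
Each further term touches only p digits, because the prefix sums vanish beyond them in `swingDigit`.
-/
theorem runs_sumSwings {w u p L A v x : ℕ} {S : Finset ℕ} {l : List ℕ} {s : ZState} (hw : 0 < w)
    (h : HoldsPrefix S l u p L A s) (hl : l.length ≤ A) (hp : p ≤ L) (hv : v < l.length)
    (hx : l.getD v 0 = x) (hx0 : 0 < x) (hxw : x < 2 ^ w) (h6 : s.reg 6 = v)
    (hwb : ((A + p * (u + 1) + u + L : ℕ) : ℤ) < 2 ^ w) :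
    Runs w sumSwings s (60 * (L + 1) + (u - 1) / x * (60 * (p + 1))) fun s' =>
      (∀ r, r ≠ 8 → r ≠ 9 → r ≠ 10 → r ≠ 40 → s'.reg r = s.reg r) ∧
      (∀ a, a < ((A + p * (u + 1) : ℕ) : ℤ) ∨ ((A + p * (u + 1) + L : ℕ) : ℤ) ≤ a →
        s'.mem a = s.mem a) ∧
      ∀ i < L, s'.mem ((A + p * (u + 1) : ℕ) + (i : ℕ)) = swingDigit S u p x ((u - 1) / x) i := by
  obtain ⟨k0, k1, k3, k11, k16, k17, k18, k19, hin, hdig⟩ := h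
  obtain ⟨V, hV⟩ : ∃ V, V = p * (u + 1) := ⟨_, rfl⟩
  obtain ⟨K, hK⟩ : ∃ K, K = (u - 1) / x := ⟨_, rfl⟩
  have hVp : V = u * p + p := by rw [hV]; ring
  rw [← hV] at k18 k19 hwb ⊢
  rw [← hK]
  -- Another pass is made as long as x < u - k x, that is (k + 1) x ≤ u - 1, so there are exactly K
  -- passes. The argument 0, where the count vanishes, is never reached.
  have hKlt : ∀ k < K, (k + 1) * x ≤ u - 1 := fun k hk =>
    (Nat.le_div_iff_mul_le hx0).1 (hK ▸ hk)
  have hKge : u ≤ K * x + x := by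
    have := Nat.lt_mul_div_succ (u - 1) hx0
    rw [← hK, mul_comm] at this
    rw [add_mul] at this
    omega
  have hrow : ∀ y ≤ u, y * p ≤ u * p := fun y hy => Nat.mul_le_mul_right _ hy
  have hword : ∀ y ≤ u, ∀ i < L, InWord w ((A : ℤ) + (y * p : ℕ) + i) := fun y hy i hi => by
    have := hrow y hy
    exact ⟨by positivity, by push_cast at hwb; omega⟩
  have hdig' : ∀ y ≤ u, ∀ i < p, s.mem ((A : ℤ) + (y * p : ℕ) + i) = prefixDigit S y i := by
    intro y hy i hi
    rw [← hdig y hy i hi]; congr 1; push_cast; ring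
  refine Runs.mono (Runs.assign_seq ?_ <| Runs.assign_seq (by simp) <| Runs.assign_seq (by simp) <|
    Runs.seq (P := fun s' => (∀ r, r ≠ 8 → r ≠ 9 → r ≠ 10 → r ≠ 40 → s'.reg r = s.reg r) ∧
      s'.reg 8 = x ∧ s'.reg 9 = u ∧ s'.reg 10 = -2 ∧
      (∀ a, a < ((A + V : ℕ) : ℤ) ∨ ((A + V + L : ℕ) : ℤ) ≤ a → s'.mem a = s.mem a) ∧
      ∀ i < L, s'.mem ((A + V : ℕ) + (i : ℕ)) = swingDigit S u p x 0 i)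
    (Runs.fill hw L (A + V : ℕ) (swingDigit S u p x 0) ?_ ?_ ?_ ?_ ?_ ?_ ?_ ?_) fun s₁ h₁ =>
    Runs.loop hw K (fun _ => 40 * (p + 1)) (fun k s' =>
      (∀ r, r ≠ 8 → r ≠ 9 → r ≠ 10 → r ≠ 40 → s'.reg r = s.reg r) ∧
      s'.reg 8 = x ∧ s'.reg 9 = (u - k * x : ℕ) ∧ s'.reg 10 = 2 * (-1) ^ (k + 1) ∧
      (∀ a, a < ((A + V : ℕ) : ℤ) ∨ ((A + V + L : ℕ) : ℤ) ≤ a → s'.mem a = s.mem a) ∧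
      ∀ i < L, s'.mem ((A + V : ℕ) + (i : ℕ)) = swingDigit S u p x k i) ?_ ?_ ?_ ?_ ?_)
    ?_ fun s' h => h
  · simp [h6, InWord]; omega
  · simp
  · simp
  · simp [k18]
  · simp [k17]
  · positivity
  · push_cast at hwb ⊢; omega
  · intro i hi M hM1 hM2
    have w0 := hword u le_rfl i hi
    have w1 : InWord w (i : ℤ) := ⟨by positivity, by push_cast at hwb; omega⟩
    have w2 : InWord w (p : ℤ) := ⟨by positivity, by push_cast at hwb; omega⟩
    push_cast at w0
    constructor
    · simp [k16, k1, k3, w0, w1, w2]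
    · by_cases hip : i < p
      · have := hM2 ((A : ℤ) + (u * p : ℕ) + i) (by push_cast; left; zify at hVp; omega)
        simp only [ZState.set_mem] at this
        rw [hdig' u le_rfl i hip] at this
        push_cast at this
        simp [k16, k1, k3, hip, this, swingDigit, alternating]
      · simp [k3, hip, swingDigit]
  · intro M hM1 hM2
    refine ⟨fun r h1 h2 h3 h4 => by simp [h1, h2, h3, h4], ?_, ?_, ?_, ?_, hM1⟩
    · simpa [h6, hin v hv] using hx
    · simp [k1]
    · simp
    · intro a ha
      exact hM2 a (by push_cast at ha ⊢; exact ha)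
  · obtain ⟨g1, g2, g3, g4, g5, g6⟩ := h₁
    exact ⟨g1, g2, by simpa using g3, by simpa using g4, g5, g6⟩
  · rintro k hk s' ⟨g1, g2, g3, g4, g5, g6⟩
    have w1 : InWord w (x : ℤ) := ⟨by positivity, by exact_mod_cast hxw⟩
    have w2 : InWord w ((u - k * x : ℕ) : ℤ) := ⟨by positivity, by push_cast at hwb; omega⟩
    rw [Expr.ok_less, Expr.evalZ_reg, Expr.evalZ_reg, g2, g3]
    exact ⟨trivial, trivial, w1, w2⟩
  · rintro k hk s' ⟨g1, g2, g3, g4, g5, g6⟩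
    rw [Expr.evalZ_reg, Expr.evalZ_reg, g2, g3]
    have := hKlt k hk
    rw [add_mul] at this
    omega
  · rintro s' ⟨g1, g2, g3, g4, g5, g6⟩
    rw [Expr.evalZ_reg, Expr.evalZ_reg, g2, g3]
    exact ⟨by omega, g1, g5, g6⟩
  · rintro k hk s' ⟨g1, g2, g3, g4, g5, g6⟩
    have hkx := hKlt k hk
    have hkx' : (k + 1) * x = k * x + x := by ring
    have e9 : ((u - k * x : ℕ) : ℤ) - x = (u - (k + 1) * x : ℕ) := by
      have := hKlt k hk
      omega
    obtain ⟨y, hy⟩ : ∃ y, y = u - (k + 1) * x := ⟨_, rfl⟩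
    have hyu : y ≤ u := by omega
    rw [← hy] at e9
    have hyp := hrow y hyu
    refine Runs.mono (Runs.assign_seq (by simp) <|
      Runs.seq (P := fun s' => (∀ r, r ≠ 8 → r ≠ 9 → r ≠ 10 → r ≠ 40 → s'.reg r = s.reg r) ∧
        s'.reg 8 = x ∧ s'.reg 9 = y ∧ s'.reg 10 = 2 * (-1) ^ (k + 1) ∧
        (∀ a, a < ((A + V : ℕ) : ℤ) ∨ ((A + V + L : ℕ) : ℤ) ≤ a → s'.mem a = s.mem a) ∧
        ∀ i < L, s'.mem ((A + V : ℕ) + (i : ℕ)) = swingDigit S u p x (k + 1) i)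
      (Runs.fill hw p (A + V : ℕ) (swingDigit S u p x (k + 1)) ?_ ?_ ?_ ?_ ?_ ?_ ?_ ?_) fun s₂ h₂ =>
      Runs.assign (Q := fun s' => (∀ r, r ≠ 8 → r ≠ 9 → r ≠ 10 → r ≠ 40 → s'.reg r = s.reg r) ∧
        s'.reg 8 = x ∧ s'.reg 9 = (u - (k + 1) * x : ℕ) ∧ s'.reg 10 = 2 * (-1) ^ (k + 1 + 1) ∧
        (∀ a, a < ((A + V : ℕ) : ℤ) ∨ ((A + V + L : ℕ) : ℤ) ≤ a → s'.mem a = s.mem a) ∧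
        ∀ i < L, s'.mem ((A + V : ℕ) + (i : ℕ)) = swingDigit S u p x (k + 1) i) (by simp) ?_)
      ?_ fun s' h => h
    · simp
    · simp
    · simp [g1, k18]
    · simp [g1, k3]
    · positivity
    · push_cast at hwb ⊢; omega
    · intro i hi M hM1 hM2
      have w0 := hword y hyu i (by omega)
      have w1 : InWord w ((A : ℤ) + V + i) := ⟨by positivity, by push_cast at hwb; omega⟩
      have m1 : M ((A : ℤ) + V + i) = swingDigit S u p x k i := by
        rw [hM2 _ (by right; push_cast; omega)]
        simpa using g6 i (by omega)
      have m2 : M ((A : ℤ) + (y * p : ℕ) + i) = prefixDigit S y i := by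
        rw [hM2 _ (by left; push_cast; zify at hVp hyp; omega)]
        simp only [ZState.set_mem]
        rw [g5 _ (by left; push_cast; zify at hVp hyp; omega), hdig' y hyu i hi]
      push_cast at w0 m2
      constructor
      · simp [g1, k16, k18, k3, g2, g3, e9, w0, w1]
      · simp [g1, k16, k18, k3, g2, g3, g4, e9, m1, m2, swingDigit, hi, alternating, ← hy]
    · intro M hM1 hM2
      refine ⟨fun r h1 h2 h3 h4 => by simp [h2, h4, g1 r h1 h2 h3 h4], by simp [g2],
        by simp [g2, g3, e9], by simp [g4], fun a ha => ?_, fun i hi => ?_⟩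
      · change M a = _
        rw [hM2 a (by push_cast at ha ⊢; omega)]
        exact g5 a ha
      · rcases lt_or_ge i p with hip | hip
        · exact hM1 i hip
        · change M _ = _
          rw [hM2 _ (by right; push_cast; omega)]
          simp only [ZState.set_mem]
          rw [g6 i hi, swingDigit, swingDigit, if_neg (by omega), if_neg (by omega)]
    · obtain ⟨f1, f2, f3, f4, f5, f6⟩ := h₂
      refine ⟨fun r h1 h2 h3 h4 => by simp [h3, f1 r h1 h2 h3 h4], by simp [f2], by simp [f3, hy],
        ?_, f5, f6⟩
      simp [f4]; ring
    · simp; omega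
  · simp
    ring_nf
    omega

end WordRAM

/-! ### Binary output for one voter and the running total -/

namespace WordRAM

/-- Write the number of swings of the voter whose number is in register `6` to the row with this
number, and add its signed digits to the total. -/
def writeSwings : Cmd :=
  sumSwings ;;
  .fill 40 (.reg 18 + .reg 17) (.reg 17) (.load (.reg 18 + .reg 17 + .reg 40) +
    .load (.reg 18 + .reg 40)) ;;
  25 ::= .reg 18 ;; 26 ::= .reg 19 + .reg 6 * .reg 17 ;; 27 ::= .reg 17 ;;
  28 ::= .reg 18 + 2 * .reg 17 ;; 29 ::= .reg 11 ;; normalize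

/-- The digits are added to the total in their signed form, so the total needs only one propagation
of carries, at the very end. The rows of earlier voters lie below the row that is written and
survive. -/
theorem runs_writeSwings {w u p L A v x : ℕ} {S : Finset ℕ} {l : List ℕ} {s : ZState} (hw : 0 < w)
    (hcount : ∀ x ≤ u, subsetSumCount S x < 2 ^ p) (h : HoldsPrefix S l u p L A s)
    (hl : l.length ≤ A) (hp : p ≤ L) (hv : v < l.length)
    (hx : l.getD v 0 = x) (hxS : x ∈ S) (hx0 : 0 < x) (hxw : x < 2 ^ w) (h6 : s.reg 6 = v)
    (hwb : ((A + p * (u + 1) + u + 3 * L + 1 + (l.length + 1) * L +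
      4 * (2 * (u + 1) * (u + 1) * (l.length + 1)) : ℕ) : ℤ) < 2 ^ w)
    {Z : ℕ → ℤ} (hZ : ∀ i < L, s.mem ((A + p * (u + 1) + L : ℕ) + (i : ℕ)) = Z i) :
    Runs w writeSwings s (170 * (L + 1) + (u - 1) / x * (60 * (p + 1))) fun s' =>
      HoldsPrefix S l u p L A s' ∧ s'.reg 6 = v ∧
      (∀ i < L, s'.mem ((A + p * (u + 1) + L : ℕ) + (i : ℕ)) =
        Z i + swingDigit S u p x ((u - 1) / x) i) ∧
      (∀ i < L, s'.mem ((A + p * (u + 1) + 3 * L + 1 + v * L : ℕ) + (i : ℕ)) =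
        ((swingCount S u x).testBit i).toNat) ∧
      ∀ a : ℤ, ((A + p * (u + 1) + 3 * L + 1 : ℕ) : ℤ) ≤ a →
        a < ((A + p * (u + 1) + 3 * L + 1 + v * L : ℕ) : ℤ) → s'.mem a = s.mem a := by
  obtain ⟨k0, k1, k3, k11, k16, k17, k18, k19, hin, hdig⟩ := id h
  obtain ⟨V, hV⟩ : ∃ V, V = p * (u + 1) := ⟨_, rfl⟩
  obtain ⟨B, hB⟩ : ∃ B, B = 2 * (u + 1) * (u + 1) * (l.length + 1) := ⟨_, rfl⟩
  have hB1 : 2 * (u + 1) * (u + 1) ≤ B := hB ▸ Nat.le_mul_of_pos_right _ (by omega)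
  have hB0 : 0 < B := hB ▸ by positivity
  have hvL : v * L + L ≤ (l.length + 1) * L := by
    calc v * L + L = (v + 1) * L := by ring
      _ ≤ (l.length + 1) * L := Nat.mul_le_mul_right _ (by omega)
  have hsum := sum_swingDigit hxS hx0 hcount hp
  have hmod : ∑ i ∈ Finset.range L, swingDigit S u p x ((u - 1) / x) i * 2 ^ i ≡
      (swingCount S u x : ℕ) [ZMOD 2 ^ L] := by rw [hsum]
  have hζB : ∀ i, |swingDigit S u p x ((u - 1) / x) i| ≤ B := fun i =>
    (abs_swingDigit_le S u p x i).trans (by exact_mod_cast hB1)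
  have hrun := runs_sumSwings hw h hl hp hv hx hx0 hxw h6 (lt_of_le_of_lt (by
    rw [← hV, ← hB]; exact_mod_cast (by omega : A + V + u + L ≤ A + V + u + 3 * L + 1 + (l.length + 1) * L + 4 * B)) hwb)
  rw [← hB, ← hV] at hwb
  rw [← hB] at k11
  rw [← hV] at k18 k19 hrun hZ ⊢
  generalize swingDigit S u p x ((u - 1) / x) = ζ at *
  push_cast at hwb
  zify at hvL
  have hvL0 : (0 : ℤ) ≤ v * L := by positivity
  generalize ((l.length : ℤ) + 1) * L = nL at *
  refine Runs.mono (Runs.seq hrun fun s₁ h₁ =>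
    Runs.seq (P := fun s' => (∀ r, r ≠ 8 → r ≠ 9 → r ≠ 10 → r ≠ 40 → s'.reg r = s.reg r) ∧
      (∀ a, a < ((A + V : ℕ) : ℤ) ∨ ((A + V + 2 * L : ℕ) : ℤ) ≤ a → s'.mem a = s.mem a) ∧
      (∀ i < L, s'.mem ((A + V : ℕ) + (i : ℕ)) = ζ i) ∧
      ∀ i < L, s'.mem ((A + V + L : ℕ) + (i : ℕ)) = Z i + ζ i)
    (Runs.fill hw L (A + V + L : ℕ) (fun i => Z i + ζ i) ?_ ?_ ?_ ?_ ?_ ?_ ?_ ?_) fun s₂ h₂ =>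
    Runs.assign_seq (by simp) <| Runs.assign_seq (by simp) <| Runs.assign_seq (by simp) <|
    Runs.assign_seq (by simp) <| Runs.assign_seq (by simp) <|
    Runs.mono (runs_normalize (zb := (A + V : ℕ)) (ob := (A + V + 3 * L + 1 + v * L : ℕ))
      (cb := (A + V + 2 * L : ℕ)) (B := B) hw L ζ
      ?_ ?_ ?_ ?_ ?_ ?_ ?_ ?_ ?_ ?_ ?_ ?_ ?_ ?_ ?_ ?_ ?_ ?_) le_rfl ?_)
    ?_ fun s' h => h
  · simp
  · simp
  · simp [h₁.1, k17, k18]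
  · simp [h₁.1, k17]
  · positivity
  · push_cast; omega
  · obtain ⟨g1, g2, g3⟩ := h₁
    intro i hi M hM1 hM2
    have w1 : InWord w ((A : ℤ) + V + L + i) := ⟨by positivity, by omega⟩
    have w2 : InWord w ((A : ℤ) + V + i) := ⟨by positivity, by omega⟩
    have m1 : M ((A : ℤ) + V + L + i) = Z i := by
      rw [hM2 _ (by right; push_cast; omega), g2 _ (by right; push_cast; omega)]
      simpa using hZ i hi
    have m2 : M ((A : ℤ) + V + i) = ζ i := by
      rw [hM2 _ (by left; push_cast; omega)]
      simpa using g3 i hi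
    constructor
    · simp [g1, k17, k18, w1, w2]
    · simp [g1, k17, k18, m1, m2]
  · obtain ⟨g1, g2, g3⟩ := h₁
    intro M hM1 hM2
    refine ⟨fun r h1 h2 h3 h4 => by simp [h4, g1 r h1 h2 h3 h4], fun a ha => ?_, fun i hi => ?_, hM1⟩
    · push_cast at ha
      change M a = _
      rw [hM2 a (by push_cast; omega), g2 a (by push_cast; omega)]
    · change M _ = _
      rw [hM2 _ (by push_cast; omega), g3 i hi]
  · simp [h₂.1, k18]
  · simp [h₂.1, k19, k17, h6]
  · simp [h₂.1, k17]
  · simp [h₂.1, k17, k18]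
  · simp [h₂.1, k11]
  · simpa using h₂.2.2.1
  · exact fun i _ => hζB i
  · exact_mod_cast hB0
  · omega
  · positivity
  · positivity
  · positivity
  · push_cast; omega
  · push_cast; omega
  · push_cast; omega
  · push_cast; omega
  · push_cast; omega
  · push_cast; omega
  · obtain ⟨g1, g2, g3, g4⟩ := h₂
    rintro s' ⟨f1, f2, f3⟩
    have hreg : ∀ r, r < 7 ∨ r = 11 ∨ r = 16 ∨ r = 17 ∨ r = 18 ∨ r = 19 → s'.reg r = s.reg r := by
      intro r hr
      rw [f1 r (by omega)]
      simp [show r ≠ 25 by omega, show r ≠ 26 by omega, show r ≠ 27 by omega,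
        show r ≠ 28 by omega, show r ≠ 29 by omega, g1 r (by omega) (by omega) (by omega) (by omega)]
    refine ⟨h.congr hl (fun r hr => hreg r (by omega)) fun a ha => ?_, ?_, fun i hi => ?_,
      fun i hi => ?_, fun a ha ha' => ?_⟩
    · rw [← hV] at ha
      rw [f2 a (by push_cast at ha ⊢; omega) (by push_cast at ha ⊢; omega)]
      exact g2 a (by left; exact ha)
    · rw [hreg 6 (by omega), h6]
    · rw [f2 _ (by push_cast; omega) (by push_cast; omega)]
      exact g4 i hi
    · rw [f3 i hi, ediv_emod_two_of_modEq hmod hi]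
    · push_cast at ha ha'
      rw [f2 _ (by push_cast; omega) (by push_cast; omega)]
      exact g2 a (by right; push_cast; omega)
  · simp
    omega

end WordRAM

/-! ### Output of all swing numbers and of their sum -/

namespace WordRAM

/-- The numbers of swings of the voters, followed by their sum. -/
def swingNumerator (S : Finset ℕ) (l : List ℕ) (u v : ℕ) : ℕ :=
  if v < l.length then swingCount S u (l.getD v 0)
  else ∑ v ∈ Finset.range l.length, swingCount S u (l.getD v 0)

/-- Write the numbers of swings of all voters and their sum. -/
def writeAllSwings : Cmd :=
  .forLoop 6 (.reg 0) writeSwings ;;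
  25 ::= .reg 18 + .reg 17 ;; 26 ::= .reg 19 + .reg 0 * .reg 17 ;; 27 ::= .reg 17 ;;
  28 ::= .reg 18 + 2 * .reg 17 ;; 29 ::= .reg 11 ;; normalize ;;
  0 ::= .reg 19 ;; 1 ::= .reg 17

theorem runs_writeAllSwings {w u p L A : ℕ} {S : Finset ℕ} {l : List ℕ} {s : ZState} (hw : 0 < w)
    (hcount : ∀ x ≤ u, subsetSumCount S x < 2 ^ p) (h : HoldsPrefix S l u p L A s)
    (hl : l.length ≤ A) (hp : p ≤ L) (hlS : ∀ x ∈ l, x ∈ S ∧ 0 < x ∧ x < 2 ^ w)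
    (hwb : ((A + p * (u + 1) + u + 3 * L + 1 + (l.length + 1) * L +
      4 * (2 * (u + 1) * (u + 1) * (l.length + 1)) : ℕ) : ℤ) < 2 ^ w)
    (hZ : ∀ i < L, s.mem ((A + p * (u + 1) + L : ℕ) + (i : ℕ)) = 0) :
    Runs w writeAllSwings s
      (∑ v ∈ Finset.range l.length, (u - 1) / l.getD v 0 * (60 * (p + 1)) +
        180 * ((l.length + 1) * (L + 1))) fun s' =>
      s'.reg 0 = (A + p * (u + 1) + 3 * L + 1 : ℕ) ∧ s'.reg 1 = L ∧
      ∀ v < l.length + 1, ∀ i < L, s'.mem ((A + p * (u + 1) + 3 * L + 1 : ℕ) + (v * L + i : ℕ)) =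
        ((swingNumerator S l u v).testBit i).toNat := by
  have hl' : ∀ v < l.length, l.getD v 0 ∈ S ∧ 0 < l.getD v 0 ∧ l.getD v 0 < 2 ^ w := fun v hv => by
    rw [List.getD_eq_getElem _ _ hv]; exact hlS _ (List.getElem_mem hv)
  set n := l.length with hn
  set ζ : ℕ → ℕ → ℤ := fun v => swingDigit S u p (l.getD v 0) ((u - 1) / l.getD v 0) with hζ
  obtain ⟨B, hB⟩ : ∃ B, B = 2 * (u + 1) * (u + 1) * (n + 1) := ⟨_, rfl⟩
  have hB0 : 0 < B := hB ▸ by positivity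
  -- The digits of the total are sums of n signed digits, which is why the common digit bound in
  -- register 11 carries the factor n + 1.
  have hζB : ∀ i, |∑ v ∈ Finset.range n, ζ v i| ≤ B := fun i => by
    refine (Finset.abs_sum_le_sum_abs _ _).trans ?_
    calc _ ≤ ∑ _v ∈ Finset.range n, (2 * (u + 1) * (u + 1) : ℤ) :=
          Finset.sum_le_sum fun v _ => abs_swingDigit_le S u p _ i
      _ = n * (2 * (u + 1) * (u + 1)) := by simp
      _ ≤ B := by rw [hB]; push_cast; nlinarith
  have hsum : ∑ i ∈ Finset.range L, (∑ v ∈ Finset.range n, ζ v i) * 2 ^ i =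
      (∑ v ∈ Finset.range n, swingCount S u (l.getD v 0) : ℕ) := by
    simp only [Finset.sum_mul]
    rw [Finset.sum_comm]
    push_cast
    refine Finset.sum_congr rfl fun v hv => ?_
    have := hl' v (Finset.mem_range.1 hv)
    exact sum_swingDigit this.1 this.2.1 hcount hp
  have hmod : ∑ i ∈ Finset.range L, (∑ v ∈ Finset.range n, ζ v i) * 2 ^ i ≡
      (∑ v ∈ Finset.range n, swingCount S u (l.getD v 0) : ℕ) [ZMOD 2 ^ L] := by rw [hsum]
  have hwb' := hwb
  obtain ⟨k0, k1, k3, k11, k16, k17, k18, k19, hin, hdig⟩ := id h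
  obtain ⟨V, hV⟩ : ∃ V, V = p * (u + 1) := ⟨_, rfl⟩
  rw [← hB, ← hV] at hwb'
  push_cast at hwb'
  have enL : ((n : ℤ) + 1) * L = n * L + L := by ring
  rw [enL] at hwb'
  have hnL0 : (0 : ℤ) ≤ n * L := by positivity
  refine Runs.mono (Runs.seq (P := fun s' => HoldsPrefix S l u p L A s' ∧
      (∀ i < L, s'.mem ((A + p * (u + 1) + L : ℕ) + (i : ℕ)) = ∑ v ∈ Finset.range n, ζ v i) ∧
      ∀ v < n, ∀ i < L, s'.mem ((A + p * (u + 1) + 3 * L + 1 + v * L : ℕ) + (i : ℕ)) =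
        ((swingCount S u (l.getD v 0)).testBit i).toNat)
    (Runs.forLoop hw n
      (fun v => 170 * (L + 1) + (u - 1) / l.getD v 0 * (60 * (p + 1)))
      (fun k s' => HoldsPrefix S l u p L A s' ∧
        (∀ i < L, s'.mem ((A + p * (u + 1) + L : ℕ) + (i : ℕ)) = ∑ v ∈ Finset.range k, ζ v i) ∧
        ∀ v < k, ∀ i < L, s'.mem ((A + p * (u + 1) + 3 * L + 1 + v * L : ℕ) + (i : ℕ)) =
          ((swingCount S u (l.getD v 0)).testBit i).toNat) ?_ ?_ ?_ ?_ ?_) fun s₁ h₁ =>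
    Runs.assign_seq (by simp) <| Runs.assign_seq (by simp) <| Runs.assign_seq (by simp) <|
    Runs.assign_seq (by simp) <| Runs.assign_seq (by simp) <|
    Runs.seq (runs_normalize (zb := (A + V + L : ℕ)) (ob := (A + V + 3 * L + 1 + n * L : ℕ))
      (cb := (A + V + 2 * L : ℕ)) (B := B) hw L (fun i => ∑ v ∈ Finset.range n, ζ v i)
      ?_ ?_ ?_ ?_ ?_ ?_ ?_ ?_ ?_ ?_ ?_ ?_ ?_ ?_ ?_ ?_ ?_ ?_) fun s₂ h₂ =>
    Runs.assign_seq (by simp) <| Runs.assign (Q := fun s' =>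
      s'.reg 0 = (A + p * (u + 1) + 3 * L + 1 : ℕ) ∧ s'.reg 1 = L ∧
      ∀ v < n + 1, ∀ i < L, s'.mem ((A + p * (u + 1) + 3 * L + 1 : ℕ) + (v * L + i : ℕ)) =
        ((swingNumerator S l u v).testBit i).toNat) (by simp) ?_)
    ?_ fun s' h => h
  · zify; omega
  · exact ⟨h.congr hl (fun r hr => by simp [show r ≠ 6 by omega]) fun a _ => rfl,
      by simpa using hZ, fun v hv => absurd hv (by omega)⟩
  · rintro k _ s' _ ⟨g1, -, -⟩
    exact ⟨by simp, g1.r0⟩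
  · rintro s' _ h
    exact h
  · rintro k hk s' hk6 ⟨g1, g2, g3⟩
    obtain ⟨x1, x2, x3⟩ := hl' k hk
    refine Runs.mono (runs_writeSwings hw hcount g1 hl hp hk rfl x1 x2 x3 hk6 hwb g2) le_rfl ?_
    rintro s'' ⟨f1, f2, f3, f4, f5⟩
    refine ⟨f2, f1.congr hl (fun r hr => by simp [show r ≠ 6 by omega]) fun a _ => rfl,
      fun i hi => ?_, fun v hv i hi => ?_⟩
    · simp only [ZState.set_mem]
      rw [f3 i hi, Finset.sum_range_succ]
    · simp only [ZState.set_mem]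
      rcases Nat.lt_succ_iff_lt_or_eq.1 hv with hv | rfl
      · have e : v * L + L ≤ k * L := by
          calc v * L + L = (v + 1) * L := by ring
            _ ≤ k * L := Nat.mul_le_mul_right _ hv
        rw [f5 _ (by push_cast; nlinarith) (by push_cast; zify at e; omega), g3 v hv i hi]
      · exact f4 i hi
  · simp [h₁.1.r17, h₁.1.r18, hV]
  · simp [h₁.1.r17, h₁.1.r19, h₁.1.r0, hV, ← hn]
  · simp [h₁.1.r17]
  · simp [h₁.1.r17, h₁.1.r18, hV]
  · simp [h₁.1.r11, hB, ← hn]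
  · intro i hi
    have := h₁.2.1 i hi
    rw [← hV] at this
    simpa using this
  · exact fun i _ => hζB i
  · exact_mod_cast hB0
  · omega
  · positivity
  · positivity
  · positivity
  · push_cast; omega
  · push_cast; omega
  · push_cast; omega
  · push_cast; omega
  · push_cast; omega
  · push_cast; omega
  · obtain ⟨g1, g2, g3⟩ := h₁
    obtain ⟨f1, f2, f3⟩ := h₂
    have e19 : s₂.reg 19 = (A + p * (u + 1) + 3 * L + 1 : ℕ) := by simp [f1, g1.r19]
    have e17 : s₂.reg 17 = L := by simp [f1, g1.r17]
    refine ⟨by simp [e19], by simp [e17], fun v hv i hi => ?_⟩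
    simp only [ZState.set_mem]
    rw [swingNumerator]
    split_ifs with hvn
    · have e : v * L + L ≤ n * L := by
        calc v * L + L = (v + 1) * L := by ring
          _ ≤ n * L := Nat.mul_le_mul_right _ hvn
      zify at e
      have e0 : (0 : ℤ) ≤ v * L := by positivity
      rw [← g3 v hvn i hi, ← hV, f2 _ (by push_cast; omega) (by push_cast; omega)]
      simp only [ZState.set_mem]
      congr 1; push_cast; ring
    · obtain rfl : v = n := by omega
      rw [← ediv_emod_two_of_modEq hmod hi, ← f3 i hi, ← hV]
      congr 1; push_cast; ring
  · rw [Finset.sum_add_distrib, Finset.sum_add_distrib, Finset.sum_add_distrib]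
    generalize ∑ v ∈ Finset.range n, (u - 1) / l.getD v 0 * (60 * (p + 1)) = Y
    simp
    ring_nf
    omega

end WordRAM

/-! ### Running time of the program for the Banzhaf indices -/

namespace WordRAM

theorem sum_getD {M : Type*} [AddCommMonoid M] (f : ℕ → M) (l : List ℕ) :
    ∑ v ∈ Finset.range l.length, f (l.getD v 0) = (l.map f).sum := by
  induction l with
  | nil => rfl
  | cons a l ih =>
    rw [List.length_cons, Finset.sum_range_succ', List.map_cons, List.sum_cons, ← ih, add_comm]
    simp

theorem sum_getD_eq_sum {M : Type*} [AddCommMonoid M] (f : ℕ → M) {S : Finset ℕ} {l : List ℕ}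
    (hl : l.Nodup) (hlS : l.toFinset = S) :
    ∑ v ∈ Finset.range l.length, f (l.getD v 0) = ∑ s ∈ S, f s := by
  rw [sum_getD, ← hlS, List.sum_toFinset _ hl]

/-- Weights above u contribute 0, and the others are distinct elements of {1, …, u}, so the sum is
at most u times a harmonic number. -/
theorem sum_div_le {S : Finset ℕ} (hS : ∀ s ∈ S, 0 < s) (u : ℕ) :
    ((∑ s ∈ S, (u - 1) / s : ℕ) : ℝ) ≤ u * (1 + Real.log u) := by
  have h1 : ∑ s ∈ S, (u - 1) / s ≤ ∑ s ∈ Finset.Icc 1 u, u / s := by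
    calc ∑ s ∈ S, (u - 1) / s = ∑ s ∈ S.filter (· ≤ u), (u - 1) / s := by
          refine (Finset.sum_subset (Finset.filter_subset _ _) fun s hs hsu => ?_).symm
          exact Nat.div_eq_of_lt (by simp [hs] at hsu; omega)
      _ ≤ ∑ s ∈ S.filter (· ≤ u), u / s :=
          Finset.sum_le_sum fun s _ => Nat.div_le_div_right (Nat.sub_le _ _)
      _ ≤ _ := Finset.sum_le_sum_of_subset fun s hs => by
          have := Finset.mem_filter.1 hs
          exact Finset.mem_Icc.2 ⟨hS s this.1, this.2⟩
  have h2 : ((∑ s ∈ Finset.Icc 1 u, u / s : ℕ) : ℝ) ≤ u * (harmonic u : ℝ) := by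
    rw [harmonic_eq_sum_Icc]
    push_cast
    rw [Finset.mul_sum]
    refine Finset.sum_le_sum fun s _ => ?_
    rw [← div_eq_mul_inv]
    exact Nat.cast_div_le
  calc _ ≤ ((∑ s ∈ Finset.Icc 1 u, u / s : ℕ) : ℝ) := by exact_mod_cast h1
    _ ≤ u * (harmonic u : ℝ) := h2
    _ ≤ _ := mul_le_mul_of_nonneg_left (harmonic_le_one_add_log u) (by positivity)

theorem sum_div_le_logFactor {S : Finset ℕ} (hS : ∀ s ∈ S, 0 < s) (u : ℕ) :
    ((∑ s ∈ S, (u - 1) / s : ℕ) : ℝ) ≤ 2 * (max (u : ℝ) 1 * logFactor ((S.card * u : ℕ) : ℝ)) := by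
  have hY := one_le_logFactor ((S.card * u : ℕ) : ℝ)
  have hB : (1 : ℝ) ≤ max (u : ℝ) 1 := le_max_right _ _
  rcases S.eq_empty_or_nonempty with rfl | hne
  · simp only [Finset.sum_empty, Nat.cast_zero]; positivity
  rcases Nat.eq_zero_or_pos u with rfl | hu
  · simp only [Nat.zero_sub, Nat.zero_div, Finset.sum_const_zero, Nat.cast_zero]; positivity
  refine (sum_div_le hS u).trans ?_
  have h1 : (1 : ℝ) ≤ u := by exact_mod_cast hu
  have hlog : Real.log u ≤ logFactor ((S.card * u : ℕ) : ℝ) := by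
    have e1 : Real.log u ≤ Real.logb 2 u := by
      rw [Real.logb, le_div_iff₀ (Real.log_pos (by norm_num))]
      have := Real.log_nonneg h1
      have h2 : Real.log 2 ≤ 1 := by
        have := Real.log_le_sub_one_of_pos (show (0 : ℝ) < 2 by norm_num)
        linarith
      nlinarith
    refine e1.trans ((logb_le_logFactor _).trans (logFactor_mono (by positivity) ?_))
    exact_mod_cast Nat.le_mul_of_pos_left u hne.card_pos
  rw [max_eq_left h1]
  have := mul_le_mul_of_nonneg_left (show 1 + Real.log u ≤ 2 * logFactor ((S.card * u : ℕ) : ℝ) by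
    linarith) (by positivity : (0 : ℝ) ≤ u)
  linarith

/-- The program for the Banzhaf indices. -/
def banzhafProgram : Cmd := countSubsets ;; prepareSwings ;; writeAllSwings

theorem mul_log_le_sq {n u q : ℕ} (h : ∀ i < q, 2 ^ i < n ∧ 2 ^ i < u) :
    (q : ℝ) * Nat.log 2 (4 * (2 ^ q * (u + 1))) ≤ 12 * logFactor ((n * u : ℕ) : ℝ) ^ 2 := by
  rcases eq_or_ne q 0 with rfl | hq
  · simp only [Nat.cast_zero, zero_mul]; positivity
  have h0 := h 0 (by omega)
  have hn : logFactor n ≤ logFactor ((n * u : ℕ) : ℝ) :=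
    logFactor_mono (by have : 0 < n := by omega
                       exact_mod_cast this)
      (by exact_mod_cast Nat.le_mul_of_pos_right n (by omega))
  have hu : logFactor u ≤ logFactor ((n * u : ℕ) : ℝ) :=
    logFactor_mono (by have : 0 < u := by omega
                       exact_mod_cast this)
      (by exact_mod_cast Nat.le_mul_of_pos_left u (by omega))
  have h1 := one_le_logFactor n
  refine (mul_log_le h).trans ?_
  rw [sq]
  exact mul_le_mul_of_nonneg_left (mul_le_mul hu hn (by linarith)
    ((by linarith [one_le_logFactor u] : (0 : ℝ) ≤ logFactor u).trans hu)) (by norm_num)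

/-- Both bounds on p = 2^q are needed: p ≤ 2 max(n, 1) where p multiplies the O(u log u) terms of
the alternating sums, and p ≤ 2 max(u, 1) where it is the length of the n + 1 output rows. -/
theorem banzhaf_time_le {u q r : ℕ} {S : Finset ℕ} (hS : ∀ s ∈ S, 0 < s)
    (h : ∀ i < q, 2 ^ i < S.card ∧ 2 ^ i < u) (hr : ∀ i < r, 2 * 2 ^ i < S.card * u + 1) :
    (((100 * (S.card + 1) + 300 * (2 ^ q * (u + 1)) +
      20010 * (q * (Nat.log 2 (4 * (2 ^ q * (u + 1))) * (2 ^ q * (u + 1))))) +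
      ((100 * (2 ^ q * (u + 1)) + 100 * (r + 1)) + ((∑ s ∈ S, (u - 1) / s) * (60 * (2 ^ q + 1)) +
        180 * ((S.card + 1) * (2 ^ q + (r + 1) + 1)))) : ℕ) : ℝ) ≤
    1010000 * (max (S.card : ℝ) 1 * max (u : ℝ) 1 * logFactor ((S.card * u : ℕ) : ℝ) ^ 2) := by
  have hY := one_le_logFactor ((S.card * u : ℕ) : ℝ)
  have hT := countSubsets_time_le h (one_le_pow₀ hY) (mul_log_le_sq h)
  have hsum := sum_div_le_logFactor hS u
  have hp1 : ((2 ^ q : ℕ) : ℝ) ≤ 2 * max (S.card : ℝ) 1 := by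
    have := two_pow_le_of_forall fun i hi => (h i hi).1
    exact_mod_cast this
  have hp2 : ((2 ^ q : ℕ) : ℝ) ≤ 2 * max (u : ℝ) 1 := by
    have := two_pow_le_of_forall fun i hi => (h i hi).2
    exact_mod_cast this
  have hr' : (r : ℝ) ≤ 2 * logFactor ((S.card * u : ℕ) : ℝ) :=
    le_two_mul_logFactor fun i hi => by
      have := hr i hi
      have := Nat.one_le_two_pow (n := i)
      omega
  have hA : (1 : ℝ) ≤ max (S.card : ℝ) 1 := le_max_right _ _
  have hB : (1 : ℝ) ≤ max (u : ℝ) 1 := le_max_right _ _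
  have hA' : (S.card : ℝ) ≤ max (S.card : ℝ) 1 := le_max_left _ _
  have hB' : (u : ℝ) ≤ max (u : ℝ) 1 := le_max_left _ _
  have hp0 : (1 : ℝ) ≤ ((2 ^ q : ℕ) : ℝ) := by exact_mod_cast Nat.one_le_two_pow
  rw [Nat.cast_add]
  generalize 100 * (S.card + 1) + 300 * (2 ^ q * (u + 1)) +
      20010 * (q * (Nat.log 2 (4 * (2 ^ q * (u + 1))) * (2 ^ q * (u + 1)))) = T at *
  generalize ∑ s ∈ S, (u - 1) / s = σ at *
  generalize logFactor ((S.card * u : ℕ) : ℝ) = Y at *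
  generalize 2 ^ q = p at *
  push_cast
  generalize max (S.card : ℝ) 1 = A at *
  generalize max (u : ℝ) 1 = B at *
  have hAB : 1 ≤ A * B := one_le_mul_of_one_le_of_one_le hA hB
  have hY2 : Y ≤ Y ^ 2 := le_self_pow₀ hY (by norm_num)
  have e1 : A * B ≤ A * B * Y ^ 2 := le_mul_of_one_le_right (by positivity) (hY.trans hY2)
  have e2 : A * B * Y ≤ A * B * Y ^ 2 := mul_le_mul_of_nonneg_left hY2 (by positivity)
  have e3 : Y ≤ A * B * Y := le_mul_of_one_le_left (by positivity) hAB
  have h1 : (p : ℝ) * (u + 1) ≤ 2 * A * (2 * B) :=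
    mul_le_mul hp1 (by linarith) (by positivity) (by positivity)
  have h2 : (σ : ℝ) * (60 * (p + 1)) ≤ 2 * (B * Y) * (60 * (4 * A)) :=
    mul_le_mul hsum (by linarith) (by positivity) (by positivity)
  have h3 : ((S.card : ℝ) + 1) * (p + (r + 1) + 1) ≤ 2 * A * (2 * B + 4 * Y) :=
    mul_le_mul (by linarith) (by linarith) (by positivity) (by positivity)
  have h4 : A * Y ≤ A * B * Y := by
    rw [mul_right_comm]; exact le_mul_of_one_le_right (by positivity) hB
  have e4 : 2 * (B * Y) * (60 * (4 * A)) = 480 * (A * B * Y) := by ring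
  have e5 : 2 * A * (2 * B + 4 * Y) = 4 * (A * B) + 8 * (A * Y) := by ring
  linarith

end WordRAM

/-! ### The program for the Banzhaf indices -/

namespace WordRAM

/-- A swing number is at most the number of coalitions of weight below u, hence at most u · 2^p. The
sum over all voters is at most n u 2^p, and n u < 2 · 2^r. -/
theorem swingNumerator_lt {S : Finset ℕ} {l : List ℕ} {u p r : ℕ} (hlS : ∀ x ∈ l, x ∈ S)
    (hcount : ∀ x ≤ u, subsetSumCount S x < 2 ^ p) (hr : l.length * u + 1 ≤ 2 * 2 ^ r) (v : ℕ) :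
    swingNumerator S l u v < 2 ^ (p + (r + 1)) := by
  have h1 : ∀ v < l.length, swingCount S u (l.getD v 0) ≤ u * 2 ^ p := fun v hv => by
    rw [List.getD_eq_getElem _ _ hv]
    exact (swingCount_le S u _ (hlS _ (List.getElem_mem hv))).trans (countBelow_le hcount)
  have h2 : swingNumerator S l u v ≤ l.length * (u * 2 ^ p) := by
    rw [swingNumerator]
    split_ifs with hv
    · exact (h1 v hv).trans (Nat.le_mul_of_pos_left _ (by omega))
    · calc _ ≤ ∑ _v ∈ Finset.range l.length, u * 2 ^ p :=
            Finset.sum_le_sum fun v hv => h1 v (Finset.mem_range.1 hv)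
        _ = _ := by simp
  have h3 : 0 < 2 ^ p := by positivity
  calc swingNumerator S l u v ≤ l.length * u * 2 ^ p := by rw [mul_assoc]; exact h2
    _ < (2 * 2 ^ r) * 2 ^ p := Nat.mul_lt_mul_of_pos_right (by omega) h3
    _ = 2 ^ (p + (r + 1)) := by ring

theorem exec_banzhafProgram {w u : ℕ} {S : Finset ℕ} {l : List ℕ} (hS : ∀ s ∈ S, 0 < s)
    (hl : l.Nodup) (hlS : l.toFinset = S) (hlw : ∀ x ∈ l, x < 2 ^ w)
    (hX : (l.length + u + 2) ^ 1000 ≤ 2 ^ w) :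
    ∃ t σ, Exec w banzhafProgram (initState l u) t σ ∧
      (t : ℝ) ≤ 1010000 * (max (S.card : ℝ) 1 * max (u : ℝ) 1 *
        logFactor ((S.card * u : ℕ) : ℝ) ^ 2) ∧
      HoldsTable σ (l.length + 1) (swingNumerator S l u) := by
  have hcard : S.card = l.length := by rw [← hlS, List.toFinset_card_of_nodup hl]
  have hmem : ∀ x ∈ l, x ∈ S := fun x hx => hlS ▸ List.mem_toFinset.2 hx
  obtain ⟨q, hq, hrun⟩ := runs_countSubsets (s := initZState l u) hS hl hlS hlw hX rfl rfl
    (initZState_mem l u)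
  obtain ⟨r, hr1, hr2⟩ := exists_double (show 0 < 2 by norm_num) (l.length * u + 1)
  have hX2 : 2 ≤ l.length + u + 2 := by omega
  have hw0 := pos_of_pow_le hX2 hX
  obtain ⟨X, hXdef⟩ : ∃ X, X = l.length + u + 2 := ⟨_, rfl⟩
  obtain ⟨n, hn⟩ : ∃ n, n = l.length := ⟨_, rfl⟩
  -- All addresses and digit bounds that follow are at most 1000 X³, so they are words.
  have hsmall : ∀ y : ℕ, y ≤ 1000 * X ^ 3 → (y : ℤ) < 2 ^ w := fun y hy => by
    refine lt_two_pow hX2 hX ?_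
    rw [← hXdef]
    exact_mod_cast (hy.trans (mul_pow_le_pow (hXdef ▸ hX2) (by norm_num))).trans
      (Nat.pow_le_pow_right (by omega) (by norm_num))
  have hinit := toState_initZState hlw hX
  clear hX
  obtain ⟨p, hp⟩ : ∃ p, p = 2 ^ q := ⟨_, rfl⟩
  have hpX : p ≤ 2 * X := by
    rw [hp]
    exact two_pow_le_of_forall_lt (fun i hi => by have := (hq i hi).1; omega) (by omega)
  have hX23 : X ^ 2 ≤ X ^ 3 := Nat.pow_le_pow_right (by omega) (by norm_num)
  have hX12 : 2 * X ≤ X ^ 2 := by rw [sq]; exact Nat.mul_le_mul_right _ (by omega)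
  have hVX : p * (u + 1) ≤ 2 * X ^ 2 := by
    calc p * (u + 1) ≤ 2 * X * X := Nat.mul_le_mul hpX (by omega)
      _ = 2 * X ^ 2 := by ring
  have hrX : 2 ^ r ≤ X ^ 2 := by
    rcases Nat.eq_zero_or_pos r with rfl | hr
    · exact Nat.one_le_pow _ _ (by omega)
    · have h1 := hr2 (r - 1) (by omega)
      have e : 2 ^ r = 2 * 2 ^ (r - 1) := by rw [← pow_succ']; congr 1; omega
      have h2 : l.length * u ≤ X * X := Nat.mul_le_mul (by omega) (by omega)
      rw [sq]; omega
  have hr' : r < 2 ^ r := Nat.lt_two_pow_self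
  obtain ⟨L, hL⟩ : ∃ L, L = p + (r + 1) := ⟨_, rfl⟩
  have hLX : L ≤ 2 * X ^ 2 := by omega
  have hnL : (n + 1) * L ≤ 2 * X ^ 3 := by
    calc (n + 1) * L ≤ X * (2 * X ^ 2) := Nat.mul_le_mul (by omega) hLX
      _ = 2 * X ^ 3 := by ring
  have hB : 2 * (u + 1) * (u + 1) * (n + 1) ≤ 2 * X ^ 3 := by
    calc 2 * (u + 1) * (u + 1) * (n + 1) ≤ 2 * X * X * X := by gcongr <;> omega
      _ = 2 * X ^ 3 := by ring
  obtain ⟨A, hA⟩ : ∃ A, A = n + p + p * (u + 1) := ⟨_, rfl⟩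
  have hwD : ((A + p * (u + 1) + 3 * L + 1 : ℕ) : ℤ) < 2 ^ w := hsmall _ (by omega)
  have hwL : (L : ℤ) < 2 ^ w := hsmall _ (by omega)
  have hw1 : ((n + p + 2 * (p * (u + 1)) + 2 * L + 2 * 2 ^ r + p * (u + 1) : ℕ) : ℤ) < 2 ^ w :=
    hsmall _ (by omega)
  have hw2 : ((A + p * (u + 1) + u + 3 * L + 1 + (n + 1) * L +
      4 * (2 * (u + 1) * (u + 1) * (n + 1)) : ℕ) : ℤ) < 2 ^ w := hsmall _ (by omega)
  have htime := banzhaf_time_le hS (by rwa [hcard]) (by rwa [hcard])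
  clear hsmall
  have hall := fun T hT => Runs.mono (T₂ := T)
    (Q := fun s' => HoldsTable (s'.toState w) (l.length + 1) (swingNumerator S l u))
    (Runs.seq hrun fun s₁ h₁ => Runs.seq (runs_prepareSwings (r := r) hw0 h₁ hr1 hr2
      (by rw [← hn, ← hp, ← hL]; exact hw1)) fun s₂ h₂ =>
    Runs.mono (runs_writeAllSwings (p := p) (L := L) (A := A) hw0 (hp ▸ h₁.count_lt)
      (by rw [hA, hL, hp, hn]; exact h₂.1) (by omega) (by omega)
      (fun x hx => ⟨hmem x hx, hS x (hmem x hx), hlw x hx⟩) (hn ▸ hw2)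
      fun i hi => by
        rw [hA, hn, ← h₂.2 i (by omega), hL, hp]
        congr 1; push_cast; ring) le_rfl
      fun s' h => HoldsTable.of_mem hw0 h.1 h.2.1 (by exact_mod_cast hwD) (by exact_mod_cast hwL)
        (fun v hv => by
          rw [hL, hp]
          exact swingNumerator_lt hmem h₁.count_lt hr1 v) h.2.2) hT fun s' h => h
  obtain ⟨t, s', hexec, ht, hres⟩ := hall _ le_rfl
  rw [hinit] at hexec
  refine ⟨t, _, hexec, le_trans ?_ htime, hres⟩
  rw [← Finset.sum_mul, sum_getD_eq_sum (fun s => (u - 1) / s) hl hlS, hL, hp] at ht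
  rw [hcard]
  exact_mod_cast ht

theorem banzhafIndex_eq_swingNumerator {S : Finset ℕ} {l : List ℕ} (hl : l.Nodup)
    (hlS : l.toFinset = S) (u : ℕ) {i : ℕ} (hi : i < l.length) :
    banzhafIndex S u l[i] = (swingNumerator S l u i : ℚ) / 2 ^ (S.card - 1) ∧
      normalizedBanzhafIndex S u l[i] =
        (swingNumerator S l u i : ℚ) / (swingNumerator S l u S.card : ℚ) := by
  have hcard : S.card = l.length := by rw [← hlS, List.toFinset_card_of_nodup hl]
  have h1 : swingNumerator S l u i = swingCount S u l[i] := by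
    rw [swingNumerator, if_pos hi, List.getD_eq_getElem _ _ hi]
  have h2 : swingNumerator S l u S.card = ∑ s ∈ S, swingCount S u s := by
    rw [swingNumerator, if_neg (by omega), sum_getD_eq_sum (swingCount S u) hl hlS]
  rw [h1, h2, banzhafIndex, normalizedBanzhafIndex]
  push_cast
  exact ⟨rfl, rfl⟩

end WordRAM

/-! ### The two programs together -/

theorem mainTheorem8 :
    -- the subset counts for all `x ≤ u`, in time `O(n u log u log n)`
    (∃ (P : WordRAM.Cmd) (C : ℝ) (c : ℕ), ∀ (S : Finset ℕ) (l : List ℕ) (u w : ℕ),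
      (∀ s ∈ S, 0 < s) → l.Nodup → l.toFinset = S →
      (∀ s ∈ S, s < 2 ^ w) → (S.card + u + 2) ^ c ≤ 2 ^ w →
      ∃ (t : ℕ) (σ : WordRAM.State), WordRAM.Exec w P (WordRAM.initState l u) t σ ∧
        (t : ℝ) ≤ C * (max (S.card : ℝ) 1 * max (u : ℝ) 1 *
          max (Real.logb 2 u) 1 * max (Real.logb 2 S.card) 1) ∧
        WordRAM.HoldsTable σ (u + 1) (fun x => subsetSumCount S x)) ∧
    -- the Banzhaf indices of all voters, as fractions of integers, in time `O(n u log ^ k (n u))`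
    (∃ (P : WordRAM.Cmd) (C : ℝ) (c k : ℕ), ∀ (S : Finset ℕ) (l : List ℕ) (u w : ℕ),
      (∀ s ∈ S, 0 < s) → l.Nodup → l.toFinset = S →
      (∀ s ∈ S, s < 2 ^ w) → (S.card + u + 2) ^ c ≤ 2 ^ w →
      ∃ (t : ℕ) (σ : WordRAM.State) (num : ℕ → ℕ),
        WordRAM.Exec w P (WordRAM.initState l u) t σ ∧
        (t : ℝ) ≤ C * (max (S.card : ℝ) 1 * max (u : ℝ) 1 *
          (max (Real.logb 2 (S.card * u)) 1) ^ k) ∧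
        WordRAM.HoldsTable σ (S.card + 1) num ∧
        ∀ (i : ℕ) (hi : i < l.length),
          banzhafIndex S u l[i] = (num i : ℚ) / 2 ^ (S.card - 1) ∧
          normalizedBanzhafIndex S u l[i] = (num i : ℚ) / (num S.card : ℚ)) := by
  have hlist : ∀ {S : Finset ℕ} {l : List ℕ} {w : ℕ}, l.toFinset = S → (∀ s ∈ S, s < 2 ^ w) →
      ∀ x ∈ l, x < 2 ^ w := fun hlS hw x hx => hw x (hlS ▸ List.mem_toFinset.2 hx)
  have hcard : ∀ {S : Finset ℕ} {l : List ℕ}, l.Nodup → l.toFinset = S → l.length = S.card :=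
    fun hl hlS => by rw [← hlS, List.toFinset_card_of_nodup hl]
  constructor
  -- The word-size exponent 1000 is generous: the largest requirement is (4V)^80 with V ≤ 2
  -- (n+u+2)², which is below (n+u+2)^900.
  · refine ⟨WordRAM.subsetSumProgram, 1000010, 1000, fun S l u w hS hl hlS hw hX => ?_⟩
    rw [← hcard hl hlS] at hX ⊢
    exact WordRAM.exec_subsetSumProgram hS hl hlS (hlist hlS hw) hX
  -- The exponent 2 of the logarithm comes from the product tree: O(log n) levels, each with a
  -- factor O(log u) for the transforms.
  · refine ⟨WordRAM.banzhafProgram, 1010000, 1000, 2, fun S l u w hS hl hlS hw hX => ?_⟩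
    rw [← hcard hl hlS] at hX
    obtain ⟨t, σ, h1, h2, h3⟩ := WordRAM.exec_banzhafProgram hS hl hlS (hlist hlS hw) hX
    refine ⟨t, σ, WordRAM.swingNumerator S l u, h1, ?_, hcard hl hlS ▸ h3,
      fun i hi => WordRAM.banzhafIndex_eq_swingNumerator hl hlS u hi⟩
    push_cast at h2
    exact h2
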